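/- Let $(M,g)$ be a spacetime (a connected, time-oriented smooth Lorentzian manifold of dimension $n\ge 3$), let $L\subset M$ be a null hypersurface (an embedded codimension-one smooth submanifold on which $g$ induces an everywhere degenerate form), and let $\xi\in\mathfrak X(L)$ be a future-directed null section, i.e. a smooth tangent vector field on $L$ whose values are future-directed null vectors. Its surface gravity is the function $\kappa_\xi$ on $L$ with $\nabla_\xi\xi=\kappa_\xi\,\xi$, where $\nabla$ is the Levi-Civita connection. Let $\Phi_\xi:\mathcal A_\xi\to L$ be the flow of $\xi$ on its maximal domain $\mathcal A_\xi\subset L\times\mathbb R$, let $\mathcal B_\xi$ be the set of all $(x,s)\in L\times\mathbb R$ such that $\exp(s\xi_x)$ is defined and lies in $L$, put $\Psi_\xi(x,s)=\exp(s\xi_x)$ for $(x,s)\in\mathcal B_\xi$, and let $$b^+_\xi(x)=\sup\{t>0:\{x\}\times[0,t)\subset\mathcal A_\xi\},\quad \Lambda^+_\xi(x)=\sup\{s>0:\{x\}\times[0,s)\subset\mathcal B_\xi\},\quad \Lambda^-_\xi(x)=\inf\{s<0:\{x\}\times(s,0]\subset\mathcal B_\xi\},$$ so that $b^+_\xi,\Lambda^+_\xi$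 take values in $(0,\infty]$ and $\Lambda^-_\xi$ takes values in $[-\infty,0)$. The null geodesic generator of $L$ through $x$ is the maximal integral curve of $\xi$ through $x$ (up to parametrization). Then: 1. Let $x\in L$ and $s\in(\Lambda^-_\xi(x),\Lambda^+_\xi(x))$. If $\Lambda^+_\xi$ is finite and smooth on an open neighbourhood $\mathcal V\subset L$ of $\Psi_\xi(x,s)$, then it is finite and smooth on some open neighbourhood $\mathcal U\subset L$ of $x$. 2. If $\Lambda^+_\xi$ is finite and smooth on an open set $\mathcal U\subset L$, then $$\xi(\Lambda^+_\xi)+\kappa_\xi\,\Lambda^+_\xi+1=0\quad\text{on }\mathcal U .$$ In particular, $\eta=\Lambda^+_\xi\,\xi$ is a future-directed null section on $\mathcal U$ with $\kappa_\eta=-1$ on $\mathcal U$. Moreover, the union $\widehat{\mathcal U}=\{\Phi_\xi(x,t):x\in\mathcal U,\ t\ge 0,\ (x,t)\in\mathcal A_\xi\}$ of the future generator segments issuing from $\mathcal U$ is open, $\Lambda^+_\xi$ is finite and smooth on $\widehat{\mathcal U}$, and for $\eta=\Lambda^+_\xi\,\xi$ considered as a vector field on $\widehat{\mathcal U}$ one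 has $b^+_\eta(x)=\infty$ for every $x\in\mathcal U$. 3. If $\kappa_\xi$ is constant along the null geodesic generator through $x\in L$, then $$\Lambda^+_\xi(x)=\begin{cases}\dfrac{e^{b^+_\xi(x)\kappa_\xi(x)}-1}{\kappa_\xi(x)} & \text{if } b^+_\xi(x)<\infty \text{ and } \kappa_\xi(x)\ne 0,\\[2mm] b^+_\xi(x) & \text{if } b^+_\xi(x)<\infty \text{ and } \kappa_\xi(x)=0,\\[1mm] -\dfrac1{\kappa_\xi(x)} & \text{if } b^+_\xi(x)=\infty \text{ and } \kappa_\xi(x)<0,\\[2mm] \infty & \text{if } b^+_\xi(x)=\infty\text{ and }\kappa_\xi(x)\ge 0.\end{cases}$$ In particular, if $b^+_\xi\equiv\infty$ (i.e. $\xi$ is future complete) and $\kappa_\xi$ is a negative constant along each null geodesic generator (the constant may depend on the generator), then $\Lambda^+_\xi$ is finite and smooth on $L$. 4. If $\Lambda^-_\xi$ and $\Lambda^+_\xi$ are finite and smooth on $L$, then $\eta=(\Lambda^+_\xi-\Lambda^-_\xi)\,\xi$ is a future-directed null section on $L$ and it is geodesic: $\nabla_\eta\eta=0$. -/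

import Mathlib

open Set Manifold Bundle
open scoped ContDiff Topology

/-! ## Spacetimes -/

/-- A smooth Lorentzian metric on `M`: a smooth field of symmetric bilinear forms on the tangent
spaces, each of signature `(-,+,…,+)`, that is, some vector has negative square and the form is
positive definite on the orthogonal complement of that vector. -/
structure LorentzianMetric (E : Type*) [NormedAddCommGroup E] [NormedSpace ℝ E]
    (M : Type*) [TopologicalSpace M] [ChartedSpace E M] [IsManifold 𝓘(ℝ, E) ∞ M] where
  inner (p : M) : TangentSpace 𝓘(ℝ, E) p →L[ℝ] TangentSpace 𝓘(ℝ, E) p →L[ℝ] ℝ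
  symm (p : M) (v w : TangentSpace 𝓘(ℝ, E) p) : inner p v w = inner p w v
  lorentzian (p : M) : ∃ v : TangentSpace 𝓘(ℝ, E) p, inner p v v < 0 ∧
    ∀ w : TangentSpace 𝓘(ℝ, E) p, inner p v w = 0 → w ≠ 0 → 0 < inner p w w
  contMDiff : ContMDiff 𝓘(ℝ, E) (𝓘(ℝ, E).prod 𝓘(ℝ, E →L[ℝ] E →L[ℝ] ℝ)) ∞
    (fun p : M ↦ TotalSpace.mk' (E →L[ℝ] E →L[ℝ] ℝ)
      (E := fun p : M ↦ TangentSpace 𝓘(ℝ, E) p →L[ℝ] TangentSpace 𝓘(ℝ, E) p →L[ℝ] ℝ) p (inner p))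

/-- A Lorentzian metric with a time orientation, the latter being given by a smooth timelike
vector field, which by definition is future-directed. -/
structure TimeOrientedLorentzianMetric (E : Type*) [NormedAddCommGroup E] [NormedSpace ℝ E]
    (M : Type*) [TopologicalSpace M] [ChartedSpace E M] [IsManifold 𝓘(ℝ, E) ∞ M]
    extends LorentzianMetric E M where
  timeField (p : M) : TangentSpace 𝓘(ℝ, E) p
  contMDiff_timeField : ContMDiff 𝓘(ℝ, E) 𝓘(ℝ, E).tangent ∞
    (fun p : M ↦ (⟨p, timeField p⟩ : TangentBundle 𝓘(ℝ, E) M))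
  timelike_timeField (p : M) : inner p (timeField p) (timeField p) < 0

noncomputable section

section Connection

variable {E : Type*} [NormedAddCommGroup E] [NormedSpace ℝ E]
  {M : Type*} [TopologicalSpace M] [ChartedSpace E M] [IsManifold 𝓘(ℝ, E) ∞ M]

namespace LorentzianMetric

/-- The metric at `p`, as a bilinear form on the model space (which is the tangent space at `p`
read in the preferred chart at `p`). -/
def bilinForm (g : LorentzianMetric E M) (p : M) : LinearMap.BilinForm ℝ E :=
  ContinuousLinearMap.toBilinForm (E := E) (g.inner p)

theorem nondegenerate_bilinForm (g : LorentzianMetric E M) (p : M) :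
    (g.bilinForm p).Nondegenerate := by
  obtain ⟨v, hv, hpos⟩ := g.lorentzian p
  have key : ∀ u : TangentSpace 𝓘(ℝ, E) p, (∀ w, g.inner p u w = 0) → u = 0 := by
    intro u hu
    by_contra hne
    have h1 : g.inner p v u = 0 := by rw [g.symm]; exact hu v
    have h2 := hpos u h1 hne
    rw [hu u] at h2
    exact lt_irrefl _ h2
  exact ⟨fun u hu ↦ key u fun w ↦ hu w, fun u hu ↦ key u fun w ↦ (g.symm p u w).trans (hu w)⟩

/-- The components of the metric near `p` with respect to the coordinate vector fields of the
preferred chart at `p`, as a function of the point `q`. -/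
def inCoordinates (g : LorentzianMetric E M) (p q : M) : E →L[ℝ] E →L[ℝ] ℝ :=
  let A : E →L[ℝ] E := (trivializationAt E (TangentSpace 𝓘(ℝ, E)) p).symmL ℝ q
  ContinuousLinearMap.bilinearComp (E := E) (F := E) (g.inner q) A A

/-- The derivative at `p` of the components of the metric in the preferred chart at `p`:
`g.derivInCoordinates p u v w = ∂ᵤ (g(v, w))`. -/
def derivInCoordinates (g : LorentzianMetric E M) (p : M) : E →L[ℝ] E →L[ℝ] E →L[ℝ] ℝ :=
  mfderiv 𝓘(ℝ, E) 𝓘(ℝ, E →L[ℝ] E →L[ℝ] ℝ) (g.inCoordinates p) p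

/-- Christoffel symbols of the first kind at `p` in the preferred chart at `p`:
`w ↦ (∂ᵤ g(v, w) + ∂ᵥ g(u, w) - ∂_w g(u, v)) / 2`. -/
def christoffelFirst (g : LorentzianMetric E M) (p : M) (u v : E) : E →L[ℝ] ℝ :=
  (1 / 2 : ℝ) • (g.derivInCoordinates p u v + g.derivInCoordinates p v u
    - ((g.derivInCoordinates p).flip u).flip v)

/-- Christoffel symbols (of the second kind) of the Levi-Civita connection at `p`, in the
preferred chart at `p`: the vector `Γ(u, v)` with `g(Γ(u, v), w) = christoffelFirst u v w` for
every `w`. -/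
def christoffel [FiniteDimensional ℝ E] (g : LorentzianMetric E M) (p : M) (u v : E) : E :=
  ((g.bilinForm p).toDual (g.nondegenerate_bilinForm p)).symm
    (g.christoffelFirst p u v : E →ₗ[ℝ] ℝ)

/-- The Levi-Civita covariant derivative `∇_v V` at `x`, in the direction `v ∈ T_x N`, of a vector
field `V` along a map `f : N → M`: in the preferred chart at `f x` it is
`dV(v) + Γ(df(v), V)`. -/
def covDerivAlong [FiniteDimensional ℝ E] (g : LorentzianMetric E M)
    {F : Type*} [NormedAddCommGroup F] [NormedSpace ℝ F]
    {N : Type*} [TopologicalSpace N] [ChartedSpace F N]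
    (f : N → M) (V : ∀ x : N, TangentSpace 𝓘(ℝ, E) (f x))
    (x : N) (v : TangentSpace 𝓘(ℝ, F) x) : TangentSpace 𝓘(ℝ, E) (f x) :=
  let Vcoord : N → E := fun y ↦
    (trivializationAt E (TangentSpace 𝓘(ℝ, E)) (f x)).continuousLinearMapAt ℝ (f y) (V y)
  let dVcoord : TangentSpace 𝓘(ℝ, F) x →L[ℝ] E := mfderiv 𝓘(ℝ, F) 𝓘(ℝ, E) Vcoord x
  dVcoord v + g.christoffel (f x) (mfderiv 𝓘(ℝ, F) 𝓘(ℝ, E) f x v) (V x)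

end LorentzianMetric

/-- The velocity of a curve. -/
def curveVelocity (γ : ℝ → M) (t : ℝ) : TangentSpace 𝓘(ℝ, E) (γ t) :=
  mfderiv 𝓘(ℝ, ℝ) 𝓘(ℝ, E) γ t (1 : ℝ)

namespace LorentzianMetric

variable [FiniteDimensional ℝ E] (g : LorentzianMetric E M)

/-- `γ` is an (affinely parametrized) geodesic on the open set of times `s`. -/
def IsGeodesicOn (γ : ℝ → M) (s : Set ℝ) : Prop :=
  ContMDiffOn 𝓘(ℝ, ℝ) 𝓘(ℝ, E) ∞ γ s ∧
    ∀ t ∈ s, g.covDerivAlong γ (curveVelocity γ) t (1 : ℝ) = 0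

/-- `γ` is a geodesic, on an open interval that contains `[0, 1]`, with initial velocity `v`. -/
def IsGeodesicFrom (v : TangentBundle 𝓘(ℝ, E) M) (γ : ℝ → M) : Prop :=
  ∃ a b : ℝ, a < 0 ∧ 1 < b ∧ g.IsGeodesicOn γ (Ioo a b) ∧
    (⟨γ 0, curveVelocity γ 0⟩ : TangentBundle 𝓘(ℝ, E) M) = v

/-- The maximal domain of the exponential map, a subset of the tangent bundle. -/
def expDomain : Set (TangentBundle 𝓘(ℝ, E) M) :=
  {v | ∃ γ : ℝ → M, g.IsGeodesicFrom v γ}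

open Classical in
/-- The exponential map; outside of `expDomain` the value is irrelevant. -/
def exp (v : TangentBundle 𝓘(ℝ, E) M) : M :=
  if h : ∃ γ : ℝ → M, g.IsGeodesicFrom v γ then h.choose 1 else v.proj

end LorentzianMetric

end Connection

/-! ## Flows of vector fields -/

section Flow

variable {F : Type*} [NormedAddCommGroup F] [NormedSpace ℝ F]
  {L : Type*} [TopologicalSpace L] [ChartedSpace F L]

/-- `γ` is an integral curve, with values in `U`, of the vector field `ξ`, defined on an open
interval that contains `0` and `t`, and it starts at `x`. -/
def IsIntegralCurveFrom (ξ : ∀ x : L, TangentSpace 𝓘(ℝ, F) x) (U : Set L) (x : L) (t : ℝ)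
    (γ : ℝ → L) : Prop :=
  ∃ a b : ℝ, a < 0 ∧ 0 < b ∧ t ∈ Ioo a b ∧ γ 0 = x ∧ MapsTo γ (Ioo a b) U ∧
    IsMIntegralCurveOn γ ξ (Ioo a b)

/-- The maximal domain of the flow of the restriction of `ξ` to the open set `U`. -/
def flowDomain (ξ : ∀ x : L, TangentSpace 𝓘(ℝ, F) x) (U : Set L) : Set (L × ℝ) :=
  {z | ∃ γ : ℝ → L, IsIntegralCurveFrom ξ U z.1 z.2 γ}

open Classical in
/-- The flow `Φ` of the vector field `ξ` on `L`; outside of `flowDomain ξ univ` the value is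
irrelevant. -/
def flow (ξ : ∀ x : L, TangentSpace 𝓘(ℝ, F) x) (x : L) (t : ℝ) : L :=
  if h : ∃ γ : ℝ → L, IsIntegralCurveFrom ξ univ x t γ then h.choose t else x

/-- The final parameter function `b⁺` of the restriction of `ξ` to the open set `U`, with values
in `(0, ∞]` at the points of `U`. -/
def finalParameter (ξ : ∀ x : L, TangentSpace 𝓘(ℝ, F) x) (U : Set L) (x : L) : EReal :=
  sSup {r : EReal | ∃ t : ℝ, r = t ∧ 0 < t ∧ ∀ u ∈ Ico 0 t, (x, u) ∈ flowDomain ξ U}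

/-- The (image of the) maximal integral curve of `ξ` through `x`. For a null section `ξ` this is
the null geodesic generator through `x`. -/
def generator (ξ : ∀ x : L, TangentSpace 𝓘(ℝ, F) x) (x : L) : Set L :=
  {y | ∃ t : ℝ, (x, t) ∈ flowDomain ξ univ ∧ flow ξ x t = y}

/-- The union of the forward orbits under the flow of `ξ` of the points of `U`. -/
def futureSaturation (ξ : ∀ x : L, TangentSpace 𝓘(ℝ, F) x) (U : Set L) : Set L :=
  {y | ∃ x ∈ U, ∃ t : ℝ, 0 ≤ t ∧ (x, t) ∈ flowDomain ξ univ ∧ flow ξ x t = y}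

/-- The derivative `v(f)` of a function `f` in the direction of a tangent vector `v` at `x`. -/
def directionalDeriv (f : L → ℝ) (x : L) (v : TangentSpace 𝓘(ℝ, F) x) : ℝ :=
  mfderiv 𝓘(ℝ, F) 𝓘(ℝ, ℝ) f x v

/-- An extended-real-valued function is finite and smooth on `U`. -/
def FiniteSmoothOn (F : Type*) [NormedAddCommGroup F] [NormedSpace ℝ F]
    {L : Type*} [TopologicalSpace L] [ChartedSpace F L] (f : L → EReal) (U : Set L) : Prop :=
  (∀ x ∈ U, f x ≠ ⊤ ∧ f x ≠ ⊥) ∧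
    ContMDiffOn 𝓘(ℝ, F) 𝓘(ℝ, ℝ) ∞ (fun x ↦ (f x).toReal) U

end Flow

/-! ## Null hypersurfaces -/

section NullHypersurface

variable {E : Type*} [NormedAddCommGroup E] [NormedSpace ℝ E]
  {M : Type*} [TopologicalSpace M] [ChartedSpace E M] [IsManifold 𝓘(ℝ, E) ∞ M]
  {F : Type*} [NormedAddCommGroup F] [NormedSpace ℝ F]
  {L : Type*} [TopologicalSpace L] [ChartedSpace F L]

/-- `i : L → M` is a smooth embedding of codimension one for which the induced metric is
everywhere degenerate: a null hypersurface. -/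
structure IsNullHypersurface (F : Type*) [NormedAddCommGroup F] [NormedSpace ℝ F]
    {L : Type*} [TopologicalSpace L] [ChartedSpace F L] (g : LorentzianMetric E M) (i : L → M) : Prop where
  isSmoothEmbedding : IsSmoothEmbedding 𝓘(ℝ, F) 𝓘(ℝ, E) ∞ i
  codim_one : Module.finrank ℝ F + 1 = Module.finrank ℝ E
  degenerate (x : L) : ∃ v : TangentSpace 𝓘(ℝ, F) x, v ≠ 0 ∧ ∀ w : TangentSpace 𝓘(ℝ, F) x,
    g.inner (i x) (mfderiv 𝓘(ℝ, F) 𝓘(ℝ, E) i x v) (mfderiv 𝓘(ℝ, F) 𝓘(ℝ, E) i x w) = 0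

/-- A vector field on `L`, pushed forward to a vector field along `i : L → M`. -/
def pushSection (E : Type*) [NormedAddCommGroup E] [NormedSpace ℝ E]
    {M : Type*} [TopologicalSpace M] [ChartedSpace E M]
    {F : Type*} [NormedAddCommGroup F] [NormedSpace ℝ F]
    {L : Type*} [TopologicalSpace L] [ChartedSpace F L]
    (i : L → M) (ξ : ∀ x : L, TangentSpace 𝓘(ℝ, F) x) (x : L) : TangentSpace 𝓘(ℝ, E) (i x) :=
  mfderiv 𝓘(ℝ, F) 𝓘(ℝ, E) i x (ξ x)

/-- The tangent vector `s ξ_x` of `M`. -/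
def scaledVector (E : Type*) [NormedAddCommGroup E] [NormedSpace ℝ E]
    {M : Type*} [TopologicalSpace M] [ChartedSpace E M]
    {F : Type*} [NormedAddCommGroup F] [NormedSpace ℝ F]
    {L : Type*} [TopologicalSpace L] [ChartedSpace F L]
    (i : L → M) (ξ : ∀ x : L, TangentSpace 𝓘(ℝ, F) x) (x : L) (s : ℝ) : TangentBundle 𝓘(ℝ, E) M :=
  ⟨i x, s • pushSection E i ξ x⟩

/-- `ξ` is a future-directed null section on the open subset `U` of the null hypersurface: a smooth
tangent vector field there whose values are (nonzero) null vectors that are future-directed. -/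
structure IsFutureNullSectionOn [IsManifold 𝓘(ℝ, F) ∞ L]
    (g : TimeOrientedLorentzianMetric E M) (i : L → M) (ξ : ∀ x : L, TangentSpace 𝓘(ℝ, F) x) (U : Set L) : Prop where
  smooth : ContMDiffOn 𝓘(ℝ, F) 𝓘(ℝ, F).tangent ∞
    (fun x : L ↦ (⟨x, ξ x⟩ : TangentBundle 𝓘(ℝ, F) L)) U
  null (x : L) (hx : x ∈ U) : ξ x ≠ 0 ∧
    g.inner (i x) (pushSection E i ξ x) (pushSection E i ξ x) = 0
  future (x : L) (hx : x ∈ U) : g.inner (i x) (pushSection E i ξ x) (g.timeField (i x)) < 0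

namespace LorentzianMetric

variable [FiniteDimensional ℝ E] (g : LorentzianMetric E M) (i : L → M)
  (ξ : ∀ x : L, TangentSpace 𝓘(ℝ, F) x)

/-- `∇_ξ ξ`, as a vector field along `i : L → M`. -/
def sectionAccel (x : L) : TangentSpace 𝓘(ℝ, E) (i x) :=
  g.covDerivAlong i (pushSection E i ξ) x (ξ x)

open Classical in
/-- The surface gravity `κ` of a null section `ξ`: the function with `∇_ξ ξ = κ ξ`. -/
def surfaceGravity (x : L) : ℝ :=
  if h : ∃ c : ℝ, g.sectionAccel i ξ x = c • pushSection E i ξ x then h.choose else 0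

/-- The set of all `(x, s)` for which `exp (s ξ_x)` is defined and lies in the hypersurface. -/
def affineDomain : Set (L × ℝ) :=
  {z | scaledVector E i ξ z.1 z.2 ∈ g.expDomain ∧ g.exp (scaledVector E i ξ z.1 z.2) ∈ range i}

open Classical in
/-- `Ψ(x, s) = exp (s ξ_x)`, as a point of `L`; outside of `affineDomain` the value is
irrelevant. -/
def affineFlow (x : L) (s : ℝ) : L :=
  if h : ∃ y : L, i y = g.exp (scaledVector E i ξ x s) then h.choose else x

/-- The future affine length function `Λ⁺`, with values in `(0, ∞]`. -/
def futureAffineLength (x : L) : EReal :=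
  sSup {r : EReal | ∃ s : ℝ, r = s ∧ 0 < s ∧ ∀ u ∈ Ico 0 s, (x, u) ∈ g.affineDomain i ξ}

/-- The past affine length function `Λ⁻`, with values in `[-∞, 0)`. -/
def pastAffineLength (x : L) : EReal :=
  sInf {r : EReal | ∃ s : ℝ, r = s ∧ s < 0 ∧ ∀ u ∈ Ioc s 0, (x, u) ∈ g.affineDomain i ξ}

/-- The vector field `Λ⁺ ξ`, at the points where `Λ⁺` is finite. -/
def futureRescaledSection (x : L) : TangentSpace 𝓘(ℝ, F) x :=
  (g.futureAffineLength i ξ x).toReal • ξ x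

/-- The vector field `(Λ⁺ - Λ⁻) ξ`, at the points where `Λ⁺` and `Λ⁻` are finite. -/
def doublyRescaledSection (x : L) : TangentSpace 𝓘(ℝ, F) x :=
  ((g.futureAffineLength i ξ x).toReal - (g.pastAffineLength i ξ x).toReal) • ξ x

end LorentzianMetric

end NullHypersurface

end

/-! Along the integral curve `Φ(x, ·)` of `ξ`, with maximal interval `I_x`, put `K(x, t) = ∫₀ᵗ
κ(Φ(x, r)) dr` and `S(x, t) = ∫₀ᵗ exp K(x, r) dr` (`flowIntegral`, `affineParameter`). Since `∇_ξ ξ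
= κ ξ`, using `S` as parameter removes the tangential acceleration. So `s ↦ Φ(x, S(x, ·)⁻¹(s))` is
the geodesic with initial velocity `ξ_x`, defined on the open interval `J_x = S(x, I_x)`
(`affineInterval`).

The geometric core is that `exp(s ξ_x)` cannot stay in `L` from `0` up to some `s` outside `J_x`. If
the geodesic were still in `L` at an endpoint of `J_x`, at a point `y` say, then embeddedness makes
the generator converge to `y` in `L`, and the velocity there is a multiple of `ξ_y` as a limit of
multiples of `ξ`. By uniqueness the geodesic then runs along the generator of `y`, so the integral
curve of `x` continues to `y`, and the endpoint belongs to `J_x`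
(`mem_affineInterval_of_mem_closure`). Hence `Λ⁺(x) = sup J_x` and `Λ⁻(x) = inf J_x`.

The cocycle rules for `K` and `S` give `J_x = S(x, t) + exp K(x, t) · J_{Φ(x, t)}`, hence the
transport formula `Λ±(x) = S(x, t) + exp K(x, t) · Λ±(Φ(x, t))`, from which the rest follows.
Smoothness of `Φ(·, t)`, `K(·, t)` and `S(·, t)` carries smoothness of `Λ⁺` along generators in both
directions. Differentiation at `t = 0` gives `ξ(Λ±) + κ Λ± + 1 = 0`; with `κ_{fξ} = ξ(f) + κ f` this
yields `κ = -1` for `Λ⁺ ξ`, and subtracting the two equations makes `(Λ⁺ - Λ⁻) ξ` geodesic. The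
integral curve of `Λ⁺ ξ` is the affine geodesic at the parameter `Λ⁺(x) (1 - exp(-τ))`, which stays
below `Λ⁺(x)` for all `τ ≥ 0`. For constant `κ` the integral `S` is elementary.

Two ingredients are prepared beforehand. The field `∇_ξ ξ` is a multiple of `ξ` with smooth factor:
in coordinates its lowered form is the Euler-Lagrange expression of the energy, which is independent
of the chart and vanishes on vectors tangent to `L` because `ξ` spans the kernel of the induced
metric. Smooth dependence of flows on initial values comes from the inverse function theorem,
applied to the integral equation on `C([0, 1], E)`. -/

/-! ## Smooth dependence of solutions of ordinary differential equations on the initial value -/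

/-! ### Smoothness of superposition operators on spaces of continuous maps. -/

section Superposition

universe u
variable {K : Type*} [TopologicalSpace K] [CompactSpace K]
  {E G H : Type u} [NormedAddCommGroup E] [NormedSpace ℝ E] [NormedAddCommGroup G] [NormedSpace ℝ G]
  [NormedAddCommGroup H] [NormedSpace ℝ H]

/-- The pointwise application of a bilinear map to continuous functions. -/
noncomputable def pointwiseBilinear (K : Type*) [TopologicalSpace K] [CompactSpace K]
    (b : H →L[ℝ] E →L[ℝ] G) : C(K, H) →L[ℝ] C(K, E) →L[ℝ] C(K, G) :=
  LinearMap.mkContinuous₂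
    (LinearMap.mk₂ ℝ (fun (A : C(K, H)) (γ : C(K, E)) ↦
        (⟨fun k ↦ b (A k) (γ k), by fun_prop⟩ : C(K, G)))
      (fun A B γ ↦ by ext; simp) (fun c A γ ↦ by ext; simp)
      (fun A γ δ ↦ by ext; simp) (fun c A γ ↦ by ext; simp)) ‖b‖
    (fun A γ ↦ by
      rw [ContinuousMap.norm_le _ (by positivity)]
      intro k
      refine (b.le_opNorm₂ (A k) (γ k)).trans ?_
      gcongr
      · exact A.norm_coe_le_norm k
      · exact γ.norm_coe_le_norm k)

@[simp]
theorem pointwiseBilinear_apply (b : H →L[ℝ] E →L[ℝ] G) (A : C(K, H)) (γ : C(K, E)) (k : K) :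
    pointwiseBilinear K b A γ k = b (A k) (γ k) := rfl

/-- The mean value inequality is applied pointwise, with a bound uniform in `k`. The derivative is
given as `b ∘ v'` with values of `v'` in an abstract space `H`; the case that matters is `H = E
→L[ℝ] G` with `b` the identity. -/
theorem hasFDerivAt_postcomp (b : H →L[ℝ] E →L[ℝ] G) (hb : ∀ h, ‖b h‖ ≤ ‖h‖) (v : C(E, G))
    (v' : C(E, H)) (hv : ∀ x, HasFDerivAt v (b (v' x)) x) (γ : C(K, E)) :
    HasFDerivAt (fun δ : C(K, E) ↦ v.comp δ) (pointwiseBilinear K b (v'.comp γ)) γ := by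
  rw [hasFDerivAt_iff_isLittleO, Asymptotics.isLittleO_iff]
  intro c hc
  have hcont : Continuous fun δ : C(K, E) ↦ v'.comp δ := ContinuousMap.continuous_postcomp v'
  obtain ⟨r, hr, hball⟩ := Metric.continuousAt_iff.1 (hcont.continuousAt (x := γ)) c hc
  filter_upwards [Metric.ball_mem_nhds γ hr] with δ hδ
  rw [ContinuousMap.norm_le _ (by positivity)]
  intro k
  have hseg : ∀ y ∈ segment ℝ (γ k) (δ k), ‖b (v' y) - b (v' (γ k))‖ ≤ c := by
    intro y hy
    obtain ⟨s, hs, rfl⟩ := (segment_eq_image' ℝ (γ k) (δ k)).subset hy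
    -- The point of the segment is a value of the map `γ + s • (δ - γ)`, which is uniformly close to
    -- `γ`. Continuity of `v'.comp` at `γ` thus replaces uniform continuity of `v'` near the compact
    -- image of `γ`.
    have h1 : dist (γ + s • (δ - γ)) γ < r := by
      rw [dist_eq_norm, add_sub_cancel_left, norm_smul, Real.norm_of_nonneg hs.1, ← dist_eq_norm]
      exact (mul_le_of_le_one_left dist_nonneg hs.2).trans_lt hδ
    have h2 := (ContinuousMap.dist_apply_le_dist (f := v'.comp (γ + s • (δ - γ)))
      (g := v'.comp γ) k).trans (hball h1).le
    rw [← map_sub]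
    exact (hb _).trans (by simpa [dist_eq_norm] using h2)
  have key := (convex_segment (γ k) (δ k)).norm_image_sub_le_of_norm_hasFDerivWithin_le'
    (f := v) (f' := fun x ↦ b (v' x)) (φ := b (v' (γ k)))
    (fun y _ ↦ (hv y).hasFDerivWithinAt) hseg
    (left_mem_segment ℝ _ _) (right_mem_segment ℝ _ _)
  calc _ ≤ c * ‖δ k - γ k‖ := by simpa using key
    _ ≤ c * ‖δ - γ‖ := by
      gcongr
      exact (δ - γ).norm_coe_le_norm k

/-- The derivative of composition with `v` is pointwise application of the composition with `fderiv
ℝ v`. The induction must therefore vary the target space, which passes from `G` to `E →L[ℝ] G`. -/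
theorem contDiff_postcomp_nat (n : ℕ) : ∀ {G : Type u} [NormedAddCommGroup G] [NormedSpace ℝ G]
    (v : C(E, G)), ContDiff ℝ n v → ContDiff ℝ n (fun δ : C(K, E) ↦ v.comp δ) := by
  induction n with
  | zero =>
    intro G _ _ v _
    exact contDiff_zero.2 (ContinuousMap.continuous_postcomp v)
  | succ n ih =>
    intro G _ _ v hv
    have hv' : ContDiff ℝ (n + 1) v := by exact_mod_cast hv
    have h0 : ContDiff ℝ n (fderiv ℝ v) := hv'.fderiv_right (m := n) le_rfl
    have h2 : ∀ x, HasFDerivAt v (fderiv ℝ v x) x := fun x ↦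
      (hv'.differentiable (by simp) x).hasFDerivAt
    have key : ∀ {H : Type u} [NormedAddCommGroup H] [NormedSpace ℝ H] (b : H →L[ℝ] E →L[ℝ] G)
        (_ : ∀ h, ‖b h‖ ≤ ‖h‖) (w : E → H) (_ : ContDiff ℝ n w)
        (_ : ∀ x, HasFDerivAt v (b (w x)) x),
        ContDiff ℝ (n + 1) (fun δ : C(K, E) ↦ v.comp δ) := by
      intro H _ _ b hb w hw hvw
      refine contDiff_succ_iff_hasFDerivAt.2
        ⟨fun γ ↦ pointwiseBilinear K b ((⟨w, hw.continuous⟩ : C(E, H)).comp γ), ?_,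
          fun γ ↦ hasFDerivAt_postcomp b hb v ⟨w, hw.continuous⟩ hvw γ⟩
      exact (pointwiseBilinear K b).contDiff.comp (ih ⟨w, hw.continuous⟩ hw)
    push_cast
    exact key (.id ℝ _) (fun h ↦ le_rfl) (fderiv ℝ v) h0 h2

/-- The superposition operator of a smooth map is smooth. -/
theorem contDiff_postcomp (v : C(E, G)) (hv : ContDiff ℝ ∞ v) :
    ContDiff ℝ ∞ (fun δ : C(K, E) ↦ v.comp δ) :=
  contDiff_infty.2 fun n ↦ contDiff_postcomp_nat n v (contDiff_infty.1 hv n)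

end Superposition

/-! ### Smooth local flows from the integral equation. -/

section LocalFlow

variable {E : Type*} [NormedAddCommGroup E] [NormedSpace ℝ E]

/-- The primitive that vanishes at `0`, as an operator on continuous functions on `[0, 1]`. -/
noncomputable def primitiveOperator (E : Type*) [NormedAddCommGroup E] [NormedSpace ℝ E] :
    C(unitInterval, E) →L[ℝ] C(unitInterval, E) :=
  LinearMap.mkContinuous
    { toFun := fun γ ↦ ⟨fun t ↦ ∫ u in (0 : ℝ)..t, γ (projIcc 0 1 zero_le_one u),
        (intervalIntegral.continuous_primitive
          (fun a b ↦ (by fun_prop : Continuous fun u ↦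
            γ (projIcc 0 1 zero_le_one u)).intervalIntegrable a b) 0).comp continuous_subtype_val⟩
      map_add' := fun γ δ ↦ by
        ext t
        exact intervalIntegral.integral_add
          ((by fun_prop : Continuous fun u ↦ γ (projIcc 0 1 zero_le_one u)).intervalIntegrable _ _)
          ((by fun_prop : Continuous fun u ↦ δ (projIcc 0 1 zero_le_one u)).intervalIntegrable _ _)
      map_smul' := fun c γ ↦ by
        ext t
        exact intervalIntegral.integral_smul c _ } 1
    (fun γ ↦ by
      rw [one_mul, ContinuousMap.norm_le _ (norm_nonneg _)]
      intro t
      refine (intervalIntegral.norm_integral_le_of_norm_le_const (C := ‖γ‖)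
        fun u _ ↦ γ.norm_coe_le_norm _).trans ?_
      rw [sub_zero, abs_of_nonneg t.2.1]
      exact mul_le_of_le_one_right (norm_nonneg _) t.2.2)

/-- The map `(x, ε, γ) ↦ (x, ε, γ - x - ε ∫ v ∘ γ)`, which vanishes in the last component if and
only if `γ` solves `γ' = ε v(γ)` with initial value `x`. -/
noncomputable def integralEquationMap (v : C(E, E)) (q : E × ℝ × C(unitInterval, E)) :
    E × ℝ × C(unitInterval, E) :=
  (q.1, q.2.1, q.2.2 - ContinuousLinearMap.const ℝ unitInterval q.1
    - q.2.1 • primitiveOperator E (v.comp q.2.2))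

theorem contDiff_integralEquationMap (v : C(E, E)) (hv : ContDiff ℝ ∞ v) :
    ContDiff ℝ ∞ (integralEquationMap v) := by
  have h := contDiff_postcomp (K := unitInterval) v hv
  unfold integralEquationMap
  refine contDiff_fst.prodMk (contDiff_snd.fst.prodMk (ContDiff.sub (ContDiff.sub contDiff_snd.snd
    ((ContinuousLinearMap.contDiff _).comp contDiff_fst)) ?_))
  exact contDiff_snd.fst.smul
    ((primitiveOperator E).contDiff.comp (h.comp contDiff_snd.snd))

section

/-- At `ε = 0` the nonlinear term contributes only through its `ε`-derivative `w`. The differential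
is then the shear `(a, b, c) ↦ (a, b, c - a - b w)`, whose inverse is the shear with the opposite
sign. -/
theorem hasFDerivAt_integralEquationMap (v : C(E, E)) (hv : ContDiff ℝ ∞ v) (x : E) :
    ∃ A : (E × ℝ × C(unitInterval, E)) ≃L[ℝ] (E × ℝ × C(unitInterval, E)),
      HasFDerivAt (integralEquationMap v) (A : (E × ℝ × C(unitInterval, E)) →L[ℝ] _)
        (x, 0, ContinuousMap.const unitInterval x) := by
  let C := C(unitInterval, E)
  let w : C := primitiveOperator E (v.comp (ContinuousMap.const unitInterval x))
  let B : (E × ℝ × C) →L[ℝ] C :=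
    (ContinuousLinearMap.const ℝ unitInterval).comp (ContinuousLinearMap.fst ℝ E (ℝ × C))
      + ((ContinuousLinearMap.fst ℝ ℝ C).comp (ContinuousLinearMap.snd ℝ E (ℝ × C))).smulRight w
  let π₁ := ContinuousLinearMap.fst ℝ E (ℝ × C)
  let π₂ := (ContinuousLinearMap.fst ℝ ℝ C).comp (ContinuousLinearMap.snd ℝ E (ℝ × C))
  let π₃ := (ContinuousLinearMap.snd ℝ ℝ C).comp (ContinuousLinearMap.snd ℝ E (ℝ × C))
  have hB : ∀ q, B q = ContinuousLinearMap.const ℝ unitInterval q.1 + q.2.1 • w := fun q ↦ rfl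
  refine ⟨ContinuousLinearEquiv.equivOfInverse (π₁.prod (π₂.prod (π₃ - B)))
    (π₁.prod (π₂.prod (π₃ + B))) ?_ ?_, ?_⟩
  · rintro ⟨a, b, c⟩
    simp [π₁, π₂, π₃, hB]
  · rintro ⟨a, b, c⟩
    simp [π₁, π₂, π₃, hB]
  · have hN : DifferentiableAt ℝ
        (fun q : E × ℝ × C ↦ primitiveOperator E (v.comp q.2.2))
        (x, 0, ContinuousMap.const unitInterval x) :=
      (((primitiveOperator E).contDiff.comp ((contDiff_postcomp v hv).comp
        contDiff_snd.snd)).differentiable (by simp)).differentiableAt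
    have h3 : HasFDerivAt (fun q : E × ℝ × C ↦ q.2.2 - ContinuousLinearMap.const ℝ unitInterval q.1
        - q.2.1 • primitiveOperator E (v.comp q.2.2)) (π₃ - B)
        (x, 0, ContinuousMap.const unitInterval x) := by
      have h := ((π₃.hasFDerivAt (x := (x, 0, ContinuousMap.const unitInterval x))).sub
        (((ContinuousLinearMap.const ℝ unitInterval).comp π₁).hasFDerivAt)).sub
        ((π₂.hasFDerivAt).smul hN.hasFDerivAt)
      refine h.congr_fderiv ?_
      refine ContinuousLinearMap.ext fun q ↦ ?_
      have h1 : π₂ (x, (0 : ℝ), ContinuousMap.const unitInterval x) = 0 := rfl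
      simp only [h1, zero_smul, zero_add, sub_apply, hB, sub_sub]
      rfl
    exact (π₁.hasFDerivAt).prodMk ((π₂.hasFDerivAt).prodMk h3)

variable [CompleteSpace E]

/-- The local inverse of `integralEquationMap`, as a smooth solution operator. -/
theorem exists_contDiffAt_inverse_integralEquationMap (v : C(E, E)) (hv : ContDiff ℝ ∞ v) (x : E) :
    ∃ Φ : E × ℝ × C(unitInterval, E) → E × ℝ × C(unitInterval, E),
      (∀ᶠ q in 𝓝 (x, 0, ContinuousMap.const unitInterval x), Φ (integralEquationMap v q) = q) ∧
      ∀ᶠ q in 𝓝 (x, 0, 0), ContDiffAt ℝ ∞ Φ q := by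
  obtain ⟨A, hA⟩ := hasFDerivAt_integralEquationMap v hv x
  have hsm := contDiff_integralEquationMap v hv
  have h0 : integralEquationMap v (x, 0, ContinuousMap.const unitInterval x) = (x, 0, 0) := by
    simp only [integralEquationMap, zero_smul, sub_zero, Prod.mk.injEq, true_and]
    ext t
    simp
  let e := (hsm.contDiffAt (x := (x, 0, ContinuousMap.const unitInterval x))
    ).toOpenPartialHomeomorph _ hA (by simp)
  have he : (e : _ → _) = integralEquationMap v := rfl
  have hsrc : (x, 0, ContinuousMap.const unitInterval x) ∈ e.source :=
    ContDiffAt.mem_toOpenPartialHomeomorph_source _ hA (by simp)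
  have htgt : (x, (0 : ℝ), (0 : C(unitInterval, E))) ∈ e.target := by
    rw [← h0]
    exact e.map_source hsrc
  have hsymm : e.symm (x, 0, 0) = (x, 0, ContinuousMap.const unitInterval x) := by
    rw [← h0]
    exact e.left_inv hsrc
  refine ⟨e.symm, ?_, ?_⟩
  · filter_upwards [e.open_source.mem_nhds hsrc] with q hq using e.left_inv hq
  -- Smoothness of the inverse at nearby points, and not only at the base point, uses that
  -- invertible operators form an open set.
  · have h1 : ∀ᶠ q in 𝓝 (x, (0 : ℝ), ContinuousMap.const unitInterval x),
        fderiv ℝ (integralEquationMap v) q ∈ range ((↑) : ((E × ℝ × C(unitInterval, E)) ≃L[ℝ]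
          (E × ℝ × C(unitInterval, E))) → _ →L[ℝ] _) := by
      refine (hsm.continuous_fderiv (by simp)).continuousAt.eventually_mem ?_
      rw [hA.fderiv]
      exact A.nhds
    have h2 := (e.continuousAt_symm htgt).eventually (hsymm ▸ h1)
    filter_upwards [h2, e.open_target.mem_nhds htgt] with q hq hqt
    obtain ⟨A', hA'⟩ := hq
    refine e.contDiffAt_symm hqt (f₀' := A') ?_ hsm.contDiffAt
    rw [hA']
    exact (hsm.differentiable (by simp) _).hasFDerivAt

/-- A smooth vector field has a local flow that stays close to a given point and depends smoothly
on the initial value. -/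
theorem exists_smooth_localFlow_of_contDiff (v : E → E) (hv : ContDiff ℝ ∞ v) (x₀ : E)
    {W : Set E} (hW : W ∈ 𝓝 x₀) :
    ∃ ε > (0 : ℝ), ∃ α : E → ℝ → E, ∀ᶠ x in 𝓝 x₀, α x 0 = x ∧ ∀ t ∈ Ioo (-ε) ε,
      HasDerivAt (α x) (v (α x t)) t ∧ α x t ∈ W ∧ ContDiffAt ℝ ∞ (fun z ↦ α z t) x := by
  -- Picard-Lindelöf supplies existence and joint continuity of the solution `α`. Smoothness in the
  -- initial value follows once `α` is identified with the solution operator `Φ`.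
  obtain ⟨τ, hτ, a, r, B, K, hr, hpl⟩ :=
    IsPicardLindelof.of_contDiffAt_one ((hv.of_le (by simp)).contDiffAt (x := x₀))
  obtain ⟨α, hα, hαc⟩ := (hpl 0).exists_forall_mem_closedBall_eq_hasDerivWithinAt_continuousOn
  simp only [zero_sub, zero_add] at hα hαc
  obtain ⟨Φ, hΦ, hΦs⟩ := exists_contDiffAt_inverse_integralEquationMap ⟨v, hv.continuous⟩ hv x₀
  have hrball : Metric.closedBall x₀ (r : ℝ) ∈ 𝓝 x₀ := Metric.closedBall_mem_nhds _ (by simpa)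
  have hIcc : Icc (-τ) τ ∈ 𝓝 (0 : ℝ) := Icc_mem_nhds (by linarith) hτ
  have hα0 : α (x₀, 0) = x₀ := (hα x₀ (mem_of_mem_nhds hrball)).1
  -- a neighbourhood on which the solution operator applies
  rw [Metric.eventually_nhds_iff_ball] at hΦ
  obtain ⟨δ, hδ, hΦ⟩ := hΦ
  have hαat : ContinuousAt α (x₀, 0) := hαc.continuousAt (prod_mem_nhds hrball hIcc)
  have hnear : ∀ᶠ q : E × ℝ in 𝓝 (x₀, 0), q.1 ∈ Metric.closedBall x₀ (r : ℝ) ∧ q.2 ∈ Icc (-τ) τ ∧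
      α q ∈ W ∧ dist (α q) x₀ < δ / 2 ∧ dist q.1 x₀ < δ ∧ dist q.2 0 < δ ∧
      ContDiffAt ℝ ∞ Φ (q.1, q.2, 0) := by
    have hc : Continuous fun q : E × ℝ ↦ (q.1, q.2, (0 : C(unitInterval, E))) := by fun_prop
    filter_upwards [continuous_fst.continuousAt.eventually_mem (x := ((x₀, 0) : E × ℝ)) hrball,
      continuous_snd.continuousAt.eventually_mem (x := ((x₀, 0) : E × ℝ)) hIcc,
      hαat.eventually_mem (s := W) (by rwa [hα0]),
      hαat.eventually_mem (s := Metric.ball x₀ (δ / 2))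
        (by rw [hα0]; exact Metric.ball_mem_nhds _ (half_pos hδ)),
      continuous_fst.continuousAt.eventually_mem (x := ((x₀, 0) : E × ℝ))
        (Metric.ball_mem_nhds _ hδ),
      continuous_snd.continuousAt.eventually_mem (x := ((x₀, 0) : E × ℝ))
        (Metric.ball_mem_nhds _ hδ),
      hc.continuousAt.eventually hΦs] with q h1 h2 h3 h4 h5 h6 h7
    exact ⟨h1, h2, h3, h4, h5, h6, h7⟩
  rw [nhds_prod_eq] at hnear
  obtain ⟨P, hP, Q, hQ, hPQ⟩ := Filter.eventually_prod_iff.1 hnear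
  obtain ⟨ε, hε, hQε⟩ := Metric.eventually_nhds_iff_ball.1 hQ
  have hQ' : ∀ t ∈ Ioo (-ε) ε, Q t := fun t ht ↦ hQε t (by simpa [Real.ball_eq_Ioo] using ht)
  have hmem0 : (0 : ℝ) ∈ Ioo (-ε) ε := ⟨by linarith, hε⟩
  -- the solution through `x` up to the time `t`, scaled to the unit interval
  have key : ∀ x t, P x → t ∈ Ioo (-ε) ε → α (x, t) = (Φ (x, t, 0)).2.2 1 := by
    intro x t hx ht
    have hscale : ∀ u ∈ Icc (0 : ℝ) 1, t * u ∈ Ioo (-ε) ε := by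
      intro u hu
      rw [mem_Ioo, ← abs_lt] at ht ⊢
      rw [abs_mul, abs_of_nonneg hu.1]
      exact (mul_le_of_le_one_right (abs_nonneg t) hu.2).trans_lt ht
    have hder : ∀ s ∈ Ioo (-ε) ε, HasDerivWithinAt (fun s ↦ α (x, s)) (v (α (x, s)))
        (Ioo (-ε) ε) s := fun s hs ↦
      ((hα x (hPQ hx (hQ' s hs)).1).2 s (hPQ hx (hQ' s hs)).2.1).mono
        fun s' hs' ↦ (hPQ hx (hQ' s' hs')).2.1
    have hder' : ∀ s ∈ Ioo (-ε) ε, HasDerivAt (fun s ↦ α (x, s)) (v (α (x, s))) s :=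
      fun s hs ↦ (hder s hs).hasDerivAt (isOpen_Ioo.mem_nhds hs)
    have hcont : ContinuousOn (fun s ↦ α (x, s)) (Ioo (-ε) ε) :=
      fun s hs ↦ (hder s hs).continuousWithinAt
    let γ : C(unitInterval, E) := ⟨fun u ↦ α (x, t * u),
      hcont.comp_continuous (by fun_prop) fun u ↦ hscale u u.2⟩
    have hγ : integralEquationMap ⟨v, hv.continuous⟩ (x, t, γ) = (x, t, 0) := by
      simp only [integralEquationMap, Prod.mk.injEq, true_and]
      ext u
      have hint : ∫ s in (0 : ℝ)..u, t • v (γ (projIcc 0 1 zero_le_one s))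
          = α (x, t * u) - α (x, t * 0) := by
        refine intervalIntegral.integral_eq_sub_of_hasDerivAt (f := fun s ↦ α (x, t * s))
          (fun s hs ↦ ?_) ?_
        · rw [uIcc_of_le u.2.1] at hs
          have hs' : s ∈ Icc (0 : ℝ) 1 := ⟨hs.1, hs.2.trans u.2.2⟩
          have h1 := (hder' (t * s) (hscale s hs')).scomp s ((hasDerivAt_id s).const_mul t)
          rw [projIcc_of_mem zero_le_one hs']
          simpa [γ, Function.comp_def] using h1
        · have hvc := hv.continuous
          exact Continuous.intervalIntegrable (by fun_prop) _ _
      have h0 : α (x, t * 0) = x := by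
        rw [mul_zero]
        exact (hα x (hPQ hx (hQ' 0 hmem0)).1).1
      rw [intervalIntegral.integral_smul, h0] at hint
      change α (x, t * u) - x - t • (∫ s in (0 : ℝ)..u, v (γ (projIcc 0 1 zero_le_one s))) = 0
      rw [hint]
      abel
    have hball : (x, t, γ) ∈ Metric.ball
        ((x₀, 0, ContinuousMap.const unitInterval x₀) : E × ℝ × C(unitInterval, E)) δ := by
      have h := hPQ hx (hQ' t ht)
      rw [Metric.mem_ball, Prod.dist_eq, Prod.dist_eq, max_lt_iff, max_lt_iff]
      -- The sup distance is only bounded non-strictly by its pointwise values, hence the margin `δ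
      -- / 2`.
      refine ⟨h.2.2.2.2.1, h.2.2.2.2.2.1, lt_of_le_of_lt ?_ (half_lt_self hδ)⟩
      rw [ContinuousMap.dist_le (half_pos hδ).le]
      exact fun u ↦ (hPQ hx (hQ' _ (hscale u u.2))).2.2.2.1.le
    rw [← hγ, hΦ _ hball]
    simp [γ]
  refine ⟨ε, hε, fun x t ↦ α (x, t), ?_⟩
  filter_upwards [eventually_eventually_nhds.2 hP] with x hx
  have hPx := hx.self_of_nhds
  refine ⟨(hα x (hPQ hPx (hQ' 0 hmem0)).1).1, fun t ht ↦ ⟨?_, (hPQ hPx (hQ' t ht)).2.2.1, ?_⟩⟩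
  · have h := (hα x (hPQ hPx (hQ' t ht)).1).2 t (hPQ hPx (hQ' t ht)).2.1
    exact (h.mono (fun s (hs : s ∈ Ioo (-ε) ε) ↦ (hPQ hPx (hQ' s hs)).2.1)).hasDerivAt
      (isOpen_Ioo.mem_nhds ht)
  · have h1 : ContDiffAt ℝ ∞ (fun z ↦ (Φ (z, t, 0)).2.2 1) x := by
      have h2 := (hPQ hPx (hQ' t ht)).2.2.2.2.2.2
      have h3 : ContDiffAt ℝ ∞ (fun z ↦ Φ (z, t, 0)) x :=
        ContDiffAt.comp x h2 (contDiffAt_id.prodMk contDiffAt_const)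
      exact (ContinuousMap.evalCLM ℝ (1 : unitInterval)).contDiff.contDiffAt.comp x
        (contDiffAt_snd.comp _ contDiffAt_snd |>.comp x h3)
    exact h1.congr_of_eventuallyEq (hx.mono fun z hz ↦ key z t hz ht)

end

end LocalFlow

section LocalFlowOn

variable {E : Type*} [NormedAddCommGroup E] [NormedSpace ℝ E]

/-- A vector field that is smooth near a point has a local flow that stays close to the point and
depends smoothly on the initial value. -/
theorem exists_smooth_localFlow [FiniteDimensional ℝ E] (v : E → E) {Ω : Set E} {x₀ : E}
    (hv : ContDiffOn ℝ ∞ v Ω) (hΩ : Ω ∈ 𝓝 x₀) :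
    ∃ ε > (0 : ℝ), ∃ α : E → ℝ → E, ∀ᶠ x in 𝓝 x₀, α x 0 = x ∧ ∀ t ∈ Ioo (-ε) ε,
      HasDerivAt (α x) (v (α x t)) t ∧ α x t ∈ Ω ∧ ContDiffAt ℝ ∞ (fun z ↦ α z t) x := by
  have : CompleteSpace E := FiniteDimensional.complete ℝ E
  obtain ⟨r, hr, hrΩ⟩ := Metric.mem_nhds_iff.1 hΩ
  -- After the cut-off the field is smooth everywhere. The flow is kept inside the ball of radius `r
  -- / 3`, where the cut-off equals `1` and the field is unchanged.
  let χ : ContDiffBump x₀ := ⟨r / 3, r / 2, by positivity, by linarith⟩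
  have hsm : ContDiff ℝ ∞ fun x ↦ χ x • v x := by
    rw [contDiff_iff_contDiffAt]
    intro x
    by_cases hx : x ∈ Metric.ball x₀ r
    · exact χ.contDiff.contDiffAt.smul ((hv.mono hrΩ).contDiffAt (Metric.isOpen_ball.mem_nhds hx))
    · have hx' : x ∈ (Metric.closedBall x₀ (r / 2))ᶜ := fun h ↦
        hx (Metric.closedBall_subset_ball (by linarith) h)
      refine (contDiffAt_const (c := (0 : E))).congr_of_eventuallyEq ?_
      filter_upwards [Metric.isClosed_closedBall.isOpen_compl.mem_nhds hx'] with y hy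
      have : χ y = 0 := χ.zero_of_le_dist (by simpa using le_of_lt (by simpa using hy))
      rw [this, zero_smul]
  obtain ⟨ε, hε, α, hα⟩ := exists_smooth_localFlow_of_contDiff _ hsm x₀
    (Metric.ball_mem_nhds x₀ (show 0 < r / 3 by positivity))
  refine ⟨ε, hε, α, hα.mono fun x hx ↦ ⟨hx.1, fun t ht ↦ ?_⟩⟩
  obtain ⟨h1, h2, h3⟩ := hx.2 t ht
  refine ⟨?_, hrΩ (Metric.ball_subset_ball (by linarith) h2), h3⟩
  have : χ (α x t) = 1 := χ.one_of_mem_closedBall (Metric.ball_subset_closedBall h2)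
  simpa [this] using h1

/-- Solutions of smooth autonomous differential equations are smooth. -/
theorem contDiffOn_of_hasDerivAt_comp {v : E → E} {Ω : Set E} (hv : ContDiffOn ℝ ∞ v Ω)
    {s : Set ℝ} (hs : IsOpen s) {f : ℝ → E} (hf : ∀ t ∈ s, HasDerivAt f (v (f t)) t)
    (hfΩ : MapsTo f s Ω) : ContDiffOn ℝ ∞ f s := by
  rw [contDiffOn_infty]
  intro n
  induction n with
  | zero => exact contDiffOn_zero.2 fun t ht ↦ (hf t ht).continuousAt.continuousWithinAt
  | succ n ih =>
    push_cast
    rw [contDiffOn_succ_iff_deriv_of_isOpen hs]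
    refine ⟨fun t ht ↦ (hf t ht).differentiableAt.differentiableWithinAt, by simp, ?_⟩
    exact ((contDiffOn_infty.1 hv n).comp ih hfΩ).congr fun t ht ↦ (hf t ht).deriv

end LocalFlowOn

/-! ## The Euler-Lagrange expression of the energy -/

section EulerLagrange

set_option synthInstance.maxHeartbeats 400000

variable {E : Type*} [NormedAddCommGroup E] [NormedSpace ℝ E]

/-- The Euler-Lagrange expression of the energy of a field `G` of bilinear forms, at the position
`y`, for the velocity `u`, the acceleration `a` and the variation `w`. -/
noncomputable def eulerLagrange (G : E → E →L[ℝ] E →L[ℝ] ℝ) (y u a w : E) : ℝ :=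
  G y a w + fderiv ℝ G y u u w - 1 / 2 * fderiv ℝ G y w u u

theorem fderiv_bilinearComp {E' : Type*} [NormedAddCommGroup E'] [NormedSpace ℝ E']
    {G : E → E →L[ℝ] E →L[ℝ] ℝ} {G' : E' → E' →L[ℝ] E' →L[ℝ] ℝ}
    {φ : E' → E} {y : E'} (hG : DifferentiableAt ℝ G (φ y)) (hφ : ContDiffAt ℝ 2 φ y)
    (h : ∀ᶠ z in 𝓝 y, ∀ v w, G' z v w = G (φ z) (fderiv ℝ φ z v) (fderiv ℝ φ z w))
    (hG' : DifferentiableAt ℝ G' y) (u v w : E') :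
    fderiv ℝ G' y u v w = fderiv ℝ G (φ y) (fderiv ℝ φ y u) (fderiv ℝ φ y v) (fderiv ℝ φ y w)
      + G (φ y) (fderiv ℝ (fderiv ℝ φ) y u v) (fderiv ℝ φ y w)
      + G (φ y) (fderiv ℝ φ y v) (fderiv ℝ (fderiv ℝ φ) y u w) := by
  have hφ1 : HasFDerivAt φ (fderiv ℝ φ y) y := (hφ.differentiableAt (by simp)).hasFDerivAt
  have hφ2 : HasFDerivAt (fderiv ℝ φ) (fderiv ℝ (fderiv ℝ φ) y) y :=
    ((hφ.fderiv_right (m := 1) (by norm_num)).differentiableAt (by simp)).hasFDerivAt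
  have h1 : HasFDerivAt (fun z ↦ G' z v w) _ y :=
    (hG'.hasFDerivAt.clm_apply (hasFDerivAt_const v y)).clm_apply (hasFDerivAt_const w y)
  have h0 : HasFDerivAt (fun z ↦ G (φ z)) ((fderiv ℝ G (φ y)).comp (fderiv ℝ φ y)) y :=
    HasFDerivAt.comp (G := E →L[ℝ] E →L[ℝ] ℝ) (g := G) (g' := fderiv ℝ G (φ y)) y hG.hasFDerivAt hφ1
  have h2 := (h0.clm_apply (hφ2.clm_apply (hasFDerivAt_const v y))).clm_apply
    (hφ2.clm_apply (hasFDerivAt_const w y))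
  have h3 := h1.unique (h2.congr_of_eventuallyEq (h.mono fun z hz ↦ hz v w))
  have h4 := DFunLike.congr_fun h3 u
  simp at h4
  linarith

/-- The Euler-Lagrange expression is invariant under changes of coordinates. -/
theorem eulerLagrange_comp {E' : Type*} [NormedAddCommGroup E'] [NormedSpace ℝ E']
    {G : E → E →L[ℝ] E →L[ℝ] ℝ} {G' : E' → E' →L[ℝ] E' →L[ℝ] ℝ}
    {φ : E' → E} {y : E'} (hG : DifferentiableAt ℝ G (φ y)) (hφ : ContDiffAt ℝ 2 φ y)
    (hsymm : ∀ v w, G (φ y) v w = G (φ y) w v)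
    (h : ∀ᶠ z in 𝓝 y, ∀ v w, G' z v w = G (φ z) (fderiv ℝ φ z v) (fderiv ℝ φ z w))
    (hG' : DifferentiableAt ℝ G' y) (u a w : E') :
    eulerLagrange G' y u a w = eulerLagrange G (φ y) (fderiv ℝ φ y u)
      (fderiv ℝ φ y a + fderiv ℝ (fderiv ℝ φ) y u u) (fderiv ℝ φ y w) := by
  -- Symmetry of the second derivative, together with that of `G`, cancels the terms that contain
  -- the second derivative of `φ` in the directions `u` and `w`.
  have hs : fderiv ℝ (fderiv ℝ φ) y w u = fderiv ℝ (fderiv ℝ φ) y u w :=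
    (hφ.isSymmSndFDerivAt (by simp)).eq w u
  rw [eulerLagrange, eulerLagrange, h.self_of_nhds, fderiv_bilinearComp hG hφ h hG',
    fderiv_bilinearComp hG hφ h hG', hs, hsymm (fderiv ℝ (fderiv ℝ φ) y u w)]
  simp
  ring

open ContinuousLinearMap in
/-- The accelerations that solve the Euler-Lagrange equation. -/
noncomputable def geodesicAcceleration (G : E → E →L[ℝ] E →L[ℝ] ℝ) (y u : E) : E :=
  (G y).inverse ((1 / 2 : ℝ) • ((fderiv ℝ G y).flip u).flip u - fderiv ℝ G y u u)

theorem eq_geodesicAcceleration {G : E → E →L[ℝ] E →L[ℝ] ℝ} {y u a : E}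
    (hinv : (G y).IsInvertible) (h : ∀ w, eulerLagrange G y u a w = 0) :
    a = geodesicAcceleration G y u := by
  obtain ⟨e, he⟩ := hinv
  have h1 : G y a = (1 / 2 : ℝ) • ((fderiv ℝ G y).flip u).flip u - fderiv ℝ G y u u := by
    ext w
    have := h w
    simp only [eulerLagrange] at this
    simp
    linarith
  rw [geodesicAcceleration, ← h1, ← he, ContinuousLinearMap.inverse_equiv]
  simp

/-- The derivative of `G` enters through functions of the position with the velocity as a parameter,
so that smoothness of parameter-dependent derivatives applies. Inversion is smooth at invertible
operators. -/
theorem contDiffAt_geodesicAcceleration [CompleteSpace E] {G : E → E →L[ℝ] E →L[ℝ] ℝ} {y u : E}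
    (hG : ContDiffAt ℝ ∞ G y) (hinv : (G y).IsInvertible) :
    ContDiffAt ℝ ∞ (fun q : E × E ↦ geodesicAcceleration G q.1 q.2) (y, u) := by
  obtain ⟨e, he⟩ := hinv
  have h1 : ContDiffAt ℝ ∞ (fun q : E × E ↦ (G q.1).inverse) (y, u) := by
    have h2 : ContDiffAt ℝ ∞ ContinuousLinearMap.inverse (G y) := he ▸ contDiffAt_map_inverse e
    exact ContDiffAt.comp (y, u) h2 (ContDiffAt.comp (g := G) (y, u) hG contDiffAt_fst)
  have hdG : ∀ᶠ q : E × E in 𝓝 (y, u), DifferentiableAt ℝ G q.1 :=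
    continuous_fst.continuousAt.eventually
      (((hG.of_le (m := 1) (by simp)).eventually (by simp)).mono
        fun z hz ↦ hz.differentiableAt (by simp))
  have hGq : ContDiffAt ℝ ∞ (fun p : (E × E) × E ↦ G p.2) ((y, u), y) :=
    ContDiffAt.comp (g := G) ((y, u), y) hG contDiffAt_snd
  have h3 : ContDiffAt ℝ ∞ (fun q : E × E ↦ fderiv ℝ (fun z ↦ G z q.2 q.2) q.1) (y, u) :=
    ContDiffAt.fderiv (f := fun (q : E × E) z ↦ G z q.2 q.2) (n := ∞)
      ((hGq.clm_apply contDiffAt_fst.snd).clm_apply contDiffAt_fst.snd) contDiffAt_fst (by simp)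
  have h4 : ContDiffAt ℝ ∞ (fun q : E × E ↦ fderiv ℝ (fun z ↦ G z q.2) q.1 q.2) (y, u) :=
    (ContDiffAt.fderiv (f := fun (q : E × E) z ↦ G z q.2) (n := ∞)
      (hGq.clm_apply contDiffAt_fst.snd) contDiffAt_fst (by simp)).clm_apply contDiffAt_snd
  have h5 : ContDiffAt ℝ ∞ (fun q : E × E ↦ (G q.1).inverse
      ((1 / 2 : ℝ) • fderiv ℝ (fun z ↦ G z q.2 q.2) q.1 - fderiv ℝ (fun z ↦ G z q.2) q.1 q.2))
      (y, u) := h1.clm_apply ((h3.const_smul _).sub h4)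
  refine h5.congr_of_eventuallyEq (hdG.mono fun q hq ↦ ?_)
  have h6 : HasFDerivAt (fun z ↦ G z q.2) _ q.1 :=
    hq.hasFDerivAt.clm_apply (hasFDerivAt_const q.2 q.1)
  have h7 := h6.clm_apply (hasFDerivAt_const q.2 q.1)
  simp only [geodesicAcceleration]
  congr 1
  rw [h6.fderiv, h7.fderiv]
  ext w
  simp

/-- Local uniqueness of solutions of the Euler-Lagrange equation. -/
theorem eventuallyEq_of_eulerLagrange_eq_zero [CompleteSpace E] {G : E → E →L[ℝ] E →L[ℝ] ℝ}
    {c₁ c₂ : ℝ → E} {t₀ : ℝ} (hG : ContDiffAt ℝ ∞ G (c₁ t₀)) (hinv : (G (c₁ t₀)).IsInvertible)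
    (hc₁ : ContDiffAt ℝ ∞ c₁ t₀) (hc₂ : ContDiffAt ℝ ∞ c₂ t₀)
    (h₁ : ∀ᶠ t in 𝓝 t₀, ∀ w, eulerLagrange G (c₁ t) (deriv c₁ t) (deriv (deriv c₁) t) w = 0)
    (h₂ : ∀ᶠ t in 𝓝 t₀, ∀ w, eulerLagrange G (c₂ t) (deriv c₂ t) (deriv (deriv c₂) t) w = 0)
    (h0 : c₁ t₀ = c₂ t₀) (h0' : deriv c₁ t₀ = deriv c₂ t₀) : c₁ =ᶠ[𝓝 t₀] c₂ := by
  -- The second order equation becomes a first order system for position and velocity whose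
  -- right-hand side is `C¹`, hence locally Lipschitz.
  let V : E × E → E × E := fun q ↦ (q.2, geodesicAcceleration G q.1 q.2)
  have hV : ContDiffAt ℝ 1 V (c₁ t₀, deriv c₁ t₀) :=
    (contDiffAt_snd.prodMk (contDiffAt_geodesicAcceleration hG hinv)).of_le (by simp)
  obtain ⟨K, s, hs, hlip⟩ := hV.exists_lipschitzOnWith
  have hInv : ∀ᶠ y in 𝓝 (c₁ t₀), (G y).IsInvertible := by
    obtain ⟨e, he⟩ := hinv
    exact hG.continuousAt.eventually (he ▸ e.nhds)
  have main : ∀ c : ℝ → E, ContDiffAt ℝ ∞ c t₀ → c t₀ = c₁ t₀ → deriv c t₀ = deriv c₁ t₀ →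
      (∀ᶠ t in 𝓝 t₀, ∀ w, eulerLagrange G (c t) (deriv c t) (deriv (deriv c) t) w = 0) →
      ∀ᶠ t in 𝓝 t₀, HasDerivAt (fun t ↦ (c t, deriv c t)) (V (c t, deriv c t)) t ∧
        (c t, deriv c t) ∈ s := by
    intro c hc hc0 hc0' hEL
    have hd : ∀ᶠ t in 𝓝 t₀, ContDiffAt ℝ 2 c t :=
      (hc.of_le (m := 2) (WithTop.coe_le_coe.2 le_top)).eventually (by simp)
    have hc1 : ContinuousAt (fun t ↦ (c t, deriv c t)) t₀ := by
      refine hc.continuousAt.prodMk ?_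
      exact ((hc.fderiv_right (m := ∞) (by simp)).clm_apply contDiffAt_const).continuousAt
    filter_upwards [hd, hEL, hc.continuousAt.eventually (hc0 ▸ hInv),
      hc1.eventually_mem (by rw [hc0, hc0']; exact hs)] with t h1 h2 h3 h4
    refine ⟨?_, h4⟩
    have h5 : HasDerivAt c (deriv c t) t := (h1.differentiableAt (by simp)).hasDerivAt
    have h6 : HasDerivAt (deriv c) (deriv (deriv c) t) t := by
      have : ContDiffAt ℝ 1 (deriv c) t :=
        (h1.fderiv_right (m := 1) (by norm_num)).clm_apply contDiffAt_const
      exact (this.differentiableAt (by simp)).hasDerivAt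
    have h7 := h5.prodMk h6
    rwa [eq_geodesicAcceleration h3 h2] at h7
  have h := ODE_solution_unique_of_eventually (v := fun _ ↦ V) (s := fun _ ↦ s) (K := K)
    (f := fun t ↦ (c₁ t, deriv c₁ t)) (g := fun t ↦ (c₂ t, deriv c₂ t)) (t₀ := t₀)
    (Filter.Eventually.of_forall fun _ ↦ hlip) (main c₁ hc₁ rfl rfl h₁)
    (main c₂ hc₂ h0.symm h0'.symm h₂) (by simp [h0, h0'])
  exact h.mono fun t ht ↦ congrArg Prod.fst ht

end EulerLagrange

/-! ## The metric and covariant derivatives in coordinates -/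

section MetricInCoordinates

set_option synthInstance.maxHeartbeats 400000

variable {E : Type*} [NormedAddCommGroup E] [NormedSpace ℝ E]
  {M : Type*} [TopologicalSpace M] [ChartedSpace E M] [IsManifold 𝓘(ℝ, E) ∞ M]

theorem symmL_trivializationAt_apply {p q : M} (h : q ∈ (chartAt E p).source) (v : E) :
    ((trivializationAt E (TangentSpace 𝓘(ℝ, E)) p).symmL ℝ q v : E)
      = tangentCoordChange 𝓘(ℝ, E) p q q v := by
  rw [TangentBundle.symmL_trivializationAt_eq_core h]
  rfl

theorem continuousLinearMapAt_trivializationAt_apply {p q : M} (h : q ∈ (chartAt E p).source)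
    (v : TangentSpace 𝓘(ℝ, E) q) :
    (trivializationAt E (TangentSpace 𝓘(ℝ, E)) p).continuousLinearMapAt ℝ q v
      = tangentCoordChange 𝓘(ℝ, E) q p q v := by
  rw [TangentBundle.continuousLinearMapAt_trivializationAt_eq_core h]
  rfl

namespace LorentzianMetric

variable (g : LorentzianMetric E M)

/-- The components of the metric in the preferred chart at `p`, as a function on the model space. -/
noncomputable def metricCoord (p : M) (y : E) : E →L[ℝ] E →L[ℝ] ℝ :=
  g.inCoordinates p ((extChartAt 𝓘(ℝ, E) p).symm y)

theorem inCoordinates_apply {p q : M} (h : q ∈ (chartAt E p).source) (v w : E) :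
    g.inCoordinates p q v w = g.inner q (tangentCoordChange 𝓘(ℝ, E) p q q v)
      (tangentCoordChange 𝓘(ℝ, E) p q q w) := by
  rw [← symmL_trivializationAt_apply h, ← symmL_trivializationAt_apply h]
  rfl

theorem metricCoord_apply {p q : M} (h : q ∈ (chartAt E p).source) (v w : E) :
    g.metricCoord p (extChartAt 𝓘(ℝ, E) p q) v w
      = g.inner q (tangentCoordChange 𝓘(ℝ, E) p q q v) (tangentCoordChange 𝓘(ℝ, E) p q q w) := by
  rw [metricCoord, (extChartAt 𝓘(ℝ, E) p).left_inv (by rwa [extChartAt_source]),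
    inCoordinates_apply g h]

theorem metricCoord_symm (p : M) (y v w : E) : g.metricCoord p y v w = g.metricCoord p y w v :=
  let q := (extChartAt 𝓘(ℝ, E) p).symm y
  let A : E →L[ℝ] E := (trivializationAt E (TangentSpace 𝓘(ℝ, E)) p).symmL ℝ q
  g.symm q (A v) (A w)

-- The component is the smooth metric tensor evaluated on two coordinate vector fields of the chart,
-- which are smooth sections because their coordinates are constant.
set_option maxHeartbeats 2000000 in
theorem contMDiffOn_inCoordinates_apply (p : M) (v w : E) :
    ContMDiffOn 𝓘(ℝ, E) 𝓘(ℝ, ℝ) ∞ (fun q ↦ g.inCoordinates p q v w) (chartAt E p).source := by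
  have hsec : ∀ v : E, ContMDiffOn 𝓘(ℝ, E) 𝓘(ℝ, E).tangent ∞
      (fun q ↦ TotalSpace.mk' E (E := TangentSpace 𝓘(ℝ, E)) q
        ((trivializationAt E (TangentSpace 𝓘(ℝ, E)) p).symmL ℝ q v)) (chartAt E p).source := by
    intro v
    refine ((trivializationAt E (TangentSpace 𝓘(ℝ, E)) p).contMDiffOn_section_baseSet_iff).2 ?_
    refine (contMDiffOn_const (c := v)).congr fun q hq ↦ ?_
    rw [Trivialization.symmL_apply (hb := hq)]
    exact congrArg Prod.snd
      ((trivializationAt E (TangentSpace 𝓘(ℝ, E)) p).apply_mk_symm hq v)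
  intro q hq
  have h := (g.contMDiff.contMDiffOn (s := (chartAt E p).source) q hq).clm_bundle_apply₂
    (F₁ := E) (F₂ := E) (F₃ := ℝ) (E₁ := TangentSpace 𝓘(ℝ, E)) (E₂ := TangentSpace 𝓘(ℝ, E))
    (E₃ := Bundle.Trivial M ℝ) (hsec v q hq) (hsec w q hq)
  rw [contMDiffWithinAt_section] at h
  exact h

variable [FiniteDimensional ℝ E]

theorem contDiffOn_metricCoord (p : M) :
    ContDiffOn ℝ ∞ (g.metricCoord p) (extChartAt 𝓘(ℝ, E) p).target := by
  refine contDiffOn_clm_apply.2 fun v ↦ contDiffOn_clm_apply.2 fun w ↦ ?_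
  rw [← contMDiffOn_iff_contDiffOn]
  refine (g.contMDiffOn_inCoordinates_apply p v w).comp (contMDiffOn_extChartAt_symm p) ?_
  intro y hy
  rw [← extChartAt_source 𝓘(ℝ, E)]
  exact (extChartAt 𝓘(ℝ, E) p).map_target hy

theorem contDiffAt_metricCoord {p q : M} (h : q ∈ (chartAt E p).source) :
    ContDiffAt ℝ ∞ (g.metricCoord p) (extChartAt 𝓘(ℝ, E) p q) :=
  (g.contDiffOn_metricCoord p).contDiffAt ((isOpen_extChartAt_target p).mem_nhds
    ((extChartAt 𝓘(ℝ, E) p).map_source (by rwa [extChartAt_source])))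

theorem derivInCoordinates_eq (p : M) :
    g.derivInCoordinates p = fderiv ℝ (g.metricCoord p) (extChartAt 𝓘(ℝ, E) p p) := by
  have h1 : MDifferentiableAt 𝓘(ℝ, E) 𝓘(ℝ, E →L[ℝ] E →L[ℝ] ℝ) (g.inCoordinates p) p := by
    have h2 : MDifferentiableAt 𝓘(ℝ, E) 𝓘(ℝ, E →L[ℝ] E →L[ℝ] ℝ)
        (g.metricCoord p ∘ extChartAt 𝓘(ℝ, E) p) p :=
      MDifferentiableAt.comp (I' := 𝓘(ℝ, E)) p
        ((g.contDiffAt_metricCoord (mem_chart_source E p)).differentiableAt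
          (by simp)).mdifferentiableAt
        (mdifferentiableAt_extChartAt (mem_chart_source E p))
    refine h2.congr_of_eventuallyEq ?_
    filter_upwards [extChartAt_source_mem_nhds (I := 𝓘(ℝ, E)) p] with q hq
    rw [Function.comp_apply, metricCoord, (extChartAt 𝓘(ℝ, E) p).left_inv hq]
  have h3 : HasFDerivWithinAt (g.metricCoord p) (g.derivInCoordinates p) (range 𝓘(ℝ, E))
    (extChartAt 𝓘(ℝ, E) p p) := h1.hasMFDerivAt.2
  rw [modelWithCornersSelf_coe, range_id, hasFDerivWithinAt_univ] at h3
  exact h3.fderiv.symm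

end LorentzianMetric

end MetricInCoordinates

/-! ### Covariant derivatives along maps, in an arbitrary chart. -/

section CovariantDerivative

set_option synthInstance.maxHeartbeats 400000

variable {E : Type*} [NormedAddCommGroup E] [NormedSpace ℝ E]
  {M : Type*} [TopologicalSpace M] [ChartedSpace E M] [IsManifold 𝓘(ℝ, E) ∞ M]
  {F : Type*} [NormedAddCommGroup F] [NormedSpace ℝ F]
  {N : Type*} [TopologicalSpace N] [ChartedSpace F N]

theorem mfderiv_extChartAt_comp {f : N → M} {x : N} {p : M}
    (hf : MDifferentiableAt 𝓘(ℝ, F) 𝓘(ℝ, E) f x) (hp : f x ∈ (chartAt E p).source)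
    (v : TangentSpace 𝓘(ℝ, F) x) :
    (mfderiv 𝓘(ℝ, F) 𝓘(ℝ, E) (extChartAt 𝓘(ℝ, E) p ∘ f) x v : E)
      = tangentCoordChange 𝓘(ℝ, E) (f x) p (f x) (mfderiv 𝓘(ℝ, F) 𝓘(ℝ, E) f x v) := by
  rw [mfderiv_comp (I' := 𝓘(ℝ, E)) x (mdifferentiableAt_extChartAt hp) hf,
    ← continuousLinearMapAt_trivializationAt_apply hp,
    TangentBundle.continuousLinearMapAt_trivializationAt hp]
  rfl

theorem deriv_eq_mfderiv_one (f : ℝ → E) (t : ℝ) :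
    deriv f t = (mfderiv 𝓘(ℝ, ℝ) 𝓘(ℝ, E) f t (1 : ℝ) : E) := by
  rw [mfderiv_eq_fderiv]
  rfl

theorem deriv_extChartAt_comp {β : ℝ → M} {t : ℝ} {p : M}
    (hf : MDifferentiableAt 𝓘(ℝ, ℝ) 𝓘(ℝ, E) β t) (hp : β t ∈ (chartAt E p).source) :
    deriv (extChartAt 𝓘(ℝ, E) p ∘ β) t
      = tangentCoordChange 𝓘(ℝ, E) (β t) p (β t) (curveVelocity β t) :=
  (deriv_eq_mfderiv_one _ t).trans (mfderiv_extChartAt_comp hf hp (1 : ℝ))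

theorem contDiffAt_extChartAt_comp {β : ℝ → M} {t : ℝ} {p : M}
    (hf : ContMDiffAt 𝓘(ℝ, ℝ) 𝓘(ℝ, E) ∞ β t) (hp : β t ∈ (chartAt E p).source) :
    ContDiffAt ℝ ∞ (extChartAt 𝓘(ℝ, E) p ∘ β) t :=
  ((contMDiffAt_extChartAt' hp).comp t hf).contDiffAt

theorem tangentCoordChange_self_apply (p : M) (v : E) :
    tangentCoordChange 𝓘(ℝ, E) p p p v = v :=
  tangentCoordChange_self (mem_extChartAt_source p)

theorem tangentCoordChange_comp_cancel {p q : M} (h : q ∈ (chartAt E p).source) (v : E) :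
    tangentCoordChange 𝓘(ℝ, E) q p q (tangentCoordChange 𝓘(ℝ, E) p q q v) = v := by
  rw [← extChartAt_source 𝓘(ℝ, E)] at h
  rw [tangentCoordChange_comp ⟨⟨h, mem_extChartAt_source q⟩, h⟩, tangentCoordChange_self h]

theorem tangentCoordChange_comp_cancel' {p q : M} (h : q ∈ (chartAt E p).source) (v : E) :
    tangentCoordChange 𝓘(ℝ, E) p q q (tangentCoordChange 𝓘(ℝ, E) q p q v) = v := by
  rw [← extChartAt_source 𝓘(ℝ, E)] at h
  rw [tangentCoordChange_comp ⟨⟨mem_extChartAt_source q, h⟩, mem_extChartAt_source q⟩,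
    tangentCoordChange_self (mem_extChartAt_source q)]

theorem eventually_mem_chart_source {f : N → M} {x : N} {p : M} (hf : ContinuousAt f x)
    (h : f x ∈ (chartAt E p).source) : ∀ᶠ y in 𝓝 x, f y ∈ (chartAt E p).source :=
  hf.eventually_mem ((chartAt E p).open_source.mem_nhds h)

namespace LorentzianMetric

variable (g : LorentzianMetric E M) [FiniteDimensional ℝ E]

theorem inner_christoffel (p : M) (u v w : E) :
    g.inner p (g.christoffel p u v) w = g.christoffelFirst p u v w :=
  LinearMap.BilinForm.apply_toDual_symm_apply (B := g.bilinForm p)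
    (hB := g.nondegenerate_bilinForm p) _ w

theorem eq_of_inner_eq {p : M} {u v : E}
    (h : ∀ w : E, g.inner p u w = g.inner p v w) : u = v := by
  have h1 : ∀ w : E, g.bilinForm p (u - v) w = 0 := fun w ↦ by
    rw [map_sub, LinearMap.sub_apply, sub_eq_zero]
    exact h w
  exact sub_eq_zero.1 ((g.nondegenerate_bilinForm p).1 (u - v) h1)

theorem christoffel_smul_smul (p : M) (a b : ℝ) (u v : E) :
    g.christoffel p (a • u) (b • v) = (a * b) • g.christoffel p u v := by
  have h : g.christoffelFirst p (a • u) (b • v) = (a * b) • g.christoffelFirst p u v := by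
    ext w
    simp [christoffelFirst]
    ring
  unfold christoffel
  rw [h]
  exact map_smul ((g.bilinForm p).toDual (g.nondegenerate_bilinForm p)).symm (a * b) _

/-- The coordinate representative `W` and the value `a` of its derivative are left free, so that
each application can supply them in whatever form it has computed. -/
theorem covDerivAlong_eq {f : N → M} {V : ∀ y : N, TangentSpace 𝓘(ℝ, E) (f y)} {x : N}
    {W : N → E} (hf : ContinuousAt f x)
    (hW : ∀ᶠ y in 𝓝 x, tangentCoordChange 𝓘(ℝ, E) (f y) (f x) (f y) (V y) = W y)
    (v : TangentSpace 𝓘(ℝ, F) x) {a : E} (ha : mfderiv 𝓘(ℝ, F) 𝓘(ℝ, E) W x v = a) :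
    g.covDerivAlong f V x v = a
      + g.christoffel (f x) (mfderiv 𝓘(ℝ, F) 𝓘(ℝ, E) f x v) (V x) := by
  have h : (fun y ↦ ((trivializationAt E (TangentSpace 𝓘(ℝ, E)) (f x)).continuousLinearMapAt ℝ
      (f y) (V y) : E)) =ᶠ[𝓝 x] W := by
    filter_upwards [hW, eventually_mem_chart_source hf (mem_chart_source E (f x))] with y hy hy'
    rw [continuousLinearMapAt_trivializationAt_apply hy', hy]
  have h2 := h.mfderiv_eq (I := 𝓘(ℝ, F)) (I' := 𝓘(ℝ, E))
  unfold covDerivAlong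
  refine congrArg (fun z : E ↦ z + (g.christoffel (f x) (mfderiv 𝓘(ℝ, F) 𝓘(ℝ, E) f x v) (V x) : E)) ?_
  exact (DFunLike.congr_fun h2 v).trans ha

theorem covDerivAlong_curveVelocity {β : ℝ → M} {t : ℝ}
    (hβ : ContMDiffAt 𝓘(ℝ, ℝ) 𝓘(ℝ, E) ∞ β t) :
    g.covDerivAlong β (curveVelocity β) t (1 : ℝ)
      = deriv (deriv (extChartAt 𝓘(ℝ, E) (β t) ∘ β)) t
        + g.christoffel (β t) (curveVelocity β t) (curveVelocity β t) := by
  have h1 : ∀ᶠ s in 𝓝 t, ContMDiffAt 𝓘(ℝ, ℝ) 𝓘(ℝ, E) 1 β s :=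
    (contMDiffAt_iff_contMDiffAt_nhds (by simp)).1 (hβ.of_le (n := ∞) (m := 1) (by simp))
  refine covDerivAlong_eq g (W := deriv (extChartAt 𝓘(ℝ, E) (β t) ∘ β)) hβ.continuousAt ?_ (1 : ℝ)
    (deriv_eq_mfderiv_one (E := E) _ t).symm
  filter_upwards [h1, eventually_mem_chart_source hβ.continuousAt (mem_chart_source E (β t))]
    with s hs hs'
  exact (deriv_extChartAt_comp (hs.mdifferentiableAt (by simp)) hs').symm

/-- The metric at `p`, as a bilinear form on the model space. -/
noncomputable def form (p : M) : E →L[ℝ] E →L[ℝ] ℝ := g.inner p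

/-- When both arguments are the same vector, the first two terms of the Christoffel symbol coincide
and the Euler-Lagrange expression appears. That expression is chart independent, whereas the
definition of the covariant derivative is tied to the preferred chart at the point. -/
theorem inner_add_christoffel (p : M) (u a w : E) :
    g.form p (a + g.christoffel p u u) w
      = eulerLagrange (g.metricCoord p) (extChartAt 𝓘(ℝ, E) p p) u a w := by
  have h1 : g.form p a w = g.metricCoord p (extChartAt 𝓘(ℝ, E) p p) a w := by
    rw [metricCoord_apply g (mem_chart_source E p), tangentCoordChange_self_apply,
      tangentCoordChange_self_apply]
    rfl
  have h2 : g.form p (g.christoffel p u u) w = g.christoffelFirst p u u w :=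
    g.inner_christoffel p u u w
  rw [map_add, add_apply, h2, h1, eulerLagrange, christoffelFirst, derivInCoordinates_eq]
  simp
  ring

theorem deriv_extChartAt_comp_self {β : ℝ → M} {t : ℝ}
    (hβ : MDifferentiableAt 𝓘(ℝ, ℝ) 𝓘(ℝ, E) β t) :
    deriv (extChartAt 𝓘(ℝ, E) (β t) ∘ β) t = curveVelocity β t :=
  (deriv_extChartAt_comp hβ (mem_chart_source E (β t))).trans
    (tangentCoordChange_self_apply (β t) _)

theorem fderiv_extChartAt_transition {p q z : M} (hzp : z ∈ (chartAt E p).source)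
    (hzq : z ∈ (chartAt E q).source) :
    fderiv ℝ (extChartAt 𝓘(ℝ, E) p ∘ (extChartAt 𝓘(ℝ, E) q).symm) (extChartAt 𝓘(ℝ, E) q z)
      = tangentCoordChange 𝓘(ℝ, E) q p z := by
  rw [← extChartAt_source 𝓘(ℝ, E)] at hzp hzq
  have h := hasFDerivWithinAt_tangentCoordChange (I := 𝓘(ℝ, E)) ⟨hzq, hzp⟩
  rw [modelWithCornersSelf_coe, range_id, hasFDerivWithinAt_univ] at h
  exact h.fderiv

theorem contDiffAt_extChartAt_transition {p q z : M} (hzp : z ∈ (chartAt E p).source)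
    (hzq : z ∈ (chartAt E q).source) :
    ContDiffAt ℝ ∞ (extChartAt 𝓘(ℝ, E) p ∘ (extChartAt 𝓘(ℝ, E) q).symm)
      (extChartAt 𝓘(ℝ, E) q z) := by
  rw [← extChartAt_source 𝓘(ℝ, E)] at hzp hzq
  have h := contDiffWithinAt_ext_coord_change (I := 𝓘(ℝ, E)) (n := ∞) p q
    (y := extChartAt 𝓘(ℝ, E) q z) (by
      rw [PartialEquiv.trans_source'', PartialEquiv.symm_symm, PartialEquiv.symm_target]
      exact mem_image_of_mem _ ⟨hzq, hzp⟩)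
  rwa [modelWithCornersSelf_coe, range_id, contDiffWithinAt_univ] at h

theorem metricCoord_transition {p q z : M} (hzp : z ∈ (chartAt E p).source)
    (hzq : z ∈ (chartAt E q).source) (v w : E) :
    g.metricCoord q (extChartAt 𝓘(ℝ, E) q z) v w
      = g.metricCoord p (extChartAt 𝓘(ℝ, E) p z) (tangentCoordChange 𝓘(ℝ, E) q p z v)
        (tangentCoordChange 𝓘(ℝ, E) q p z w) := by
  rw [g.metricCoord_apply hzp, g.metricCoord_apply hzq]
  rw [← extChartAt_source 𝓘(ℝ, E)] at hzp hzq
  rw [tangentCoordChange_comp ⟨⟨hzq, hzp⟩, mem_extChartAt_source z⟩,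
    tangentCoordChange_comp ⟨⟨hzq, hzp⟩, mem_extChartAt_source z⟩]

/-- In any chart, the covariant acceleration of a curve is given by the Euler-Lagrange expression
of the energy. -/
theorem form_covDerivAlong {β : ℝ → M} {t : ℝ} {p : M}
    (hβ : ContMDiffAt 𝓘(ℝ, ℝ) 𝓘(ℝ, E) ∞ β t) (hp : β t ∈ (chartAt E p).source) (w : E) :
    g.form (β t) (g.covDerivAlong β (curveVelocity β) t (1 : ℝ))
        (tangentCoordChange 𝓘(ℝ, E) p (β t) (β t) w)
      = eulerLagrange (g.metricCoord p) (extChartAt 𝓘(ℝ, E) p (β t))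
          (deriv (extChartAt 𝓘(ℝ, E) p ∘ β) t) (deriv (deriv (extChartAt 𝓘(ℝ, E) p ∘ β)) t) w := by
  set q := β t with hq
  set φ := extChartAt 𝓘(ℝ, E) p ∘ (extChartAt 𝓘(ℝ, E) q).symm with hφdef
  set c₀ := extChartAt 𝓘(ℝ, E) q ∘ β with hc₀
  set c := extChartAt 𝓘(ℝ, E) p ∘ β with hc
  have hqq : q ∈ (chartAt E q).source := mem_chart_source E q
  have hφy : φ (extChartAt 𝓘(ℝ, E) q q) = extChartAt 𝓘(ℝ, E) p q := by
    simp [hφdef]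
  have hφ : ContDiffAt ℝ ∞ φ (extChartAt 𝓘(ℝ, E) q q) := contDiffAt_extChartAt_transition hp hqq
  have hφ2 : ContDiffAt ℝ 2 φ (extChartAt 𝓘(ℝ, E) q q) := hφ.of_le (WithTop.coe_le_coe.2 le_top)
  have hc₀s : ContDiffAt ℝ ∞ c₀ t := contDiffAt_extChartAt_comp hβ hqq
  have hc₀2 : ContDiffAt ℝ 2 c₀ t := hc₀s.of_le (WithTop.coe_le_coe.2 le_top)
  have hcφ : c =ᶠ[𝓝 t] φ ∘ c₀ := by
    filter_upwards [eventually_mem_chart_source hβ.continuousAt hqq] with s hs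
    rw [← extChartAt_source 𝓘(ℝ, E)] at hs
    simp only [hc, hφdef, hc₀, Function.comp_apply, (extChartAt 𝓘(ℝ, E) q).left_inv hs]
  have hφ1 : ∀ᶠ s in 𝓝 t, DifferentiableAt ℝ φ (c₀ s) :=
    hc₀s.continuousAt.eventually ((hφ2.eventually (by simp)).mono
      fun y hy ↦ hy.differentiableAt (by simp))
  have hd : deriv c =ᶠ[𝓝 t] fun s ↦ fderiv ℝ φ (c₀ s) (deriv c₀ s) := by
    refine hcφ.deriv.trans ?_
    filter_upwards [hφ1, hc₀2.eventually (by simp)] with s h1 h2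
    exact (h1.hasFDerivAt.comp_hasDerivAt s
      (h2.differentiableAt (by simp)).hasDerivAt).deriv
  -- The term with the second derivative of the transition map is exactly the correction of the
  -- acceleration that occurs in `eulerLagrange_comp`.
  have hd2 : deriv (deriv c) t = fderiv ℝ φ (c₀ t) (deriv (deriv c₀) t)
      + fderiv ℝ (fderiv ℝ φ) (c₀ t) (deriv c₀ t) (deriv c₀ t) := by
    rw [hd.deriv_eq]
    have h1 : HasFDerivAt (fderiv ℝ φ) (fderiv ℝ (fderiv ℝ φ) (c₀ t)) (c₀ t) :=
      ((hφ2.fderiv_right (m := 1) (by norm_num)).differentiableAt (by simp)).hasFDerivAt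
    have h2 : HasDerivAt c₀ (deriv c₀ t) t := (hc₀2.differentiableAt (by simp)).hasDerivAt
    have h3 : HasDerivAt (deriv c₀) (deriv (deriv c₀) t) t := by
      have : ContDiffAt ℝ 1 (deriv c₀) t :=
        (hc₀2.fderiv_right (m := 1) (by norm_num)).clm_apply contDiffAt_const
      exact (this.differentiableAt (by simp)).hasDerivAt
    have h4 : HasDerivAt (fun s ↦ fderiv ℝ φ (c₀ s) (deriv c₀ s))
        (fderiv ℝ (fderiv ℝ φ) (c₀ t) (deriv c₀ t) (deriv c₀ t)
          + fderiv ℝ φ (c₀ t) (deriv (deriv c₀) t)) t := (h1.comp_hasDerivAt t h2).clm_apply h3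
    rw [h4.deriv, add_comm]
  have hcov : g.covDerivAlong β (curveVelocity β) t (1 : ℝ)
      = deriv (deriv c₀) t + g.christoffel q (deriv c₀ t) (deriv c₀ t) := by
    rw [hc₀, hq, deriv_extChartAt_comp_self (hβ.mdifferentiableAt (by simp))]
    exact g.covDerivAlong_curveVelocity hβ
  have hmetric : ∀ᶠ z in 𝓝 (extChartAt 𝓘(ℝ, E) q q), ∀ v w, g.metricCoord q z v w
      = g.metricCoord p (φ z) (fderiv ℝ φ z v) (fderiv ℝ φ z w) := by
    have h1 : ∀ᶠ y in 𝓝 (extChartAt 𝓘(ℝ, E) q q),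
        (extChartAt 𝓘(ℝ, E) q).symm y ∈ (chartAt E p).source :=
      eventually_mem_chart_source (continuousAt_extChartAt_symm q) (by simpa using hp)
    filter_upwards [h1, extChartAt_target_mem_nhds (I := 𝓘(ℝ, E)) q] with y hy hyt v w
    have h2 := (extChartAt 𝓘(ℝ, E) q).map_target hyt
    rw [extChartAt_source] at h2
    have h3 := g.metricCoord_transition hy h2 v w
    rw [← fderiv_extChartAt_transition hy h2, (extChartAt 𝓘(ℝ, E) q).right_inv hyt] at h3
    exact h3
  have hEL := eulerLagrange_comp (G := g.metricCoord p) (G' := g.metricCoord q) (φ := φ)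
    (y := extChartAt 𝓘(ℝ, E) q q)
    (by rw [hφy]; exact (g.contDiffAt_metricCoord hp).differentiableAt (by simp)) hφ2
    (fun v w ↦ g.metricCoord_symm p _ v w) hmetric
    ((g.contDiffAt_metricCoord hqq).differentiableAt (by simp)) (deriv c₀ t) (deriv (deriv c₀) t)
    (tangentCoordChange 𝓘(ℝ, E) p q q w)
  have hw : fderiv ℝ φ (extChartAt 𝓘(ℝ, E) q q) (tangentCoordChange 𝓘(ℝ, E) p q q w) = w := by
    rw [hφdef, fderiv_extChartAt_transition hp hqq, tangentCoordChange_comp_cancel hp]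
  have hct : c₀ t = extChartAt 𝓘(ℝ, E) q q := rfl
  rw [hw, hφy] at hEL
  rw [hcov, g.inner_add_christoffel, hEL, hd2, hd.self_of_nhds]
  rfl

end LorentzianMetric

end CovariantDerivative

/-! ### Geodesics: uniqueness, reparametrization and the exponential map. -/

section Geodesics

set_option synthInstance.maxHeartbeats 400000

variable {E : Type*} [NormedAddCommGroup E] [NormedSpace ℝ E]
  {M : Type*} [TopologicalSpace M] [ChartedSpace E M] [IsManifold 𝓘(ℝ, E) ∞ M]

/-- The velocity of a curve, as an element of the model space. -/
noncomputable def velocity (β : ℝ → M) (t : ℝ) : E := curveVelocity (E := E) β t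

theorem exists_Ioo_subset {s : Set ℝ} (hs : IsOpen s) (hc : s.OrdConnected) {x y : ℝ} (hx : x ∈ s)
    (hy : y ∈ s) : ∃ a b, a < x ∧ y < b ∧ Ioo a b ⊆ s := by
  obtain ⟨a, ha, has⟩ := exists_Ioc_subset_of_mem_nhds (hs.mem_nhds hx) (exists_lt x)
  obtain ⟨b, hb, hbs⟩ := exists_Ico_subset_of_mem_nhds (hs.mem_nhds hy) (exists_gt y)
  refine ⟨a, b, ha, hb, fun z hz ↦ ?_⟩
  rcases le_total z x with h | h
  · exact has ⟨hz.1, h⟩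
  · rcases le_total y z with h' | h'
    · exact hbs ⟨h', hz.2⟩
    · exact hc.out hx hy ⟨h, h'⟩

theorem hasDerivAt_of_contDiffAt {c : ℝ → E} {t : ℝ} (hc : ContDiffAt ℝ ∞ c t) :
    HasDerivAt c (deriv c t) t :=
  (hc.differentiableAt (by simp)).hasDerivAt

theorem ContDiffAt.deriv_infty {c : ℝ → E} {t : ℝ} (hc : ContDiffAt ℝ ∞ c t) :
    ContDiffAt ℝ ∞ (deriv c) t :=
  (hc.fderiv_right (m := ∞) (by simp)).clm_apply contDiffAt_const

theorem velocity_eq_deriv {β : ℝ → M} {t : ℝ} (hβ : MDifferentiableAt 𝓘(ℝ, ℝ) 𝓘(ℝ, E) β t) :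
    velocity (E := E) β t = deriv (extChartAt 𝓘(ℝ, E) (β t) ∘ β) t :=
  ((deriv_extChartAt_comp hβ (mem_chart_source E (β t))).trans
    (tangentCoordChange_self_apply (β t) _)).symm

theorem velocity_comp {β : ℝ → M} {T : ℝ → ℝ} {t : ℝ} {T' : ℝ}
    (hβ : MDifferentiableAt 𝓘(ℝ, ℝ) 𝓘(ℝ, E) β (T t)) (hT : HasDerivAt T T' t) :
    velocity (E := E) (β ∘ T) t = T' • velocity (E := E) β (T t) := by
  have h1 := hT.hasFDerivAt.hasMFDerivAt
  rw [velocity_eq_deriv hβ, velocity_eq_deriv (hβ.comp t h1.mdifferentiableAt)]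
  have h2 : HasDerivAt (extChartAt 𝓘(ℝ, E) (β (T t)) ∘ β)
      (deriv (extChartAt 𝓘(ℝ, E) (β (T t)) ∘ β) (T t)) (T t) :=
    (MDifferentiableAt.comp (I' := 𝓘(ℝ, E)) (T t)
      (mdifferentiableAt_extChartAt (mem_chart_source E _)) hβ).differentiableAt.hasDerivAt
  exact (h2.scomp t hT).deriv

namespace LorentzianMetric

variable (g : LorentzianMetric E M) [FiniteDimensional ℝ E]

theorem isInvertible_metricCoord {p q : M} (h : q ∈ (chartAt E p).source) :
    (g.metricCoord p (extChartAt 𝓘(ℝ, E) p q)).IsInvertible := by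
  set B := g.metricCoord p (extChartAt 𝓘(ℝ, E) p q) with hB
  have hinj : Function.Injective (B : E →ₗ[ℝ] E →L[ℝ] ℝ) := by
    rw [← LinearMap.ker_eq_bot, LinearMap.ker_eq_bot']
    intro v hv
    have h1 : tangentCoordChange 𝓘(ℝ, E) p q q v = (0 : E) := by
      refine g.eq_of_inner_eq (p := q) fun w ↦ ?_
      have h2 := g.metricCoord_apply h v (tangentCoordChange 𝓘(ℝ, E) q p q w)
      rw [tangentCoordChange_comp_cancel' h] at h2
      rw [← h2]
      have h3 : B v = 0 := hv
      rw [← hB, h3]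
      exact (congrArg (fun f : E →L[ℝ] ℝ ↦ f w) ((g.form q).map_zero)).symm
    have h4 := tangentCoordChange_comp_cancel h v
    rw [h1, map_zero] at h4
    exact h4.symm
  have hfr : Module.finrank ℝ E = Module.finrank ℝ (E →L[ℝ] ℝ) :=
    (Subspace.dual_finrank_eq (K := ℝ) (V := E)).symm.trans
      (LinearMap.toContinuousLinearMap (𝕜 := ℝ) (E := E) (F' := ℝ)).finrank_eq
  let e := LinearEquiv.ofInjectiveOfFinrankEq (B : E →ₗ[ℝ] E →L[ℝ] ℝ) hinj hfr
  exact ⟨e.toContinuousLinearEquiv, by ext; rfl⟩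

/-- The covariant acceleration of a curve, as an element of the model space. -/
noncomputable def acceleration (β : ℝ → M) (t : ℝ) : E :=
  g.covDerivAlong β (curveVelocity β) t (1 : ℝ)

theorem acceleration_eq {β : ℝ → M} {t : ℝ} (hβ : ContMDiffAt 𝓘(ℝ, ℝ) 𝓘(ℝ, E) ∞ β t) :
    g.acceleration β t = deriv (deriv (extChartAt 𝓘(ℝ, E) (β t) ∘ β)) t
        + g.christoffel (β t) (velocity β t) (velocity β t) :=
  g.covDerivAlong_curveVelocity hβ

theorem eulerLagrange_eq_zero {β : ℝ → M} {t : ℝ} {p : M}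
    (hβ : ContMDiffAt 𝓘(ℝ, ℝ) 𝓘(ℝ, E) ∞ β t) (hp : β t ∈ (chartAt E p).source)
    (h0 : g.covDerivAlong β (curveVelocity β) t (1 : ℝ) = 0) (w : E) :
    eulerLagrange (g.metricCoord p) (extChartAt 𝓘(ℝ, E) p (β t))
      (deriv (extChartAt 𝓘(ℝ, E) p ∘ β) t) (deriv (deriv (extChartAt 𝓘(ℝ, E) p ∘ β)) t) w = 0 := by
  rw [← g.form_covDerivAlong hβ hp w, h0]
  exact congrArg (fun f : E →L[ℝ] ℝ ↦ f _) ((g.form (β t)).map_zero)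

variable {g}

theorem IsGeodesicOn.contMDiffAt {β : ℝ → M} {s : Set ℝ} (h : g.IsGeodesicOn β s) (hs : IsOpen s)
    {t : ℝ} (ht : t ∈ s) : ContMDiffAt 𝓘(ℝ, ℝ) 𝓘(ℝ, E) ∞ β t :=
  (h.1 t ht).contMDiffAt (hs.mem_nhds ht)

theorem IsGeodesicOn.mono {β : ℝ → M} {s s' : Set ℝ} (h : g.IsGeodesicOn β s) (hs : s' ⊆ s) :
    g.IsGeodesicOn β s' :=
  ⟨h.1.mono hs, fun t ht ↦ h.2 t (hs ht)⟩

theorem IsGeodesicOn.eventually_eulerLagrange {β : ℝ → M} {s : Set ℝ} {t : ℝ} {p : M}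
    (h : g.IsGeodesicOn β s) (hs : IsOpen s) (ht : t ∈ s) (hp : β t ∈ (chartAt E p).source) :
    ∀ᶠ u in 𝓝 t, ∀ w, eulerLagrange (g.metricCoord p) ((extChartAt 𝓘(ℝ, E) p ∘ β) u)
      (deriv (extChartAt 𝓘(ℝ, E) p ∘ β) u)
      (deriv (deriv (extChartAt 𝓘(ℝ, E) p ∘ β)) u) w = 0 := by
  filter_upwards [eventually_mem_chart_source (h.contMDiffAt hs ht).continuousAt hp,
    hs.mem_nhds ht] with u hu hu' w
  exact g.eulerLagrange_eq_zero (h.contMDiffAt hs hu') hu (h.2 u hu') w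

/-- Velocities are compared in a fixed chart, because at a limit time their equality is obtained as
a limit of coordinate derivatives. -/
theorem IsGeodesicOn.eventuallyEq {β₁ β₂ : ℝ → M} {s₁ s₂ : Set ℝ} {t : ℝ} {p : M}
    (h₁ : g.IsGeodesicOn β₁ s₁) (h₂ : g.IsGeodesicOn β₂ s₂) (hs₁ : IsOpen s₁) (hs₂ : IsOpen s₂)
    (ht₁ : t ∈ s₁) (ht₂ : t ∈ s₂) (hp : β₁ t ∈ (chartAt E p).source) (h0 : β₁ t = β₂ t)
    (h0' : deriv (extChartAt 𝓘(ℝ, E) p ∘ β₁) t = deriv (extChartAt 𝓘(ℝ, E) p ∘ β₂) t) :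
    β₁ =ᶠ[𝓝 t] β₂ := by
  have hp₂ : β₂ t ∈ (chartAt E p).source := h0 ▸ hp
  have hc₁ := contDiffAt_extChartAt_comp (h₁.contMDiffAt hs₁ ht₁) hp
  have hc₂ := contDiffAt_extChartAt_comp (h₂.contMDiffAt hs₂ ht₂) hp₂
  have key := eventuallyEq_of_eulerLagrange_eq_zero (G := g.metricCoord p)
    (c₁ := extChartAt 𝓘(ℝ, E) p ∘ β₁) (c₂ := extChartAt 𝓘(ℝ, E) p ∘ β₂)
    (g.contDiffAt_metricCoord hp) (g.isInvertible_metricCoord hp) hc₁ hc₂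
    (h₁.eventually_eulerLagrange hs₁ ht₁ hp) (h₂.eventually_eulerLagrange hs₂ ht₂ hp₂)
    (congrArg (extChartAt 𝓘(ℝ, E) p) h0) h0'
  filter_upwards [key, eventually_mem_chart_source (h₁.contMDiffAt hs₁ ht₁).continuousAt hp,
    eventually_mem_chart_source (h₂.contMDiffAt hs₂ ht₂).continuousAt hp₂] with u hu hu₁ hu₂
  rw [← extChartAt_source 𝓘(ℝ, E)] at hu₁ hu₂
  exact (extChartAt 𝓘(ℝ, E) p).injOn hu₁ hu₂ hu

theorem IsGeodesicOn.eventuallyEq_of_velocity_eq {β₁ β₂ : ℝ → M} {s₁ s₂ : Set ℝ} {t : ℝ}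
    (h₁ : g.IsGeodesicOn β₁ s₁) (h₂ : g.IsGeodesicOn β₂ s₂) (hs₁ : IsOpen s₁) (hs₂ : IsOpen s₂)
    (ht₁ : t ∈ s₁) (ht₂ : t ∈ s₂) (h0 : β₁ t = β₂ t)
    (h0' : velocity (E := E) β₁ t = velocity β₂ t) : β₁ =ᶠ[𝓝 t] β₂ := by
  refine h₁.eventuallyEq h₂ hs₁ hs₂ ht₁ ht₂ (mem_chart_source E (β₁ t)) h0 ?_
  rw [velocity_eq_deriv ((h₁.contMDiffAt hs₁ ht₁).mdifferentiableAt (by simp)),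
    velocity_eq_deriv ((h₂.contMDiffAt hs₂ ht₂).mdifferentiableAt (by simp)), ← h0] at h0'
  exact h0'

/-- The set of times with equal germs is open by local uniqueness. It is closed in `s` because, in a
chart at a limit point, position and velocity pass to the limit. -/
theorem IsGeodesicOn.eqOn [T2Space M] {β₁ β₂ : ℝ → M} {s : Set ℝ} {t₀ : ℝ}
    (h₁ : g.IsGeodesicOn β₁ s) (h₂ : g.IsGeodesicOn β₂ s) (hs : IsOpen s) (hc : IsPreconnected s)
    (ht₀ : t₀ ∈ s) (h0 : β₁ t₀ = β₂ t₀) (h0' : velocity (E := E) β₁ t₀ = velocity β₂ t₀) :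
    EqOn β₁ β₂ s := by
  have key : s ⊆ {t | β₁ =ᶠ[𝓝 t] β₂} := by
    refine hc.subset_of_closure_inter_subset isOpen_setOfPred_eventually_nhds
      ⟨t₀, ht₀, h₁.eventuallyEq_of_velocity_eq h₂ hs hs ht₀ ht₀ h0 h0'⟩ ?_
    rintro t ⟨htc, ht⟩
    have hfr : ∃ᶠ u in 𝓝 t, β₁ =ᶠ[𝓝 u] β₂ := mem_closure_iff_frequently.1 htc
    have heq : β₁ t = β₂ t := tendsto_nhds_unique_of_frequently_eq
      (h₁.contMDiffAt hs ht).continuousAt (h₂.contMDiffAt hs ht).continuousAt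
      (hfr.mono fun u hu ↦ hu.self_of_nhds)
    have hm : β₂ t ∈ (chartAt E (β₁ t)).source := heq ▸ mem_chart_source E (β₁ t)
    refine h₁.eventuallyEq h₂ hs hs ht ht (mem_chart_source E (β₁ t)) heq ?_
    refine tendsto_nhds_unique_of_frequently_eq
      (contDiffAt_extChartAt_comp (h₁.contMDiffAt hs ht)
        (mem_chart_source E (β₁ t))).deriv_infty.continuousAt
      (contDiffAt_extChartAt_comp (h₂.contMDiffAt hs ht) hm).deriv_infty.continuousAt
      (hfr.mono fun u hu ↦ ?_)
    exact (hu.fun_comp (extChartAt 𝓘(ℝ, E) (β₁ t))).deriv_eq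
  exact fun t ht ↦ (key ht).self_of_nhds

-- The coordinate acceleration of `β ∘ T` is `T'² c'' + T'' c'`, and the Christoffel term is
-- quadratic in the velocity, so that it scales with `T'²` as well.
variable (g) in
theorem acceleration_comp {β : ℝ → M} {T : ℝ → ℝ} {t : ℝ}
    (hβ : ContMDiffAt 𝓘(ℝ, ℝ) 𝓘(ℝ, E) ∞ β (T t)) (hT : ContDiffAt ℝ ∞ T t) :
    g.acceleration (β ∘ T) t = (deriv T t) ^ 2 • g.acceleration β (T t)
        + deriv (deriv T) t • velocity (E := E) β (T t) := by
  have hβT : ContMDiffAt 𝓘(ℝ, ℝ) 𝓘(ℝ, E) ∞ (β ∘ T) t := hβ.comp t hT.contMDiffAt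
  set c := extChartAt 𝓘(ℝ, E) (β (T t)) ∘ β with hc
  have hcs : ContDiffAt ℝ ∞ c (T t) := contDiffAt_extChartAt_comp hβ (mem_chart_source E _)
  have hd : deriv (c ∘ T) =ᶠ[𝓝 t] fun u ↦ deriv T u • deriv c (T u) := by
    have h1 : ∀ᶠ u in 𝓝 t, DifferentiableAt ℝ c (T u) := hT.continuousAt.eventually
      (((hcs.of_le (m := 1) (by simp)).eventually (by simp)).mono
        fun y hy ↦ hy.differentiableAt (by simp))
    filter_upwards [h1, ((hT.of_le (m := 1) (by simp)).eventually (by simp))] with u hu hu'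
    exact (hu.hasDerivAt.scomp u (hu'.differentiableAt (by simp)).hasDerivAt).deriv
  have hd2 : deriv (deriv (c ∘ T)) t
      = (deriv T t) ^ 2 • deriv (deriv c) (T t) + deriv (deriv T) t • deriv c (T t) := by
    rw [hd.deriv_eq]
    have h2 : HasDerivAt (fun u ↦ deriv T u • deriv c (T u))
        (deriv T t • (deriv T t • deriv (deriv c) (T t)) + deriv (deriv T) t • deriv c (T t)) t :=
      (hasDerivAt_of_contDiffAt hT.deriv_infty).smul
      ((hasDerivAt_of_contDiffAt hcs.deriv_infty).scomp t (hasDerivAt_of_contDiffAt hT))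
    rw [h2.deriv, smul_smul, pow_two]
  have h1 : g.acceleration (β ∘ T) t
      = deriv (deriv (c ∘ T)) t + g.christoffel (β (T t)) (velocity (β ∘ T) t)
        (velocity (β ∘ T) t) := g.acceleration_eq hβT
  have h2 : g.acceleration β (T t)
      = deriv (deriv c) (T t) + g.christoffel (β (T t)) (velocity β (T t))
        (velocity β (T t)) := g.acceleration_eq hβ
  rw [h1, h2, hd2, velocity_comp (hβ.mdifferentiableAt (by simp)) (hasDerivAt_of_contDiffAt hT),
    christoffel_smul_smul, velocity_eq_deriv (hβ.mdifferentiableAt (by simp)), smul_add, pow_two]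
  abel

theorem IsGeodesicOn.comp_mul_add {β : ℝ → M} {s : Set ℝ} (h : g.IsGeodesicOn β s)
    (hs : IsOpen s) (a b : ℝ) :
    g.IsGeodesicOn (β ∘ fun u ↦ a * u + b) ((fun u ↦ a * u + b) ⁻¹' s) := by
  have hT : ContDiff ℝ ∞ fun u : ℝ ↦ a * u + b := by fun_prop
  refine ⟨h.1.comp hT.contMDiff.contMDiffOn fun u hu ↦ hu, fun t ht ↦ ?_⟩
  have hd : deriv (fun u : ℝ ↦ a * u + b) = fun _ ↦ a := by
    funext u
    simp
  have h1 := g.acceleration_comp (T := fun u ↦ a * u + b) (t := t) (h.contMDiffAt hs ht) hT.contDiffAt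
  rw [hd, deriv_const, zero_smul, add_zero] at h1
  have h2 : g.acceleration β (a * t + b) = 0 := h.2 _ ht
  rw [h2, smul_zero] at h1
  exact h1

theorem IsGeodesicOn.velocity_comp_mul_add {β : ℝ → M} {s : Set ℝ} (h : g.IsGeodesicOn β s)
    (hs : IsOpen s) (a b : ℝ) {t : ℝ} (ht : a * t + b ∈ s) :
    velocity (E := E) (β ∘ fun u ↦ a * u + b) t = a • velocity (E := E) β (a * t + b) := by
  refine velocity_comp (T := fun u ↦ a * u + b) ((h.contMDiffAt hs ht).mdifferentiableAt (by simp)) ?_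
  simpa using ((hasDerivAt_id t).const_mul a).add_const b

theorem mk_velocity_eq_iff {γ : ℝ → M} {t : ℝ} {p : M} {u : E} :
    (⟨γ t, curveVelocity γ t⟩ : TangentBundle 𝓘(ℝ, E) M) = ⟨p, u⟩
      ↔ γ t = p ∧ velocity (E := E) γ t = u := by
  constructor
  · intro h
    exact ⟨congrArg TotalSpace.proj h, congrArg (fun v : TangentBundle 𝓘(ℝ, E) M ↦ (v.2 : E)) h⟩
  · rintro ⟨rfl, h⟩
    exact TotalSpace.ext rfl (heq_of_eq h)

/-- Two admissible geodesics agree on the intersection of their intervals, which contains `0` and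
`1`; the geodesic chosen in the definition is therefore immaterial. -/
theorem exp_eq [T2Space M] {v : TangentBundle 𝓘(ℝ, E) M} {γ : ℝ → M} (h : g.IsGeodesicFrom v γ) :
    g.exp v = γ 1 := by
  have h' : ∃ γ : ℝ → M, g.IsGeodesicFrom v γ := ⟨γ, h⟩
  rw [exp, dif_pos h']
  obtain ⟨a, b, ha, hb, hγ, hv⟩ := h
  obtain ⟨a', b', ha', hb', hγ', hv'⟩ := h'.choose_spec
  obtain ⟨h1, h2⟩ := mk_velocity_eq_iff.1 (hv'.trans hv.symm)
  exact (hγ'.mono (Ioo_subset_Ioo_left (le_max_right a a')) |>.mono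
      (Ioo_subset_Ioo_right (min_le_right b b'))).eqOn
    (hγ.mono (Ioo_subset_Ioo_left (le_max_left a a')) |>.mono
      (Ioo_subset_Ioo_right (min_le_left b b'))) isOpen_Ioo isPreconnected_Ioo
    (t₀ := 0) ⟨max_lt ha ha', lt_min (by linarith) (by linarith)⟩ h1 h2
    ⟨max_lt (by linarith) (by linarith), lt_min hb hb'⟩

/-- The geodesic `u ↦ β (s u)` has initial velocity `s u₀`, where `u₀` is that of `β`, and reaches
`β s` at time `1`. Order-connectedness of `J` ensures that it is defined on an interval around `[0,
1]`. -/
theorem IsGeodesicOn.exp_smul [T2Space M] {β : ℝ → M} {J : Set ℝ} {s : ℝ}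
    (hβ : g.IsGeodesicOn β J) (hJ : IsOpen J) (hJc : J.OrdConnected) (h0 : 0 ∈ J) (hs : s ∈ J)
    {p : M} {u : E} (hp : β 0 = p) (hu : velocity (E := E) β 0 = u) :
    (⟨p, (s • u : E)⟩ : TangentBundle 𝓘(ℝ, E) M) ∈ g.expDomain ∧
      g.exp (⟨p, (s • u : E)⟩ : TangentBundle 𝓘(ℝ, E) M) = β s := by
  have h1 := hβ.comp_mul_add hJ s 0
  have hJ' : IsOpen ((fun u ↦ s * u + 0) ⁻¹' J) := hJ.preimage (by fun_prop)
  have hc' : OrdConnected ((fun u ↦ s * u + 0) ⁻¹' J) := by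
    refine ⟨fun x hx y hy z hz ↦ ?_⟩
    rcases le_total 0 s with h | h
    · exact hJc.out hx hy ⟨by nlinarith [hz.1], by nlinarith [hz.2]⟩
    · exact hJc.out hy hx ⟨by nlinarith [hz.2], by nlinarith [hz.1]⟩
  obtain ⟨a, b, ha, hb, hab⟩ := exists_Ioo_subset hJ' hc' (x := 0) (y := 1) (by simpa using h0)
    (by simpa using hs)
  have key : g.IsGeodesicFrom (⟨p, (s • u : E)⟩ : TangentBundle 𝓘(ℝ, E) M)
      (β ∘ fun u ↦ s * u + 0) := by
    refine ⟨a, b, ha, hb, h1.mono hab, mk_velocity_eq_iff.2 ⟨by simpa using hp, ?_⟩⟩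
    rw [hβ.velocity_comp_mul_add hJ s 0 (by simpa using h0), mul_zero, add_zero, hu]
  exact ⟨⟨_, key⟩, (exp_eq key).trans (by simp)⟩

/-- Undoing the scaling by `s` produces a single geodesic, with unscaled initial velocity, that
carries `exp` along the whole segment from `0` to `s`. -/
theorem exists_isGeodesicOn_of_mem_expDomain {p : M} {u : E} {s : ℝ} (hs : s ≠ 0)
    (h : (⟨p, (s • u : E)⟩ : TangentBundle 𝓘(ℝ, E) M) ∈ g.expDomain) :
    ∃ (β : ℝ → M) (J : Set ℝ), g.IsGeodesicOn β J ∧ IsOpen J ∧ J.OrdConnected ∧ 0 ∈ J ∧ s ∈ J ∧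
      β 0 = p ∧ velocity (E := E) β 0 = u := by
  obtain ⟨γ, a, b, ha, hb, hγ, hv⟩ := h
  obtain ⟨h1, h2⟩ := mk_velocity_eq_iff.1 hv
  refine ⟨_, _, hγ.comp_mul_add isOpen_Ioo s⁻¹ 0, isOpen_Ioo.preimage (by fun_prop), ?_, ?_, ?_,
    by simpa using h1, ?_⟩
  · refine ⟨fun x hx y hy z hz ↦ ?_⟩
    rcases le_total 0 s⁻¹ with h | h
    · exact ordConnected_Ioo.out hx hy ⟨by nlinarith [hz.1], by nlinarith [hz.2]⟩
    · exact ordConnected_Ioo.out hy hx ⟨by nlinarith [hz.2], by nlinarith [hz.1]⟩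
  · simp only [mem_preimage, mul_zero, add_zero]
    exact ⟨ha, by linarith⟩
  · simp only [mem_preimage, inv_mul_cancel₀ hs, add_zero]
    exact ⟨by linarith, hb⟩
  · rw [hγ.velocity_comp_mul_add isOpen_Ioo s⁻¹ 0 (by simpa using ⟨ha, by linarith⟩), mul_zero,
      add_zero, h2, smul_smul, inv_mul_cancel₀ hs, one_smul]

end LorentzianMetric

end Geodesics

/-! ### Vector fields and integral curves in charts. -/

section CoordinateFields

variable {F : Type*} [NormedAddCommGroup F] [NormedSpace ℝ F]
  {L : Type*} [TopologicalSpace L] [ChartedSpace F L] [IsManifold 𝓘(ℝ, F) ∞ L]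

/-- The components of a vector field in the preferred chart at `x₀`. -/
noncomputable def coordField (ξ : ∀ x : L, TangentSpace 𝓘(ℝ, F) x) (x₀ : L) (z : F) : F :=
  let y := (extChartAt 𝓘(ℝ, F) x₀).symm z
  tangentCoordChange 𝓘(ℝ, F) y x₀ y (ξ y)

variable {ξ : ∀ x : L, TangentSpace 𝓘(ℝ, F) x}

theorem coordField_extChartAt {x₀ y : L} (hy : y ∈ (chartAt F x₀).source) :
    coordField ξ x₀ (extChartAt 𝓘(ℝ, F) x₀ y) = tangentCoordChange 𝓘(ℝ, F) y x₀ y (ξ y) := by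
  rw [coordField, (extChartAt 𝓘(ℝ, F) x₀).left_inv (by rwa [extChartAt_source])]

theorem contMDiffOn_iff_extChartAt_source {s : L → F} {x₀ : L}
    (h : ContMDiffOn 𝓘(ℝ, F) 𝓘(ℝ, F) ∞ s (chartAt F x₀).source) :
    ContDiffOn ℝ ∞ (s ∘ (extChartAt 𝓘(ℝ, F) x₀).symm) (extChartAt 𝓘(ℝ, F) x₀).target := by
  rw [← contMDiffOn_iff_contDiffOn]
  refine h.comp (contMDiffOn_extChartAt_symm x₀) fun y hy ↦ ?_
  rw [← extChartAt_source 𝓘(ℝ, F)]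
  exact (extChartAt 𝓘(ℝ, F) x₀).map_target hy

theorem contDiffOn_coordField
    (hξ : ContMDiff 𝓘(ℝ, F) 𝓘(ℝ, F).tangent ∞
      (fun x : L ↦ (⟨x, ξ x⟩ : TangentBundle 𝓘(ℝ, F) L))) (x₀ : L) :
    ContDiffOn ℝ ∞ (coordField ξ x₀) (extChartAt 𝓘(ℝ, F) x₀).target := by
  have h1 := ((trivializationAt F (TangentSpace 𝓘(ℝ, F)) x₀).contMDiffOn_section_baseSet_iff).1
    (hξ.contMDiffOn (s := (chartAt F x₀).source))
  have h2 : ContMDiffOn 𝓘(ℝ, F) 𝓘(ℝ, F) ∞ (fun y : L ↦ (tangentCoordChange 𝓘(ℝ, F) y x₀ y (ξ y) : F))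
      (chartAt F x₀).source := by
    refine h1.congr fun y hy ↦ ?_
    rw [← continuousLinearMapAt_trivializationAt_apply hy]
    exact (trivializationAt F (TangentSpace 𝓘(ℝ, F)) x₀).continuousLinearMapAt_apply_of_mem ℝ hy _
  exact contMDiffOn_iff_extChartAt_source h2

theorem hasMFDerivAt_extChartAt_symm_comp {x₀ : L} {c : ℝ → F} {t : ℝ}
    (ht : c t ∈ (extChartAt 𝓘(ℝ, F) x₀).target) (hc : HasDerivAt c (coordField ξ x₀ (c t)) t) :
    HasMFDerivAt 𝓘(ℝ, ℝ) 𝓘(ℝ, F) ((extChartAt 𝓘(ℝ, F) x₀).symm ∘ c) t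
      ((1 : ℝ →L[ℝ] ℝ).smulRight (ξ ((extChartAt 𝓘(ℝ, F) x₀).symm (c t)))) := by
  set y := (extChartAt 𝓘(ℝ, F) x₀).symm (c t) with hy
  have hys : y ∈ (chartAt F x₀).source := by
    rw [← extChartAt_source 𝓘(ℝ, F)]
    exact (extChartAt 𝓘(ℝ, F) x₀).map_target ht
  have hcy : extChartAt 𝓘(ℝ, F) x₀ y = c t := (extChartAt 𝓘(ℝ, F) x₀).right_inv ht
  have h1 : MDifferentiableAt 𝓘(ℝ, F) 𝓘(ℝ, F) (extChartAt 𝓘(ℝ, F) x₀).symm (c t) :=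
    (((contMDiffOn_extChartAt_symm (n := ∞) x₀) _ ht).contMDiffAt
      ((isOpen_extChartAt_target x₀).mem_nhds ht)).mdifferentiableAt (by simp)
  have h2 := h1.hasMFDerivAt.comp t hc.hasFDerivAt.hasMFDerivAt
  have h3 := TangentBundle.symmL_trivializationAt (I := 𝓘(ℝ, F)) hys
  rw [modelWithCornersSelf_coe, range_id, mfderivWithin_univ, hcy] at h3
  have h4 : ∀ r : ℝ, (mfderiv 𝓘(ℝ, F) 𝓘(ℝ, F) (extChartAt 𝓘(ℝ, F) x₀).symm (c t)
      (r • coordField ξ x₀ (c t) : F) : F) = r • (ξ y : F) := by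
    intro r
    rw [← h3]
    refine (symmL_trivializationAt_apply hys _).trans ?_
    rw [map_smul, ← hcy, coordField_extChartAt hys]
    exact congrArg (fun z : F ↦ r • z) (tangentCoordChange_comp_cancel' hys (ξ y))
  refine h2.congr_mfderiv ?_
  exact ContinuousLinearMap.ext (M₁ := ℝ) (M₂ := F) (R₁ := ℝ) h4

theorem HasMFDerivAt.hasDerivAt_extChartAt_comp {γ : ℝ → L} {t : ℝ} {x₀ : L}
    (hγ : HasMFDerivAt 𝓘(ℝ, ℝ) 𝓘(ℝ, F) γ t ((1 : ℝ →L[ℝ] ℝ).smulRight (ξ (γ t))))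
    (h : γ t ∈ (chartAt F x₀).source) :
    HasDerivAt (extChartAt 𝓘(ℝ, F) x₀ ∘ γ)
      (coordField ξ x₀ (extChartAt 𝓘(ℝ, F) x₀ (γ t))) t := by
  have h1 := deriv_extChartAt_comp hγ.mdifferentiableAt h
  have h2 : (curveVelocity (E := F) γ t : F) = ξ (γ t) := by
    rw [curveVelocity, hγ.mfderiv]
    exact one_smul ℝ _
  rw [h2, ← coordField_extChartAt h] at h1
  rw [← h1]
  exact (MDifferentiableAt.comp (I' := 𝓘(ℝ, F)) t (mdifferentiableAt_extChartAt h)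
    hγ.mdifferentiableAt).differentiableAt.hasDerivAt

/-- In a chart the curve solves a smooth autonomous equation, so its regularity bootstraps. -/
theorem contMDiffOn_integralCurve [FiniteDimensional ℝ F]
    (hξ : ContMDiff 𝓘(ℝ, F) 𝓘(ℝ, F).tangent ∞
      (fun x : L ↦ (⟨x, ξ x⟩ : TangentBundle 𝓘(ℝ, F) L))) {γ : ℝ → L} {s : Set ℝ} (hs : IsOpen s)
    (hγ : ∀ t ∈ s, HasMFDerivAt 𝓘(ℝ, ℝ) 𝓘(ℝ, F) γ t ((1 : ℝ →L[ℝ] ℝ).smulRight (ξ (γ t)))) :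
    ContMDiffOn 𝓘(ℝ, ℝ) 𝓘(ℝ, F) ∞ γ s := by
  intro t ht
  refine ContMDiffAt.contMDiffWithinAt ?_
  set x₀ := γ t with hx₀
  have hsrc : ∀ᶠ u in 𝓝 t, γ u ∈ (chartAt F x₀).source ∧ u ∈ s :=
    (eventually_mem_chart_source (hγ t ht).continuousAt (mem_chart_source F x₀)).and
      (hs.mem_nhds ht)
  obtain ⟨o, ho, hoo, hto⟩ := eventually_nhds_iff.1 hsrc
  have h1 : ContDiffOn ℝ ∞ (extChartAt 𝓘(ℝ, F) x₀ ∘ γ) o :=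
    contDiffOn_of_hasDerivAt_comp (contDiffOn_coordField hξ x₀) hoo
      (fun u hu ↦ (hγ u (ho u hu).2).hasDerivAt_extChartAt_comp (ho u hu).1)
      (fun u hu ↦ (extChartAt 𝓘(ℝ, F) x₀).map_source
        (by rw [extChartAt_source]; exact (ho u hu).1))
  have h2 : ContMDiffAt 𝓘(ℝ, ℝ) 𝓘(ℝ, F) ∞
      ((extChartAt 𝓘(ℝ, F) x₀).symm ∘ (extChartAt 𝓘(ℝ, F) x₀ ∘ γ)) t :=
    ContMDiffAt.comp (I' := 𝓘(ℝ, F)) t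
      ((contMDiffOn_extChartAt_symm (n := ∞) x₀ _ (mem_extChartAt_target x₀)).contMDiffAt
        (extChartAt_target_mem_nhds x₀))
      (h1.contDiffAt (hoo.mem_nhds hto)).contMDiffAt
  refine h2.congr_of_eventuallyEq ?_
  filter_upwards [hsrc] with u hu
  exact ((extChartAt 𝓘(ℝ, F) x₀).left_inv (by rw [extChartAt_source]; exact hu.1)).symm

end CoordinateFields

/-! ### Injectivity of the differential of an immersion. -/

section Immersion

variable {E : Type*} [NormedAddCommGroup E] [NormedSpace ℝ E]
  {M : Type*} [TopologicalSpace M] [ChartedSpace E M] [IsManifold 𝓘(ℝ, E) ∞ M]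
  {F : Type*} [NormedAddCommGroup F] [NormedSpace ℝ F]
  {L : Type*} [TopologicalSpace L] [ChartedSpace F L] [IsManifold 𝓘(ℝ, F) ∞ L]

/-- In the adapted charts `i` is the inclusion of a factor. Projecting back gives a smooth local
left inverse `r` of `i`, and the chain rule makes the differential of `r` a left inverse of that of
`i`. -/
theorem mfderiv_injective_of_charts {K : Type*} [NormedAddCommGroup K] [NormedSpace ℝ K]
    {i : L → M} {x : L} (hi : MDifferentiableAt 𝓘(ℝ, F) 𝓘(ℝ, E) i x)
    {φ : OpenPartialHomeomorph L F} (hφ : φ ∈ IsManifold.maximalAtlas 𝓘(ℝ, F) ∞ L)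
    {ψ : OpenPartialHomeomorph M E} (hψ : ψ ∈ IsManifold.maximalAtlas 𝓘(ℝ, E) ∞ M)
    (hx : x ∈ φ.source) (hix : i x ∈ ψ.source) (e : (F × K) ≃L[ℝ] E)
    (he : ∀ y ∈ φ.source, ψ (i y) = e (φ y, 0)) :
    Function.Injective (mfderiv 𝓘(ℝ, F) 𝓘(ℝ, E) i x) := by
  let r₀ : E → F := fun z ↦ (e.symm z).1
  let r : M → L := φ.symm ∘ r₀ ∘ ψ
  have hr₀ : ∀ y ∈ φ.source, r₀ (ψ (i y)) = φ y := fun y hy ↦ by simp [r₀, he y hy]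
  have hleft : r ∘ i =ᶠ[𝓝 x] id := by
    filter_upwards [φ.open_source.mem_nhds hx] with y hy
    simp only [r, Function.comp_apply, hr₀ y hy, φ.left_inv hy, id_eq]
  have hr : MDifferentiableAt 𝓘(ℝ, E) 𝓘(ℝ, F) r (i x) := by
    have h1 : MDifferentiableAt 𝓘(ℝ, E) 𝓘(ℝ, E) ψ (i x) :=
      (contMDiffAt_of_mem_maximalAtlas hψ hix).mdifferentiableAt (by simp)
    have h2 : MDifferentiableAt 𝓘(ℝ, F) 𝓘(ℝ, F) φ.symm (r₀ (ψ (i x))) := by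
      rw [hr₀ x hx]
      exact (contMDiffAt_symm_of_mem_maximalAtlas hφ (φ.map_source hx)).mdifferentiableAt (by simp)
    have h3 : Differentiable ℝ r₀ := by fun_prop
    exact h2.comp (i x) ((h3 _).mdifferentiableAt.comp (i x) h1)
  have hcomp := mfderiv_comp x hr hi
  rw [hleft.mfderiv_eq] at hcomp
  refine Function.LeftInverse.injective (g := mfderiv 𝓘(ℝ, E) 𝓘(ℝ, F) r (i x)) fun v ↦ ?_
  have h4 := DFunLike.congr_fun hcomp v
  have h5 : (mfderiv 𝓘(ℝ, F) 𝓘(ℝ, F) (id : L → L) x v : F) = v := by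
    rw [mfderiv_id]; rfl
  exact (h5.symm.trans h4).symm

theorem Manifold.IsImmersionAt.mfderiv_injective {i : L → M} {x : L}
    (h : IsImmersionAt 𝓘(ℝ, F) 𝓘(ℝ, E) ∞ i x) :
    Function.Injective (mfderiv 𝓘(ℝ, F) 𝓘(ℝ, E) i x) := by
  refine mfderiv_injective_of_charts (h.contMDiffAt.mdifferentiableAt (by simp))
    h.domChart_mem_maximalAtlas h.codChart_mem_maximalAtlas h.mem_domChart_source
    h.mem_codChart_source h.equiv fun y hy ↦ ?_
  have hm : h.domChart y ∈ (h.domChart.extend 𝓘(ℝ, F)).target := by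
    simpa using h.domChart.map_source hy
  have h1 := h.writtenInCharts hm
  simp only [Function.comp_apply] at h1
  rwa [OpenPartialHomeomorph.extend_coe_symm, Function.comp_apply, modelWithCornersSelf_coe_symm,
    id_eq, h.domChart.left_inv hy] at h1

end Immersion

/-! ### The field `∇_ξ ξ` along a map into spacetime. -/

section NullHypersurfaceGeometry

set_option synthInstance.maxHeartbeats 400000

variable {E : Type*} [NormedAddCommGroup E] [NormedSpace ℝ E]
  {M : Type*} [TopologicalSpace M] [ChartedSpace E M] [IsManifold 𝓘(ℝ, E) ∞ M]
  {F : Type*} [NormedAddCommGroup F] [NormedSpace ℝ F]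
  {L : Type*} [TopologicalSpace L] [ChartedSpace F L] [IsManifold 𝓘(ℝ, F) ∞ L]
  {i : L → M} {ξ : ∀ x : L, TangentSpace 𝓘(ℝ, F) x}

/-- The map `i` in the preferred charts at `x₀` and `p`. -/
noncomputable def coordMap (i : L → M) (x₀ : L) (p : M) : F → E :=
  extChartAt 𝓘(ℝ, E) p ∘ i ∘ (extChartAt 𝓘(ℝ, F) x₀).symm

/-- The components of the vector field `ξ` along `i`, with respect to the preferred chart at `p`. -/
noncomputable def coordPush (i : L → M) (ξ : ∀ x : L, TangentSpace 𝓘(ℝ, F) x) (x₀ : L) (p : M)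
    (z : F) : E :=
  fderiv ℝ (coordMap (E := E) i x₀ p) z (coordField ξ x₀ z)

theorem coordMap_extChartAt {x₀ y : L} {p : M} (hy : y ∈ (chartAt F x₀).source) :
    coordMap (E := E) i x₀ p (extChartAt 𝓘(ℝ, F) x₀ y) = extChartAt 𝓘(ℝ, E) p (i y) := by
  simp only [coordMap, Function.comp_apply,
    (extChartAt 𝓘(ℝ, F) x₀).left_inv (by rwa [extChartAt_source])]

theorem contDiffAt_coordMap (hi : ContMDiff 𝓘(ℝ, F) 𝓘(ℝ, E) ∞ i) {x₀ y : L} {p : M}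
    (hy : y ∈ (chartAt F x₀).source) (hp : i y ∈ (chartAt E p).source) :
    ContDiffAt ℝ ∞ (coordMap (E := E) i x₀ p) (extChartAt 𝓘(ℝ, F) x₀ y) := by
  have hy' : y ∈ (extChartAt 𝓘(ℝ, F) x₀).source := by rwa [extChartAt_source]
  have h1 : ContMDiffAt 𝓘(ℝ, F) 𝓘(ℝ, F) ∞ (extChartAt 𝓘(ℝ, F) x₀).symm
      (extChartAt 𝓘(ℝ, F) x₀ y) :=
    (contMDiffOn_extChartAt_symm (n := ∞) x₀ _
      ((extChartAt 𝓘(ℝ, F) x₀).map_source hy')).contMDiffAt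
      ((isOpen_extChartAt_target x₀).mem_nhds ((extChartAt 𝓘(ℝ, F) x₀).map_source hy'))
  have h2 : i ((extChartAt 𝓘(ℝ, F) x₀).symm (extChartAt 𝓘(ℝ, F) x₀ y)) ∈ (chartAt E p).source := by
    rwa [(extChartAt 𝓘(ℝ, F) x₀).left_inv hy']
  have h3 : ContMDiffAt 𝓘(ℝ, F) 𝓘(ℝ, E) ∞ (i ∘ (extChartAt 𝓘(ℝ, F) x₀).symm)
      (extChartAt 𝓘(ℝ, F) x₀ y) := hi.contMDiffAt.comp _ h1
  have h4 : ContMDiffAt 𝓘(ℝ, F) 𝓘(ℝ, E) ∞ (coordMap (E := E) i x₀ p)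
      (extChartAt 𝓘(ℝ, F) x₀ y) :=
    ContMDiffAt.comp (I' := 𝓘(ℝ, E)) _ (contMDiffAt_extChartAt' (n := ∞) h2) h3
  exact h4.contDiffAt

theorem mfderiv_eq_fderiv_coordMap (hi : ContMDiff 𝓘(ℝ, F) 𝓘(ℝ, E) ∞ i) {x₀ y : L} {p : M}
    (hy : y ∈ (chartAt F x₀).source) (hp : i y ∈ (chartAt E p).source)
    (v : TangentSpace 𝓘(ℝ, F) y) :
    tangentCoordChange 𝓘(ℝ, E) (i y) p (i y) (mfderiv 𝓘(ℝ, F) 𝓘(ℝ, E) i y v)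
      = fderiv ℝ (coordMap (E := E) i x₀ p) (extChartAt 𝓘(ℝ, F) x₀ y)
          (tangentCoordChange 𝓘(ℝ, F) y x₀ y v) := by
  rw [← mfderiv_extChartAt_comp (hi.mdifferentiableAt (by simp)) hp]
  have h1 : extChartAt 𝓘(ℝ, E) p ∘ i
      =ᶠ[𝓝 y] coordMap (E := E) i x₀ p ∘ extChartAt 𝓘(ℝ, F) x₀ := by
    filter_upwards [(chartAt F x₀).open_source.mem_nhds hy] with z hz
    exact (coordMap_extChartAt hz).symm
  have h2 : MDifferentiableAt 𝓘(ℝ, F) 𝓘(ℝ, E) (coordMap (E := E) i x₀ p)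
      (extChartAt 𝓘(ℝ, F) x₀ y) :=
    ((contDiffAt_coordMap hi hy hp).differentiableAt (by simp)).mdifferentiableAt
  have h3 : (mfderiv 𝓘(ℝ, F) 𝓘(ℝ, F) (extChartAt 𝓘(ℝ, F) x₀ ∘ id) y v : F)
      = tangentCoordChange 𝓘(ℝ, F) y x₀ y v := by
    rw [mfderiv_extChartAt_comp (f := id) mdifferentiableAt_id hy, mfderiv_id]
    rfl
  rw [h1.mfderiv_eq, mfderiv_comp (I' := 𝓘(ℝ, F)) y h2 (mdifferentiableAt_extChartAt hy), ← h3,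
    mfderiv_eq_fderiv]
  rfl

theorem tangentCoordChange_pushSection (hi : ContMDiff 𝓘(ℝ, F) 𝓘(ℝ, E) ∞ i) {x₀ y : L} {p : M}
    (hy : y ∈ (chartAt F x₀).source) (hp : i y ∈ (chartAt E p).source) :
    tangentCoordChange 𝓘(ℝ, E) (i y) p (i y) (pushSection E i ξ y)
      = coordPush i ξ x₀ p (extChartAt 𝓘(ℝ, F) x₀ y) := by
  rw [coordPush, coordField_extChartAt hy]
  exact mfderiv_eq_fderiv_coordMap hi hy hp (ξ y)

variable [FiniteDimensional ℝ F]

theorem contDiffAt_coordField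
    (hξ : ContMDiff 𝓘(ℝ, F) 𝓘(ℝ, F).tangent ∞
      (fun x : L ↦ (⟨x, ξ x⟩ : TangentBundle 𝓘(ℝ, F) L))) {x₀ y : L}
    (hy : y ∈ (chartAt F x₀).source) :
    ContDiffAt ℝ ∞ (coordField ξ x₀) (extChartAt 𝓘(ℝ, F) x₀ y) :=
  (contDiffOn_coordField hξ x₀).contDiffAt ((isOpen_extChartAt_target x₀).mem_nhds
    ((extChartAt 𝓘(ℝ, F) x₀).map_source (by rwa [extChartAt_source])))

theorem contDiffAt_coordPush (hi : ContMDiff 𝓘(ℝ, F) 𝓘(ℝ, E) ∞ i)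
    (hξ : ContMDiff 𝓘(ℝ, F) 𝓘(ℝ, F).tangent ∞
      (fun x : L ↦ (⟨x, ξ x⟩ : TangentBundle 𝓘(ℝ, F) L))) {x₀ y : L} {p : M}
    (hy : y ∈ (chartAt F x₀).source) (hp : i y ∈ (chartAt E p).source) :
    ContDiffAt ℝ ∞ (coordPush (E := E) i ξ x₀ p) (extChartAt 𝓘(ℝ, F) x₀ y) :=
  ((contDiffAt_coordMap hi hy hp).fderiv_right (m := ∞) (by simp)).clm_apply
    (contDiffAt_coordField hξ hy)

/-- `γ` is differentiable with derivative `ξ` on a neighbourhood of `t`. -/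
theorem deriv_coord_integralCurve (hi : ContMDiff 𝓘(ℝ, F) 𝓘(ℝ, E) ∞ i) {x₀ : L} {p : M}
    {γ : ℝ → L} {t : ℝ}
    (hγ : HasMFDerivAt 𝓘(ℝ, ℝ) 𝓘(ℝ, F) γ t ((1 : ℝ →L[ℝ] ℝ).smulRight (ξ (γ t))))
    (hy : γ t ∈ (chartAt F x₀).source) (hp : i (γ t) ∈ (chartAt E p).source) :
    HasDerivAt (extChartAt 𝓘(ℝ, E) p ∘ i ∘ γ)
      (coordPush (E := E) i ξ x₀ p (extChartAt 𝓘(ℝ, F) x₀ (γ t))) t := by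
  have h1 : extChartAt 𝓘(ℝ, E) p ∘ i ∘ γ
      =ᶠ[𝓝 t] coordMap (E := E) i x₀ p ∘ extChartAt 𝓘(ℝ, F) x₀ ∘ γ := by
    filter_upwards [eventually_mem_chart_source hγ.continuousAt hy] with z hz
    exact (coordMap_extChartAt hz).symm
  refine HasDerivAt.congr_of_eventuallyEq ?_ h1
  exact ((contDiffAt_coordMap hi hy hp).differentiableAt (by simp)).hasFDerivAt.comp_hasDerivAt t
    (hγ.hasDerivAt_extChartAt_comp hy)

theorem deriv_deriv_coord_integralCurve (hi : ContMDiff 𝓘(ℝ, F) 𝓘(ℝ, E) ∞ i)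
    (hξ : ContMDiff 𝓘(ℝ, F) 𝓘(ℝ, F).tangent ∞
      (fun x : L ↦ (⟨x, ξ x⟩ : TangentBundle 𝓘(ℝ, F) L))) {x₀ : L} {p : M}
    {γ : ℝ → L} {t : ℝ} (hγ : IsMIntegralCurveAt γ ξ t)
    (hy : γ t ∈ (chartAt F x₀).source) (hp : i (γ t) ∈ (chartAt E p).source) :
    HasDerivAt (deriv (extChartAt 𝓘(ℝ, E) p ∘ i ∘ γ))
      (fderiv ℝ (coordPush (E := E) i ξ x₀ p) (extChartAt 𝓘(ℝ, F) x₀ (γ t))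
        (coordField ξ x₀ (extChartAt 𝓘(ℝ, F) x₀ (γ t)))) t := by
  have hγt := hγ.self_of_nhds
  have h1 : deriv (extChartAt 𝓘(ℝ, E) p ∘ i ∘ γ)
      =ᶠ[𝓝 t] coordPush (E := E) i ξ x₀ p ∘ extChartAt 𝓘(ℝ, F) x₀ ∘ γ := by
    filter_upwards [hγ, eventually_mem_chart_source hγt.continuousAt hy,
      eventually_mem_chart_source (f := i ∘ γ)
        (hi.continuous.continuousAt.comp hγt.continuousAt) hp] with u h1 h2 h3
    exact (deriv_coord_integralCurve hi h1 h2 h3).deriv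
  refine HasDerivAt.congr_of_eventuallyEq ?_ h1
  exact ((contDiffAt_coordPush hi hξ hy hp).differentiableAt
    (by simp)).hasFDerivAt.comp_hasDerivAt t (hγt.hasDerivAt_extChartAt_comp hy)

/-- The vector field `ξ` along `i`, with values in the model space. -/
noncomputable def push (E : Type*) [NormedAddCommGroup E] [NormedSpace ℝ E]
    {M : Type*} [TopologicalSpace M] [ChartedSpace E M]
    {F : Type*} [NormedAddCommGroup F] [NormedSpace ℝ F]
    {L : Type*} [TopologicalSpace L] [ChartedSpace F L]
    (i : L → M) (ξ : ∀ x : L, TangentSpace 𝓘(ℝ, F) x) (x : L) : E :=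
  pushSection E i ξ x

theorem coordPush_self (hi : ContMDiff 𝓘(ℝ, F) 𝓘(ℝ, E) ∞ i) (x : L) :
    coordPush i ξ x (i x) (extChartAt 𝓘(ℝ, F) x x) = push E i ξ x :=
  (tangentCoordChange_pushSection hi (mem_chart_source F x) (mem_chart_source E (i x))).symm.trans
    (tangentCoordChange_self_apply (i x) _)

theorem push_smul (f : L → ℝ) (x : L) :
    push E i (fun y ↦ f y • ξ y) x = f x • push E i ξ x :=
  (mfderiv 𝓘(ℝ, F) 𝓘(ℝ, E) i x).map_smul (f x) (ξ x)

theorem velocity_comp_integralCurve (hi : ContMDiff 𝓘(ℝ, F) 𝓘(ℝ, E) ∞ i) {γ : ℝ → L} {t : ℝ}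
    (hγ : HasMFDerivAt 𝓘(ℝ, ℝ) 𝓘(ℝ, F) γ t ((1 : ℝ →L[ℝ] ℝ).smulRight (ξ (γ t)))) :
    velocity (E := E) (i ∘ γ) t = push E i ξ (γ t) := by
  have h1 := ((hi.mdifferentiableAt (by simp)).hasMFDerivAt (x := γ t)).comp t hγ
  have h2 : (curveVelocity (E := E) (i ∘ γ) t : E)
      = mfderiv 𝓘(ℝ, F) 𝓘(ℝ, E) i (γ t) ((1 : ℝ) • ξ (γ t)) := by
    rw [curveVelocity, h1.mfderiv]
    rfl
  rw [one_smul] at h2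
  exact h2

theorem hasDerivAt_comp_integralCurve {h : L → E} {γ : ℝ → L} {t : ℝ}
    (hh : MDifferentiableAt 𝓘(ℝ, F) 𝓘(ℝ, E) h (γ t))
    (hγ : HasMFDerivAt 𝓘(ℝ, ℝ) 𝓘(ℝ, F) γ t ((1 : ℝ →L[ℝ] ℝ).smulRight (ξ (γ t)))) :
    HasDerivAt (h ∘ γ) (mfderiv 𝓘(ℝ, F) 𝓘(ℝ, E) h (γ t) (ξ (γ t)) : E) t := by
  have hm := hh.hasMFDerivAt.comp t hγ
  have hd : DifferentiableAt ℝ (h ∘ γ) t := hm.mdifferentiableAt.differentiableAt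
  have h1 : deriv (h ∘ γ) t = (mfderiv 𝓘(ℝ, F) 𝓘(ℝ, E) h (γ t) ((1 : ℝ) • ξ (γ t)) : E) :=
    (deriv_eq_mfderiv_one _ t).trans (by rw [hm.mfderiv]; rfl)
  rw [one_smul] at h1
  rw [← h1]
  exact hd.hasDerivAt

theorem hasDerivAt_comp_integralCurve_real {h : L → ℝ} {γ : ℝ → L} {t : ℝ}
    (hh : MDifferentiableAt 𝓘(ℝ, F) 𝓘(ℝ, ℝ) h (γ t))
    (hγ : HasMFDerivAt 𝓘(ℝ, ℝ) 𝓘(ℝ, F) γ t ((1 : ℝ →L[ℝ] ℝ).smulRight (ξ (γ t)))) :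
    HasDerivAt (h ∘ γ) (directionalDeriv h (γ t) (ξ (γ t))) t :=
  hasDerivAt_comp_integralCurve hh hγ

namespace LorentzianMetric

variable (g : LorentzianMetric E M) [FiniteDimensional ℝ E]

/-- `∇_ξ ξ`, with values in the model space. -/
noncomputable def pushAccel (i : L → M) (ξ : ∀ x : L, TangentSpace 𝓘(ℝ, F) x) (x : L) : E :=
  g.sectionAccel i ξ x

theorem exists_integralCurve (hξ : ContMDiff 𝓘(ℝ, F) 𝓘(ℝ, F).tangent ∞
      (fun x : L ↦ (⟨x, ξ x⟩ : TangentBundle 𝓘(ℝ, F) L))) (x : L) :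
    ∃ γ : ℝ → L, γ 0 = x ∧ IsMIntegralCurveAt γ ξ 0 :=
  exists_isMIntegralCurveAt_of_contMDiffAt_boundaryless (I := 𝓘(ℝ, F)) 0
    ((hξ.contMDiffAt (x := x)).of_le (m := 1) (n := ∞) (by simp))

/-- The directional derivative along `ξ` is evaluated on an integral curve through `x`, which
reduces the Leibniz rule to the product rule for functions of one real variable. -/
theorem pushAccel_smul_eq (hi : ContMDiff 𝓘(ℝ, F) 𝓘(ℝ, E) ∞ i)
    (hξ : ContMDiff 𝓘(ℝ, F) 𝓘(ℝ, F).tangent ∞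
      (fun x : L ↦ (⟨x, ξ x⟩ : TangentBundle 𝓘(ℝ, F) L))) {f : L → ℝ} {x : L}
    (hf : MDifferentiableAt 𝓘(ℝ, F) 𝓘(ℝ, ℝ) f x) :
    g.pushAccel i (fun y ↦ f y • ξ y) x
      = (f x * directionalDeriv f x (ξ x)) • push E i ξ x
        + (f x) ^ 2 • (fderiv ℝ (coordPush (E := E) i ξ x (i x)) (extChartAt 𝓘(ℝ, F) x x)
            (coordField ξ x (extChartAt 𝓘(ℝ, F) x x))
          + g.christoffel (i x) (push E i ξ x) (push E i ξ x)) := by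
  set V := coordPush (E := E) i ξ x (i x) with hV
  have hxs := mem_chart_source F x
  have hps := mem_chart_source E (i x)
  obtain ⟨γ, hγ0, hγ⟩ := exists_integralCurve hξ x
  have hγt := hγ.self_of_nhds
  rw [hγ0] at hγt
  have hVd : MDifferentiableAt 𝓘(ℝ, F) 𝓘(ℝ, E) (V ∘ extChartAt 𝓘(ℝ, F) x) x :=
    MDifferentiableAt.comp (I' := 𝓘(ℝ, F)) x
      ((contDiffAt_coordPush hi hξ hxs hps).differentiableAt (by simp)).mdifferentiableAt
      (mdifferentiableAt_extChartAt hxs)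
  have hγs : HasMFDerivAt 𝓘(ℝ, ℝ) 𝓘(ℝ, F) γ 0 ((1 : ℝ →L[ℝ] ℝ).smulRight (ξ (γ 0))) :=
    hγ.self_of_nhds
  set W : L → E := fun y ↦ f y • V (extChartAt 𝓘(ℝ, F) x y) with hW
  have hWd : MDifferentiableAt 𝓘(ℝ, F) 𝓘(ℝ, E) W x := hf.smul hVd
  obtain ⟨D, hD⟩ : ∃ D : E, D = mfderiv 𝓘(ℝ, F) 𝓘(ℝ, E) W x (ξ x) := ⟨_, rfl⟩
  have hd1 : HasDerivAt (W ∘ γ) D 0 := by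
    have := hasDerivAt_comp_integralCurve (h := W) (hγ0 ▸ hWd) hγs
    rw [hγ0] at this
    rw [hD]
    exact this
  have hd2 : HasDerivAt (f ∘ γ) (directionalDeriv f x (ξ x)) 0 := by
    have := hasDerivAt_comp_integralCurve_real (h := f) (hγ0 ▸ hf) hγs
    rwa [hγ0] at this
  have hd3 : HasDerivAt (V ∘ extChartAt 𝓘(ℝ, F) x ∘ γ) (fderiv ℝ V (extChartAt 𝓘(ℝ, F) x x)
      (coordField ξ x (extChartAt 𝓘(ℝ, F) x x))) 0 := by
    have h1 := hγs.hasDerivAt_extChartAt_comp (x₀ := x) (hγ0 ▸ hxs)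
    rw [hγ0] at h1
    refine HasFDerivAt.comp_hasDerivAt 0 ?_ h1
    rw [Function.comp_apply, hγ0]
    exact ((contDiffAt_coordPush hi hξ hxs hps).differentiableAt (by simp)).hasFDerivAt
  have hd4 := hd1.unique (hd2.smul hd3)
  simp only [Function.comp_apply, hγ0] at hd4
  have hcov := g.covDerivAlong_eq (f := i) (V := pushSection E i (fun y ↦ f y • ξ y)) (x := x)
    (W := W) hi.continuous.continuousAt ?_ (f x • ξ x)
    (a := f x • D) ?_
  · have h5 : g.pushAccel i (fun y ↦ f y • ξ y) x
        = f x • D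
          + g.christoffel (i x) (push E i (fun y ↦ f y • ξ y) x)
            (push E i (fun y ↦ f y • ξ y) x) := hcov
    rw [h5, hd4, push_smul, christoffel_smul_smul, hV, coordPush_self hi, smul_add, smul_add,
      smul_smul, smul_smul, pow_two]
    abel
  · filter_upwards [(chartAt F x).open_source.mem_nhds hxs,
      eventually_mem_chart_source hi.continuous.continuousAt hps] with y hy hy'
    have h6 : tangentCoordChange 𝓘(ℝ, E) (i y) (i x) (i y) (push E i (fun y ↦ f y • ξ y) y) = W y := by
      rw [push_smul, map_smul, hW]
      exact congrArg (fun z : E ↦ f y • z) (tangentCoordChange_pushSection hi hy hy')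
    exact h6
  · rw [hD]
    exact (mfderiv 𝓘(ℝ, F) 𝓘(ℝ, E) W x).map_smul (f x) (ξ x)

theorem pushAccel_eq (hi : ContMDiff 𝓘(ℝ, F) 𝓘(ℝ, E) ∞ i)
    (hξ : ContMDiff 𝓘(ℝ, F) 𝓘(ℝ, F).tangent ∞
      (fun x : L ↦ (⟨x, ξ x⟩ : TangentBundle 𝓘(ℝ, F) L))) (x : L) :
    g.pushAccel i ξ x = fderiv ℝ (coordPush (E := E) i ξ x (i x)) (extChartAt 𝓘(ℝ, F) x x)
            (coordField ξ x (extChartAt 𝓘(ℝ, F) x x))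
          + g.christoffel (i x) (push E i ξ x) (push E i ξ x) := by
  have h := g.pushAccel_smul_eq hi hξ (f := fun _ ↦ 1) (x := x) mdifferentiableAt_const
  have h1 : directionalDeriv (fun _ : L ↦ (1 : ℝ)) x (ξ x) = 0 := by
    rw [directionalDeriv, mfderiv_const]
    rfl
  simp only [one_smul, h1, mul_zero, zero_smul, one_pow, zero_add] at h
  exact h

/-- The Leibniz rule for `∇_{fξ} (fξ)`. -/
theorem pushAccel_smul (hi : ContMDiff 𝓘(ℝ, F) 𝓘(ℝ, E) ∞ i)
    (hξ : ContMDiff 𝓘(ℝ, F) 𝓘(ℝ, F).tangent ∞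
      (fun x : L ↦ (⟨x, ξ x⟩ : TangentBundle 𝓘(ℝ, F) L))) {f : L → ℝ} {x : L}
    (hf : MDifferentiableAt 𝓘(ℝ, F) 𝓘(ℝ, ℝ) f x) :
    g.pushAccel i (fun y ↦ f y • ξ y) x
      = (f x * directionalDeriv f x (ξ x)) • push E i ξ x + (f x) ^ 2 • g.pushAccel i ξ x := by
  rw [g.pushAccel_smul_eq hi hξ hf, g.pushAccel_eq hi hξ]

/-- In coordinates both sides differentiate the components of `ξ` in the direction `ξ`. This links
the geodesic equation to the surface gravity. -/
theorem acceleration_comp_integralCurve (hi : ContMDiff 𝓘(ℝ, F) 𝓘(ℝ, E) ∞ i)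
    (hξ : ContMDiff 𝓘(ℝ, F) 𝓘(ℝ, F).tangent ∞
      (fun x : L ↦ (⟨x, ξ x⟩ : TangentBundle 𝓘(ℝ, F) L))) {γ : ℝ → L} {t : ℝ}
    (hγ : IsMIntegralCurveAt γ ξ t) (hs : ContMDiffAt 𝓘(ℝ, ℝ) 𝓘(ℝ, F) ∞ γ t) :
    g.acceleration (i ∘ γ) t = g.pushAccel i ξ (γ t) := by
  rw [g.acceleration_eq (hi.contMDiffAt.comp t hs), velocity_comp_integralCurve hi hγ.self_of_nhds,
    g.pushAccel_eq hi hξ]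
  congr 1
  exact (deriv_deriv_coord_integralCurve hi hξ hγ (mem_chart_source F (γ t))
    (mem_chart_source E (i (γ t)))).deriv

/-- The field `∇_ξ ξ` is the acceleration of integral curves, for which the Euler-Lagrange formula
holds in every chart. Fixed charts at `x₀` and `p` are needed to let `x` vary. -/
theorem form_pushAccel (hi : ContMDiff 𝓘(ℝ, F) 𝓘(ℝ, E) ∞ i)
    (hξ : ContMDiff 𝓘(ℝ, F) 𝓘(ℝ, F).tangent ∞
      (fun x : L ↦ (⟨x, ξ x⟩ : TangentBundle 𝓘(ℝ, F) L))) {x₀ x : L} {p : M}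
    (hx : x ∈ (chartAt F x₀).source) (hp : i x ∈ (chartAt E p).source) (w : E) :
    g.form (i x) (g.pushAccel i ξ x) (tangentCoordChange 𝓘(ℝ, E) p (i x) (i x) w)
      = eulerLagrange (g.metricCoord p) (coordMap i x₀ p (extChartAt 𝓘(ℝ, F) x₀ x))
          (coordPush i ξ x₀ p (extChartAt 𝓘(ℝ, F) x₀ x))
          (fderiv ℝ (coordPush i ξ x₀ p) (extChartAt 𝓘(ℝ, F) x₀ x)
            (coordField ξ x₀ (extChartAt 𝓘(ℝ, F) x₀ x))) w := by
  obtain ⟨γ, rfl, hγ⟩ := exists_integralCurve hξ x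
  obtain ⟨o, ho, hoo, h0⟩ := eventually_nhds_iff.1 hγ
  have hs : ContMDiffAt 𝓘(ℝ, ℝ) 𝓘(ℝ, F) ∞ γ 0 :=
    (contMDiffOn_integralCurve hξ hoo ho).contMDiffAt (hoo.mem_nhds h0)
  have h1 := g.form_covDerivAlong (hi.contMDiffAt.comp 0 hs) hp w
  rw [(deriv_deriv_coord_integralCurve hi hξ hγ hx hp).deriv,
    (deriv_coord_integralCurve hi hγ.self_of_nhds hx hp).deriv] at h1
  rw [← g.acceleration_comp_integralCurve hi hξ hγ hs, coordMap_extChartAt hx]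
  exact h1

end LorentzianMetric

end NullHypersurfaceGeometry

/-- If `v` is a null vector field of the degenerate metric `φ^* G`, then the Euler-Lagrange
expression of its integral curves vanishes in the directions tangent to the image of `φ`. -/
theorem eulerLagrange_eq_zero_of_null {E F : Type*} [NormedAddCommGroup E] [NormedSpace ℝ E]
    [NormedAddCommGroup F] [NormedSpace ℝ F] [FiniteDimensional ℝ F]
    {G : E → E →L[ℝ] E →L[ℝ] ℝ} {φ : F → E} {v : F → F} {z₀ : F}
    (hG : ContDiffAt ℝ ∞ G (φ z₀)) (hφ : ContDiffAt ℝ ∞ φ z₀) (hv : DifferentiableAt ℝ v z₀)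
    (hGsymm : ∀ z a b, G z a b = G z b a)
    (hnull : ∀ᶠ z in 𝓝 z₀, ∀ b, G (φ z) (fderiv ℝ φ z (v z)) (fderiv ℝ φ z b) = 0) (w : F) :
    eulerLagrange G (φ z₀) (fderiv ℝ φ z₀ (v z₀))
      (fderiv ℝ (fun z ↦ fderiv ℝ φ z (v z)) z₀ (v z₀)) (fderiv ℝ φ z₀ w) = 0 := by
  have hφ2 : ContDiffAt ℝ 2 φ z₀ := hφ.of_le (WithTop.coe_le_coe.2 le_top)
  let G' : F → F →L[ℝ] F →L[ℝ] ℝ := fun z ↦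
    (G (φ z)).bilinearComp (fderiv ℝ φ z) (fderiv ℝ φ z)
  have hG'apply : ∀ z a b, G' z a b = G (φ z) (fderiv ℝ φ z a) (fderiv ℝ φ z b) :=
    fun z a b ↦ rfl
  have hG' : DifferentiableAt ℝ G' z₀ := by
    have hG2 : ContDiffAt ℝ 2 (G ∘ φ) z₀ := hG.comp z₀ hφ |>.of_le
      (WithTop.coe_le_coe.2 le_top)
    obtain ⟨o, ho, hoo, hzo⟩ := eventually_nhds_iff.1
      ((hφ2.eventually (by simp)).and (hG2.eventually (by simp)))
    have h1 : ContDiffOn ℝ 1 G' o := by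
      refine contDiffOn_clm_apply.2 fun a ↦ contDiffOn_clm_apply.2 fun b z hz ↦ ?_
      have h2 : ContDiffAt ℝ 1 (fderiv ℝ φ) z := (ho z hz).1.fderiv_right (by norm_num)
      have h3 : ContDiffAt ℝ 1 (G ∘ φ) z := (ho z hz).2.of_le (by norm_num)
      exact ((h3.clm_apply (h2.clm_apply contDiffAt_const)).clm_apply
        (h2.clm_apply contDiffAt_const)).contDiffWithinAt
    exact (h1.contDiffAt (hoo.mem_nhds hzo)).differentiableAt (by simp)
  have hnullG : ∀ᶠ z in 𝓝 z₀, ∀ b, G' z (v z) b = 0 := hnull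
  -- The identity `G'(v, b) = 0` is differentiated in the direction `u`.
  have hderiv : ∀ u b, fderiv ℝ G' z₀ u (v z₀) b + G' z₀ (fderiv ℝ v z₀ u) b = 0 := by
    intro u b
    have h1 : HasFDerivAt (fun z ↦ G' z (v z)) _ z₀ := hG'.hasFDerivAt.clm_apply hv.hasFDerivAt
    have h2 : HasFDerivAt (fun z ↦ G' z (v z) b) _ z₀ := h1.clm_apply (hasFDerivAt_const b z₀)
    have h3 : (fun z ↦ G' z (v z) b) =ᶠ[𝓝 z₀] fun _ ↦ 0 := hnullG.mono fun z hz ↦ hz b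
    have h4 := h2.unique ((hasFDerivAt_const (0 : ℝ) z₀).congr_of_eventuallyEq h3)
    have h5 := DFunLike.congr_fun h4 u
    simp at h5
    linarith
  have hsymm : ∀ a b, G' z₀ a b = G' z₀ b a := fun a b ↦ hGsymm _ _ _
  have hEL : eulerLagrange G' z₀ (v z₀) (fderiv ℝ v z₀ (v z₀)) w = 0 := by
    -- The direction `v` cancels the first two terms of the Euler-Lagrange expression. The direction
    -- `w` with `b = v` kills the last one, since `v` is orthogonal to everything.
    have h1 := hderiv (v z₀) w
    have h2 := hderiv w (v z₀)
    rw [hsymm, hnullG.self_of_nhds] at h2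
    rw [eulerLagrange]
    linarith
  rw [eulerLagrange_comp (G := G) (φ := φ) (hG.differentiableAt (by simp)) hφ2
    (fun a b ↦ hGsymm _ a b) (Filter.Eventually.of_forall hG'apply) hG'] at hEL
  have hV : fderiv ℝ (fun z ↦ fderiv ℝ φ z (v z)) z₀ (v z₀) = fderiv ℝ φ z₀ (fderiv ℝ v z₀ (v z₀))
      + fderiv ℝ (fderiv ℝ φ) z₀ (v z₀) (v z₀) := by
    have h1 : HasFDerivAt (fun z ↦ fderiv ℝ φ z (v z)) _ z₀ :=
      ((hφ2.fderiv_right (m := 1) (by norm_num)).differentiableAt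
        (by simp)).hasFDerivAt.clm_apply hv.hasFDerivAt
    have h2 : fderiv ℝ (fun z ↦ fderiv ℝ φ z (v z)) z₀ = _ := h1.fderiv
    rw [h2]
    simp
  rwa [← hV] at hEL

/-! ### Existence of the surface gravity. -/

section SurfaceGravity

set_option synthInstance.maxHeartbeats 400000

variable {E : Type*} [NormedAddCommGroup E] [NormedSpace ℝ E]
  {M : Type*} [TopologicalSpace M] [ChartedSpace E M] [IsManifold 𝓘(ℝ, E) ∞ M]
  {F : Type*} [NormedAddCommGroup F] [NormedSpace ℝ F] [FiniteDimensional ℝ F]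
  {L : Type*} [TopologicalSpace L] [ChartedSpace F L] [IsManifold 𝓘(ℝ, F) ∞ L]
  {i : L → M} {ξ : ∀ x : L, TangentSpace 𝓘(ℝ, F) x}

/-- The differential of `i`, as a map between the model spaces. -/
noncomputable def tangentMapModel (E : Type*) [NormedAddCommGroup E] [NormedSpace ℝ E]
    {M : Type*} [TopologicalSpace M] [ChartedSpace E M]
    (F : Type*) [NormedAddCommGroup F] [NormedSpace ℝ F]
    {L : Type*} [TopologicalSpace L] [ChartedSpace F L] (i : L → M) (x : L) : F →L[ℝ] E :=
  mfderiv 𝓘(ℝ, F) 𝓘(ℝ, E) i x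

namespace LorentzianMetric

variable (g : LorentzianMetric E M)

theorem form_symm (p : M) (u v : E) : g.form p u v = g.form p v u := g.symm p u v

variable {g} in
/-- Two orthogonal null vectors are proportional. -/
theorem exists_eq_smul_of_null {p : M} {a b : E} (ha : g.form p a a = 0) (hb : g.form p b b = 0)
    (hab : g.form p a b = 0) (ha0 : a ≠ 0) : ∃ c : ℝ, b = c • a := by
  obtain ⟨T, -, hpos⟩ : ∃ T : E, g.form p T T < 0 ∧
    ∀ w : E, g.form p T w = 0 → w ≠ 0 → 0 < g.form p w w := g.lorentzian p
  have hTa : g.form p T a ≠ 0 := fun h ↦ (hpos a h ha0).ne' ha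
  have hba : g.form p b a = 0 := (g.form_symm p b a).trans hab
  -- This combination is null and orthogonal to the timelike vector `T`; positivity on the
  -- orthogonal complement of `T` forces it to vanish.
  set c : E := g.form p T b • a - g.form p T a • b with hc
  have h1 : g.form p T c = 0 := by simp [hc, mul_comm]
  have h2 : g.form p c c = 0 := by simp [hc, ha, hb, hab, hba]
  have h3 : c = 0 := by
    by_contra h
    exact (hpos c h1 h).ne' h2
  refine ⟨(g.form p T a)⁻¹ * g.form p T b, ?_⟩
  rw [mul_smul, sub_eq_zero.1 (hc.symm.trans h3), smul_smul, inv_mul_cancel₀ hTa, one_smul]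

end LorentzianMetric

namespace IsNullHypersurface

variable {g : LorentzianMetric E M}

theorem contMDiff (hi : IsNullHypersurface F g i) : ContMDiff 𝓘(ℝ, F) 𝓘(ℝ, E) ∞ i := hi.isSmoothEmbedding.contMDiff

theorem tangentMapModel_injective (hi : IsNullHypersurface F g i) (x : L) : Function.Injective (tangentMapModel E F i x) :=
  (hi.isSmoothEmbedding.isImmersion.isImmersionAt x).mfderiv_injective

theorem push_ne_zero (hi : IsNullHypersurface F g i) {x : L} (h : ξ x ≠ 0) : push E i ξ x ≠ 0 := fun h0 ↦
  h (hi.tangentMapModel_injective x (h0.trans (map_zero (tangentMapModel E F i x)).symm))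

/-- The degenerate direction `v` given by the hypothesis is null and orthogonal to `ξ`. Orthogonal
null vectors are proportional, so `ξ` inherits from `v` the orthogonality to the whole tangent space
of `L`. -/
theorem form_push_eq_zero (hi : IsNullHypersurface F g i) {x : L} (h : g.form (i x) (push E i ξ x) (push E i ξ x) = 0) (w : F) :
    g.form (i x) (push E i ξ x) (tangentMapModel E F i x w) = 0 := by
  obtain ⟨v, hv0, hv⟩ : ∃ v : F, v ≠ 0 ∧ ∀ w : F,
    g.form (i x) (tangentMapModel E F i x v) (tangentMapModel E F i x w) = 0 := hi.degenerate x
  have ha : tangentMapModel E F i x v ≠ 0 := fun h0 ↦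
    hv0 (hi.tangentMapModel_injective x (h0.trans (map_zero (tangentMapModel E F i x)).symm))
  obtain ⟨c, hc⟩ := LorentzianMetric.exists_eq_smul_of_null (hv v) h (hv (ξ x)) ha
  rw [hc, map_smul, smul_apply, hv w, smul_zero]

/-- The image of the tangent space of `L` is a hyperplane, so by nondegeneracy its orthogonal
complement is a line. It contains the nonzero vector `ξ`, hence is spanned by it. -/
theorem exists_eq_smul_push [FiniteDimensional ℝ E] (hi : IsNullHypersurface F g i) {x : L} (h0 : ξ x ≠ 0)
    (h : g.form (i x) (push E i ξ x) (push E i ξ x) = 0) {u : E}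
    (hu : ∀ w : F, g.form (i x) u (tangentMapModel E F i x w) = 0) :
    ∃ c : ℝ, u = c • push E i ξ x := by
  set W : Submodule ℝ E := (tangentMapModel E F i x : F →ₗ[ℝ] E).range with hW
  set B := g.bilinForm (i x) with hB
  have hfr : Module.finrank ℝ (B.orthogonal W) = 1 := by
    rw [LinearMap.BilinForm.finrank_orthogonal (g.nondegenerate_bilinForm (i x)), hW,
      LinearMap.finrank_range_of_inj (hi.tangentMapModel_injective x), ← hi.codim_one]
    omega
  have hmem : ∀ u : E, (∀ w : F, g.form (i x) u (tangentMapModel E F i x w) = 0) →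
      u ∈ B.orthogonal W := by
    rintro u hu _ ⟨w, rfl⟩
    exact (g.form_symm (i x) _ _).trans (hu w)
  have h1 := (finrank_eq_one_iff_of_nonzero'
    (⟨push E i ξ x, hmem _ (hi.form_push_eq_zero h)⟩ : B.orthogonal W)
    (fun h2 ↦ hi.push_ne_zero h0 (congrArg Subtype.val h2))).1 hfr ⟨u, hmem u hu⟩
  obtain ⟨c, hc⟩ := h1
  exact ⟨c, (congrArg Subtype.val hc).symm⟩

/-- Near the point, `ξ` lies in the kernel of the pulled-back metric. Its integral curves therefore
satisfy the Euler-Lagrange equation in tangential directions, and that expression computes `g(∇_ξ ξ,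
·)`. -/
theorem form_pushAccel_eq_zero [FiniteDimensional ℝ E] (hi : IsNullHypersurface F g i)
    (hξ : ContMDiff 𝓘(ℝ, F) 𝓘(ℝ, F).tangent ∞
      (fun x : L ↦ (⟨x, ξ x⟩ : TangentBundle 𝓘(ℝ, F) L)))
    (hnull : ∀ x, g.form (i x) (push E i ξ x) (push E i ξ x) = 0) (x : L) (w : F) :
    g.form (i x) (g.pushAccel i ξ x) (tangentMapModel E F i x w) = 0 := by
  have hxs := mem_chart_source F x
  have hps := mem_chart_source E (i x)
  set p := i x with hp
  set φ : F → E := coordMap i x p with hφdef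
  set v : F → F := coordField ξ x with hv
  set z₀ := extChartAt 𝓘(ℝ, F) x x with hz₀
  have hφz : φ z₀ = extChartAt 𝓘(ℝ, E) p p := coordMap_extChartAt hxs
  have hφ : ContDiffAt ℝ ∞ φ z₀ := contDiffAt_coordMap hi.contMDiff hxs hps
  have hvs : DifferentiableAt ℝ v z₀ := (contDiffAt_coordField hξ hxs).differentiableAt (by simp)
  have hG : ContDiffAt ℝ ∞ (g.metricCoord p) (φ z₀) := hφz ▸ g.contDiffAt_metricCoord hps
  have hnull' : ∀ᶠ z in 𝓝 z₀, ∀ b, g.metricCoord p (φ z)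
      (fderiv ℝ φ z (v z)) (fderiv ℝ φ z b) = 0 := by
    filter_upwards [extChartAt_target_mem_nhds (I := 𝓘(ℝ, F)) x,
      (continuousAt_extChartAt_symm (I := 𝓘(ℝ, F)) x).eventually
        (eventually_mem_chart_source (f := i) (p := p) hi.contMDiff.continuous.continuousAt
          (by rwa [extChartAt_to_inv]))] with z hz hz' b
    set y := (extChartAt 𝓘(ℝ, F) x).symm z with hy
    have hys : y ∈ (chartAt F x).source := by
      rw [← extChartAt_source 𝓘(ℝ, F)]
      exact (extChartAt 𝓘(ℝ, F) x).map_target hz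
    have hyz : extChartAt 𝓘(ℝ, F) x y = z := (extChartAt 𝓘(ℝ, F) x).right_inv hz
    have h1 : fderiv ℝ φ z (v z)
        = tangentCoordChange 𝓘(ℝ, E) (i y) p (i y) (push E i ξ y) := by
      rw [← hyz]
      exact (tangentCoordChange_pushSection hi.contMDiff hys hz').symm
    have h2 : fderiv ℝ φ z b = tangentCoordChange 𝓘(ℝ, E) (i y) p (i y)
        (tangentMapModel E F i y (tangentCoordChange 𝓘(ℝ, F) x y y b)) := by
      have h3 := mfderiv_eq_fderiv_coordMap hi.contMDiff hys hz'
        (tangentCoordChange 𝓘(ℝ, F) x y y b)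
      rw [hyz, tangentCoordChange_comp_cancel hys] at h3
      exact h3.symm
    have h4 : φ z = extChartAt 𝓘(ℝ, E) p (i y) := by
      rw [← hyz]
      exact coordMap_extChartAt hys
    rw [h1, h2, h4, g.metricCoord_apply hz', tangentCoordChange_comp_cancel' hz',
      tangentCoordChange_comp_cancel' hz']
    exact hi.form_push_eq_zero (hnull y) _
  have hEL := eulerLagrange_eq_zero_of_null hG hφ hvs (fun z a b ↦ g.metricCoord_symm p z a b)
    hnull' w
  have hw : tangentMapModel E F i x w = tangentCoordChange 𝓘(ℝ, E) p p p (fderiv ℝ φ z₀ w) := by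
    have h3 := mfderiv_eq_fderiv_coordMap hi.contMDiff hxs hps w
    rw [show tangentCoordChange 𝓘(ℝ, F) x x x w = w from tangentCoordChange_self_apply x w] at h3
    have h4 : tangentCoordChange 𝓘(ℝ, E) p p p (tangentMapModel E F i x w) = fderiv ℝ φ z₀ w := h3
    rw [← h4, tangentCoordChange_self_apply, tangentCoordChange_self_apply]
  rw [hw]
  exact (g.form_pushAccel hi.contMDiff hξ hxs hps (fderiv ℝ φ z₀ w)).trans hEL

end IsNullHypersurface

end SurfaceGravity

/-! ### Smoothness and transformation of the surface gravity. -/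

section SurfaceGravitySmooth

set_option synthInstance.maxHeartbeats 400000

theorem contDiffAt_eulerLagrange {E F : Type*} [NormedAddCommGroup E] [NormedSpace ℝ E]
    [NormedAddCommGroup F] [NormedSpace ℝ F] {G : E → E →L[ℝ] E →L[ℝ] ℝ} {y u a : F → E} {z₀ : F}
    (hG : ContDiffAt ℝ ∞ G (y z₀)) (hy : ContDiffAt ℝ ∞ y z₀) (hu : ContDiffAt ℝ ∞ u z₀)
    (ha : ContDiffAt ℝ ∞ a z₀) (w : E) :
    ContDiffAt ℝ ∞ (fun z ↦ eulerLagrange G (y z) (u z) (a z) w) z₀ := by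
  have hdG : ∀ᶠ z in 𝓝 z₀, DifferentiableAt ℝ G (y z) :=
    hy.continuousAt.eventually (((hG.of_le (m := 1) (by simp)).eventually (by simp)).mono
      fun z hz ↦ hz.differentiableAt (by simp))
  have hGq : ContDiffAt ℝ ∞ (fun p : F × E ↦ G p.2) (z₀, y z₀) :=
    ContDiffAt.comp (g := G) (z₀, y z₀) hG contDiffAt_snd
  have hu' : ContDiffAt ℝ ∞ (fun p : F × E ↦ u p.1) (z₀, y z₀) :=
    ContDiffAt.comp (g := u) (z₀, y z₀) hu contDiffAt_fst
  have h3 : ContDiffAt ℝ ∞ (fun z ↦ fderiv ℝ (fun p ↦ G p (u z) (u z)) (y z)) z₀ :=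
    ContDiffAt.fderiv (f := fun z p ↦ G p (u z) (u z)) (n := ∞)
      ((hGq.clm_apply hu').clm_apply hu') hy (by simp)
  have h4 : ContDiffAt ℝ ∞ (fun z ↦ fderiv ℝ (fun p ↦ G p (u z) w) (y z)) z₀ :=
    ContDiffAt.fderiv (f := fun z p ↦ G p (u z) w) (n := ∞)
      ((hGq.clm_apply hu').clm_apply contDiffAt_const) hy (by simp)
  have h5 : ContDiffAt ℝ ∞ (fun z ↦ G (y z)) z₀ := ContDiffAt.comp (g := G) z₀ hG hy
  have h6 : ContDiffAt ℝ ∞ (fun z ↦ G (y z) (a z) w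
      + fderiv ℝ (fun p ↦ G p (u z) w) (y z) (u z)
      - 1 / 2 * fderiv ℝ (fun p ↦ G p (u z) (u z)) (y z) w) z₀ :=
    (((h5.clm_apply ha).clm_apply contDiffAt_const).add (h4.clm_apply hu)).sub
      (contDiffAt_const.mul (h3.clm_apply contDiffAt_const))
  refine h6.congr_of_eventuallyEq (hdG.mono fun z hz ↦ ?_)
  have h7 : HasFDerivAt (fun p ↦ G p (u z)) _ (y z) :=
    hz.hasFDerivAt.clm_apply (hasFDerivAt_const (u z) (y z))
  have h8 := h7.clm_apply (hasFDerivAt_const (u z) (y z))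
  have h9 := h7.clm_apply (hasFDerivAt_const w (y z))
  simp only [eulerLagrange]
  rw [h8.fderiv, h9.fderiv]
  simp

variable {E : Type*} [NormedAddCommGroup E] [NormedSpace ℝ E] [FiniteDimensional ℝ E]
  {M : Type*} [TopologicalSpace M] [ChartedSpace E M] [IsManifold 𝓘(ℝ, E) ∞ M]
  {F : Type*} [NormedAddCommGroup F] [NormedSpace ℝ F] [FiniteDimensional ℝ F]
  {L : Type*} [TopologicalSpace L] [ChartedSpace F L] [IsManifold 𝓘(ℝ, F) ∞ L]

/-- A smooth nowhere vanishing null vector field on the null hypersurface `i : L → M`. -/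
structure IsNullSection (g : LorentzianMetric E M) (i : L → M)
    (ξ : ∀ x : L, TangentSpace 𝓘(ℝ, F) x) : Prop where
  hypersurface : IsNullHypersurface F g i
  smooth : ContMDiff 𝓘(ℝ, F) 𝓘(ℝ, F).tangent ∞
      (fun x : L ↦ (⟨x, ξ x⟩ : TangentBundle 𝓘(ℝ, F) L))
  ne_zero (x : L) : ξ x ≠ 0
  null (x : L) : g.form (i x) (push E i ξ x) (push E i ξ x) = 0

variable {g : LorentzianMetric E M} {i : L → M} {ξ : ∀ x : L, TangentSpace 𝓘(ℝ, F) x}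

theorem LorentzianMetric.surfaceGravity_eq_of {x : L} (h : push E i ξ x ≠ 0) {c : ℝ}
    (hc : g.pushAccel i ξ x = c • push E i ξ x) : g.surfaceGravity i ξ x = c := by
  have h1 : ∃ c : ℝ, g.sectionAccel i ξ x = c • pushSection E i ξ x := ⟨c, hc⟩
  have h2 : g.pushAccel i ξ x = h1.choose • push E i ξ x := h1.choose_spec
  rw [surfaceGravity, dif_pos h1]
  exact smul_left_injective ℝ h (h2.symm.trans hc)

namespace IsNullSection

theorem push_ne_zero (h : IsNullSection g i ξ) (x : L) : push E i ξ x ≠ 0 :=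
  h.hypersurface.push_ne_zero (h.ne_zero x)

theorem pushAccel_eq (h : IsNullSection g i ξ) (x : L) :
    g.pushAccel i ξ x = g.surfaceGravity i ξ x • push E i ξ x := by
  obtain ⟨c, hc⟩ := h.hypersurface.exists_eq_smul_push (h.ne_zero x) (h.null x)
    (h.hypersurface.form_pushAccel_eq_zero h.smooth h.null x)
  rw [LorentzianMetric.surfaceGravity_eq_of (h.push_ne_zero x) hc, hc]

theorem pushAccel_smul (h : IsNullSection g i ξ) {f : L → ℝ} {x : L}
    (hf : MDifferentiableAt 𝓘(ℝ, F) 𝓘(ℝ, ℝ) f x) :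
    g.pushAccel i (fun y ↦ f y • ξ y) x
      = (directionalDeriv f x (ξ x) + g.surfaceGravity i ξ x * f x) •
        push E i (fun y ↦ f y • ξ y) x := by
  rw [g.pushAccel_smul h.hypersurface.contMDiff h.smooth hf, h.pushAccel_eq, push_smul, smul_smul,
    smul_smul, ← add_smul]
  congr 1
  ring

theorem surfaceGravity_smul (h : IsNullSection g i ξ) {f : L → ℝ} {x : L}
    (hf : MDifferentiableAt 𝓘(ℝ, F) 𝓘(ℝ, ℝ) f x) (hx : f x ≠ 0) :
    g.surfaceGravity i (fun y ↦ f y • ξ y) x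
      = directionalDeriv f x (ξ x) + g.surfaceGravity i ξ x * f x :=
  LorentzianMetric.surfaceGravity_eq_of
    (by rw [push_smul]; exact smul_ne_zero hx (h.push_ne_zero x)) (h.pushAccel_smul hf)

/-- Pairing `∇_ξ ξ = κ ξ` with a vector field of constant coordinates `w` exhibits `κ` as a quotient
of smooth functions near the point. -/
theorem contMDiff_surfaceGravity (h : IsNullSection g i ξ) :
    ContMDiff 𝓘(ℝ, F) 𝓘(ℝ, ℝ) ∞ (g.surfaceGravity i ξ) := by
  intro x₀
  have hi := h.hypersurface.contMDiff
  have hxs := mem_chart_source F x₀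
  have hps := mem_chart_source E (i x₀)
  set p := i x₀ with hp
  set φ : F → E := coordMap i x₀ p with hφdef
  set V : F → E := coordPush i ξ x₀ p with hV
  set z₀ := extChartAt 𝓘(ℝ, F) x₀ x₀ with hz₀
  have hφz : φ z₀ = extChartAt 𝓘(ℝ, E) p p := coordMap_extChartAt hxs
  have hφ : ContDiffAt ℝ ∞ φ z₀ := contDiffAt_coordMap hi hxs hps
  have hVs : ContDiffAt ℝ ∞ V z₀ := contDiffAt_coordPush hi h.smooth hxs hps
  have hvs : ContDiffAt ℝ ∞ (coordField ξ x₀) z₀ := contDiffAt_coordField h.smooth hxs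
  have hG : ContDiffAt ℝ ∞ (g.metricCoord p) (φ z₀) := hφz ▸ g.contDiffAt_metricCoord hps
  -- Such a `w` exists by nondegeneracy of the metric. It is necessarily transverse to `L`, since
  -- `ξ` is orthogonal to all tangent vectors of `L`.
  obtain ⟨w, hw⟩ : ∃ w : E, g.form p (push E i ξ x₀) w ≠ 0 := by
    by_contra! hw
    refine h.push_ne_zero x₀ (g.eq_of_inner_eq (p := p) fun w ↦ (hw w).trans ?_)
    exact (congrArg (fun f : E →L[ℝ] ℝ ↦ f w) ((g.form p).map_zero)).symm
  have hden : ContDiffAt ℝ ∞ (fun z ↦ g.metricCoord p (φ z) (V z) w) z₀ :=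
    ((ContDiffAt.comp (g := g.metricCoord p) z₀ hG hφ).clm_apply hVs).clm_apply contDiffAt_const
  have hnum : ContDiffAt ℝ ∞ (fun z ↦ eulerLagrange (g.metricCoord p) (φ z) (V z)
      (fderiv ℝ V z (coordField ξ x₀ z)) w) z₀ :=
    contDiffAt_eulerLagrange hG hφ hVs
      ((hVs.fderiv_right (m := ∞) (by simp)).clm_apply hvs) w
  have hden0 : g.metricCoord p (φ z₀) (V z₀) w ≠ 0 := by
    rw [hφz, g.metricCoord_apply hps, hV, hz₀, coordPush_self hi, tangentCoordChange_self_apply,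
      tangentCoordChange_self_apply]
    exact hw
  have hq := hnum.div hden hden0
  have hq' : ContMDiffAt 𝓘(ℝ, F) 𝓘(ℝ, ℝ) ∞ ((fun z ↦ eulerLagrange (g.metricCoord p) (φ z) (V z)
      (fderiv ℝ V z (coordField ξ x₀ z)) w / g.metricCoord p (φ z) (V z) w) ∘
        extChartAt 𝓘(ℝ, F) x₀) x₀ :=
    ContMDiffAt.comp (I' := 𝓘(ℝ, F)) x₀ hq.contMDiffAt contMDiffAt_extChartAt
  refine hq'.congr_of_eventuallyEq ?_
  have hne : ∀ᶠ x in 𝓝 x₀, g.metricCoord p (φ (extChartAt 𝓘(ℝ, F) x₀ x))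
      (V (extChartAt 𝓘(ℝ, F) x₀ x)) w ≠ 0 :=
    (continuousAt_extChartAt x₀).eventually (hden.continuousAt.eventually_ne hden0)
  filter_upwards [hne, (chartAt F x₀).open_source.mem_nhds hxs,
    eventually_mem_chart_source hi.continuous.continuousAt hps] with x hx hxs' hps'
  have h1 : φ (extChartAt 𝓘(ℝ, F) x₀ x) = extChartAt 𝓘(ℝ, E) p (i x) := coordMap_extChartAt hxs'
  have h2 : V (extChartAt 𝓘(ℝ, F) x₀ x)
      = tangentCoordChange 𝓘(ℝ, E) (i x) p (i x) (push E i ξ x) :=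
    (tangentCoordChange_pushSection hi hxs' hps').symm
  have h3 : g.metricCoord p (φ (extChartAt 𝓘(ℝ, F) x₀ x)) (V (extChartAt 𝓘(ℝ, F) x₀ x)) w
      = g.form (i x) (push E i ξ x) (tangentCoordChange 𝓘(ℝ, E) p (i x) (i x) w) := by
    rw [h1, h2, g.metricCoord_apply hps', tangentCoordChange_comp_cancel' hps']
    rfl
  rw [Function.comp_apply, eq_div_iff hx, ← g.form_pushAccel hi h.smooth hxs' hps',
    h.pushAccel_eq, h3, map_smul, smul_apply, smul_eq_mul]

end IsNullSection

end SurfaceGravitySmooth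

/-! ### Primitives and the group law of the flow. -/

section Primitives

theorem hasDerivAt_primitive {f : ℝ → ℝ} {I : Set ℝ} (hf : ContinuousOn f I) (hI : IsOpen I)
    (hc : I.OrdConnected) (h0 : 0 ∈ I) {t : ℝ} (ht : t ∈ I) :
    HasDerivAt (fun u ↦ ∫ r in (0 : ℝ)..u, f r) (f t) t :=
  intervalIntegral.integral_hasDerivAt_right
    ((hf.mono (hc.uIcc_subset h0 ht)).intervalIntegrable)
    (hf.stronglyMeasurableAtFilter hI t ht) (hf.continuousAt (hI.mem_nhds ht))

theorem primitive_add {f : ℝ → ℝ} {I : Set ℝ} (hf : ContinuousOn f I)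
    (hc : I.OrdConnected) (h0 : 0 ∈ I) {t τ : ℝ} (ht : t ∈ I) (hτ : t + τ ∈ I) :
    ∫ r in (0 : ℝ)..(t + τ), f r = (∫ r in (0 : ℝ)..t, f r) + ∫ r in (0 : ℝ)..τ, f (t + r) := by
  rw [intervalIntegral.integral_comp_add_left, add_zero,
    intervalIntegral.integral_add_adjacent_intervals
      ((hf.mono (hc.uIcc_subset h0 ht)).intervalIntegrable)
      ((hf.mono (hc.uIcc_subset ht hτ)).intervalIntegrable)]

theorem primitive_eq {f k : ℝ → ℝ} {I : Set ℝ} (hf : ContinuousOn f I) (hc : I.OrdConnected)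
    (h0 : 0 ∈ I) (hk : ∀ t ∈ I, HasDerivAt k (f t) t) (hk0 : k 0 = 0) {t : ℝ} (ht : t ∈ I) :
    ∫ r in (0 : ℝ)..t, f r = k t := by
  rw [intervalIntegral.integral_eq_sub_of_hasDerivAt
    (fun r hr ↦ hk r (hc.uIcc_subset h0 ht hr))
    ((hf.mono (hc.uIcc_subset h0 ht)).intervalIntegrable), hk0, sub_zero]

end Primitives

section FlowProperties

variable {F : Type*} [NormedAddCommGroup F] [NormedSpace ℝ F]
  {L : Type*} [TopologicalSpace L] [ChartedSpace F L]

/-- The maximal interval on which the integral curve of `ξ` that starts at `x` is defined. -/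
def flowInterval (ξ : ∀ x : L, TangentSpace 𝓘(ℝ, F) x) (x : L) : Set ℝ :=
  {t | (x, t) ∈ flowDomain ξ univ}

/-- A smooth vector field. -/
def SmoothField [IsManifold 𝓘(ℝ, F) ∞ L] (ξ : ∀ x : L, TangentSpace 𝓘(ℝ, F) x) : Prop :=
  ContMDiff 𝓘(ℝ, F) 𝓘(ℝ, F).tangent ∞ (fun x : L ↦ (⟨x, ξ x⟩ : TangentBundle 𝓘(ℝ, F) L))

variable {ξ : ∀ x : L, TangentSpace 𝓘(ℝ, F) x}

theorem isMIntegralCurveOn_iff_of_isOpen {γ : ℝ → L} {J : Set ℝ} (hJ : IsOpen J) :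
    IsMIntegralCurveOn γ ξ J ↔
      ∀ t ∈ J, HasMFDerivAt 𝓘(ℝ, ℝ) 𝓘(ℝ, F) γ t ((1 : ℝ →L[ℝ] ℝ).smulRight (ξ (γ t))) :=
  forall₂_congr fun _ ht ↦
    ⟨fun h ↦ h.hasMFDerivAt (hJ.mem_nhds ht), fun h ↦ h.hasMFDerivWithinAt⟩

theorem isIntegralCurveFrom_of_isOpen {γ : ℝ → L} {J : Set ℝ} {U : Set L} (hJ : IsOpen J)
    (hc : J.OrdConnected) (h0 : 0 ∈ J) (hγ : IsMIntegralCurveOn γ ξ J) (hU : MapsTo γ J U) {t : ℝ}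
    (ht : t ∈ J) : IsIntegralCurveFrom ξ U (γ 0) t γ := by
  have hmin : min 0 t ∈ J := by rcases min_choice 0 t with h | h <;> rw [h] <;> assumption
  have hmax : max 0 t ∈ J := by rcases max_choice 0 t with h | h <;> rw [h] <;> assumption
  obtain ⟨a, b, ha, hb, hab⟩ := exists_Ioo_subset hJ hc hmin hmax
  exact ⟨a, b, ha.trans_le (min_le_left _ _), (le_max_left _ _).trans_lt hb,
    ⟨ha.trans_le (min_le_right _ _), (le_max_right _ _).trans_lt hb⟩, rfl, hU.mono_left hab,
    hγ.mono hab⟩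

variable [IsManifold 𝓘(ℝ, F) ∞ L] [T2Space L]

theorem flow_eq (hξ : SmoothField ξ) {x : L} {t : ℝ} {γ : ℝ → L}
    (hγ : IsIntegralCurveFrom ξ univ x t γ) : flow ξ x t = γ t := by
  have h : ∃ γ : ℝ → L, IsIntegralCurveFrom ξ univ x t γ := ⟨γ, hγ⟩
  rw [flow, dif_pos h]
  obtain ⟨a, b, ha, hb, ht, h0, -, hint⟩ := hγ
  obtain ⟨a', b', ha', hb', ht', h0', -, hint'⟩ := h.choose_spec
  have hξ1 : ContMDiff 𝓘(ℝ, F) 𝓘(ℝ, F).tangent 1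
      (fun x : L ↦ (⟨x, ξ x⟩ : TangentBundle 𝓘(ℝ, F) L)) :=
    ContMDiff.of_le (n := ∞) hξ (by simp)
  exact isMIntegralCurveOn_Ioo_eqOn_of_contMDiff_boundaryless (t₀ := 0)
    (a := max a a') (b := min b b') ⟨max_lt ha ha', lt_min hb hb'⟩ hξ1
    (hint'.mono (Ioo_subset_Ioo (le_max_right _ _) (min_le_right _ _)))
    (hint.mono (Ioo_subset_Ioo (le_max_left _ _) (min_le_left _ _))) (h0'.trans h0.symm)
    ⟨max_lt ht.1 ht'.1, lt_min ht.2 ht'.2⟩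

theorem mem_flowInterval_of_isMIntegralCurveOn (hξ : SmoothField ξ) {γ : ℝ → L} {J : Set ℝ}
    (hJ : IsOpen J) (hc : J.OrdConnected) (h0 : 0 ∈ J) (hγ : IsMIntegralCurveOn γ ξ J) {t : ℝ}
    (ht : t ∈ J) : t ∈ flowInterval ξ (γ 0) ∧ flow ξ (γ 0) t = γ t :=
  have h := isIntegralCurveFrom_of_isOpen (U := univ) hJ hc h0 hγ (mapsTo_univ _ _) ht
  ⟨⟨γ, h⟩, flow_eq hξ h⟩

/-- The value `flow ξ x t` is read off a curve chosen separately for every `t`. Uniqueness of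
integral curves glues these choices to one integral curve. -/
theorem exists_isMIntegralCurveOn_of_mem (hξ : SmoothField ξ) {x : L} {t : ℝ}
    (ht : t ∈ flowInterval ξ x) : ∃ a b : ℝ, a < 0 ∧ 0 < b ∧ t ∈ Ioo a b ∧
      Ioo a b ⊆ flowInterval ξ x ∧ flow ξ x 0 = x ∧ IsMIntegralCurveOn (flow ξ x) ξ (Ioo a b) := by
  obtain ⟨γ, a, b, ha, hb, htab, rfl, -, hγ⟩ := ht
  have h : ∀ u ∈ Ioo a b, u ∈ flowInterval ξ (γ 0) ∧ flow ξ (γ 0) u = γ u := fun u hu ↦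
    mem_flowInterval_of_isMIntegralCurveOn hξ isOpen_Ioo ordConnected_Ioo ⟨ha, hb⟩ hγ hu
  refine ⟨a, b, ha, hb, htab, fun u hu ↦ (h u hu).1, (h 0 ⟨ha, hb⟩).2, ?_⟩
  rw [isMIntegralCurveOn_iff_of_isOpen isOpen_Ioo] at hγ ⊢
  intro u hu
  rw [(h u hu).2]
  refine (hγ u hu).congr_of_eventuallyEq ?_
  filter_upwards [isOpen_Ioo.mem_nhds hu] with r hr using (h r hr).2

theorem isOpen_flowInterval (hξ : SmoothField ξ) (x : L) : IsOpen (flowInterval ξ x) := by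
  refine isOpen_iff_mem_nhds.2 fun t ht ↦ ?_
  obtain ⟨a, b, -, -, htab, h, -⟩ := exists_isMIntegralCurveOn_of_mem hξ ht
  exact Filter.mem_of_superset (isOpen_Ioo.mem_nhds htab) h

theorem ordConnected_flowInterval (hξ : SmoothField ξ) (x : L) :
    (flowInterval ξ x).OrdConnected := by
  refine ordConnected_of_uIcc_subset_left (x := 0) fun t ht ↦ ?_
  obtain ⟨a, b, ha, hb, htab, h, -⟩ := exists_isMIntegralCurveOn_of_mem hξ ht
  exact (ordConnected_Ioo.uIcc_subset ⟨ha, hb⟩ htab).trans h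

theorem hasMFDerivAt_flow (hξ : SmoothField ξ) {x : L} {t : ℝ} (ht : t ∈ flowInterval ξ x) :
    HasMFDerivAt 𝓘(ℝ, ℝ) 𝓘(ℝ, F) (flow ξ x) t
      ((1 : ℝ →L[ℝ] ℝ).smulRight (ξ (flow ξ x t))) := by
  obtain ⟨a, b, -, -, htab, -, -, h⟩ := exists_isMIntegralCurveOn_of_mem hξ ht
  exact (isMIntegralCurveOn_iff_of_isOpen isOpen_Ioo).1 h t htab

theorem isMIntegralCurveOn_flow (hξ : SmoothField ξ) (x : L) :
    IsMIntegralCurveOn (flow ξ x) ξ (flowInterval ξ x) :=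
  (isMIntegralCurveOn_iff_of_isOpen (isOpen_flowInterval hξ x)).2 fun _ ht ↦ hasMFDerivAt_flow hξ ht

theorem continuousOn_flow (hξ : SmoothField ξ) (x : L) :
    ContinuousOn (flow ξ x) (flowInterval ξ x) := fun _ ht ↦
  (hasMFDerivAt_flow hξ ht).continuousAt.continuousWithinAt

variable [FiniteDimensional ℝ F]

theorem zero_mem_flowInterval (hξ : SmoothField ξ) (x : L) : 0 ∈ flowInterval ξ x := by
  obtain ⟨γ, rfl, hγ⟩ := LorentzianMetric.exists_integralCurve hξ x
  obtain ⟨ε, hε, h⟩ := Metric.eventually_nhds_iff_ball.1 hγ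
  rw [Real.ball_eq_Ioo] at h
  have h0 : (0 : ℝ) ∈ Ioo (0 - ε) (0 + ε) := by simpa using hε
  exact (mem_flowInterval_of_isMIntegralCurveOn hξ isOpen_Ioo ordConnected_Ioo h0
    ((isMIntegralCurveOn_iff_of_isOpen isOpen_Ioo).2 h) h0).1

theorem flow_zero (hξ : SmoothField ξ) (x : L) : flow ξ x 0 = x := by
  obtain ⟨a, b, -, -, -, -, h, -⟩ :=
    exists_isMIntegralCurveOn_of_mem hξ (zero_mem_flowInterval hξ x)
  exact h

theorem flow_add_aux (hξ : SmoothField ξ) {x : L} {t τ : ℝ} (ht : t ∈ flowInterval ξ x)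
    (hτ : t + τ ∈ flowInterval ξ x) :
    τ ∈ flowInterval ξ (flow ξ x t) ∧ flow ξ (flow ξ x t) τ = flow ξ x (t + τ) := by
  have h1 := (isMIntegralCurveOn_flow hξ x).comp_add t
  have hc := ordConnected_flowInterval hξ x
  have h2 := mem_flowInterval_of_isMIntegralCurveOn hξ (J := {u | u + t ∈ flowInterval ξ x})
    ((isOpen_flowInterval hξ x).preimage (by fun_prop))
    ⟨fun a ha b hb c hc' ↦ hc.out ha hb ⟨by linarith [hc'.1], by linarith [hc'.2]⟩⟩
    (by simpa using ht) h1 (t := τ) (by simpa [add_comm] using hτ)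
  simpa [add_comm τ t] using h2

theorem mem_flowInterval_flow_iff (hξ : SmoothField ξ) {x : L} {t : ℝ} (ht : t ∈ flowInterval ξ x)
    (τ : ℝ) : τ ∈ flowInterval ξ (flow ξ x t) ↔ t + τ ∈ flowInterval ξ x := by
  refine ⟨fun hτ ↦ ?_, fun hτ ↦ (flow_add_aux hξ ht hτ).1⟩
  -- To show that `t + τ` is admissible at `x`, the base point is moved: from `flow ξ x t` back by
  -- `-t` to `x`, then on by `t + τ`.
  have h1 := flow_add_aux hξ ht (τ := -t) (by simpa using zero_mem_flowInterval hξ x)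
  rw [add_neg_cancel, flow_zero hξ] at h1
  have h2 := flow_add_aux hξ h1.1 (τ := t + τ) (by simpa using hτ)
  rw [h1.2] at h2
  exact h2.1

theorem flow_add (hξ : SmoothField ξ) {x : L} {t τ : ℝ} (ht : t ∈ flowInterval ξ x)
    (hτ : t + τ ∈ flowInterval ξ x) : flow ξ (flow ξ x t) τ = flow ξ x (t + τ) :=
  (flow_add_aux hξ ht hτ).2

theorem neg_mem_flowInterval_flow (hξ : SmoothField ξ) {x : L} {t : ℝ}
    (ht : t ∈ flowInterval ξ x) : -t ∈ flowInterval ξ (flow ξ x t) := by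
  rw [mem_flowInterval_flow_iff hξ ht, add_neg_cancel]
  exact zero_mem_flowInterval hξ x

theorem flow_flow_neg (hξ : SmoothField ξ) {x : L} {t : ℝ} (ht : t ∈ flowInterval ξ x) :
    flow ξ (flow ξ x t) (-t) = x := by
  rw [flow_add hξ ht (by rw [add_neg_cancel]; exact zero_mem_flowInterval hξ x), add_neg_cancel,
    flow_zero hξ]

end FlowProperties

/-! ### Smooth dependence of the flow and of the affine parameter on the starting point. -/

section AugmentedFlow

variable {F : Type*} [NormedAddCommGroup F] [NormedSpace ℝ F]
  {L : Type*} [TopologicalSpace L] [ChartedSpace F L]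

/-- The integral of `κ` along the integral curve of `ξ` that starts at `x`. -/
noncomputable def flowIntegral (ξ : ∀ x : L, TangentSpace 𝓘(ℝ, F) x) (κ : L → ℝ) (x : L)
    (t : ℝ) : ℝ :=
  ∫ r in (0 : ℝ)..t, κ (flow ξ x r)

/-- The affine parameter along the integral curve of `ξ` that starts at `x`. -/
noncomputable def affineParameter (ξ : ∀ x : L, TangentSpace 𝓘(ℝ, F) x) (κ : L → ℝ) (x : L)
    (t : ℝ) : ℝ :=
  ∫ r in (0 : ℝ)..t, Real.exp (flowIntegral ξ κ x r)

variable [IsManifold 𝓘(ℝ, F) ∞ L] [T2Space L] [FiniteDimensional ℝ F]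
  {ξ : ∀ x : L, TangentSpace 𝓘(ℝ, F) x} {κ : L → ℝ}

theorem continuousOn_comp_flow (hξ : SmoothField ξ) (hκ : Continuous κ) (x : L) :
    ContinuousOn (fun r ↦ κ (flow ξ x r)) (flowInterval ξ x) :=
  hκ.comp_continuousOn (continuousOn_flow hξ x)

theorem hasDerivAt_flowIntegral (hξ : SmoothField ξ) (hκ : Continuous κ) {x : L} {t : ℝ}
    (ht : t ∈ flowInterval ξ x) : HasDerivAt (flowIntegral ξ κ x) (κ (flow ξ x t)) t :=
  hasDerivAt_primitive (continuousOn_comp_flow hξ hκ x) (isOpen_flowInterval hξ x)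
    (ordConnected_flowInterval hξ x) (zero_mem_flowInterval hξ x) ht

theorem continuousOn_exp_flowIntegral (hξ : SmoothField ξ) (hκ : Continuous κ) (x : L) :
    ContinuousOn (fun r ↦ Real.exp (flowIntegral ξ κ x r)) (flowInterval ξ x) := fun _ ht ↦
  (hasDerivAt_flowIntegral hξ hκ ht).continuousAt.rexp.continuousWithinAt

theorem hasDerivAt_affineParameter (hξ : SmoothField ξ) (hκ : Continuous κ) {x : L} {t : ℝ}
    (ht : t ∈ flowInterval ξ x) :
    HasDerivAt (affineParameter ξ κ x) (Real.exp (flowIntegral ξ κ x t)) t :=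
  hasDerivAt_primitive (continuousOn_exp_flowIntegral hξ hκ x) (isOpen_flowInterval hξ x)
    (ordConnected_flowInterval hξ x) (zero_mem_flowInterval hξ x) ht

theorem flowIntegral_zero (x : L) : flowIntegral ξ κ x 0 = 0 := by simp [flowIntegral]

theorem affineParameter_zero (x : L) : affineParameter ξ κ x 0 = 0 := by simp [affineParameter]

theorem flowIntegral_add (hξ : SmoothField ξ) (hκ : Continuous κ) {x : L} {t τ : ℝ}
    (ht : t ∈ flowInterval ξ x) (hτ : t + τ ∈ flowInterval ξ x) :
    flowIntegral ξ κ x (t + τ) = flowIntegral ξ κ x t + flowIntegral ξ κ (flow ξ x t) τ := by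
  rw [flowIntegral, primitive_add (continuousOn_comp_flow hξ hκ x)
    (ordConnected_flowInterval hξ x) (zero_mem_flowInterval hξ x) ht hτ]
  congr 1
  refine intervalIntegral.integral_congr fun r hr ↦ ?_
  have h1 : τ ∈ flowInterval ξ (flow ξ x t) := (mem_flowInterval_flow_iff hξ ht τ).2 hτ
  have h2 := (ordConnected_flowInterval hξ _).uIcc_subset (zero_mem_flowInterval hξ _) h1 hr
  simp only [flow_add hξ ht ((mem_flowInterval_flow_iff hξ ht r).1 h2)]

/-- The inner integral is additive along the flow, so the constant factor `exp K(x, t)` comes out of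
the integral over the second piece. -/
theorem affineParameter_add (hξ : SmoothField ξ) (hκ : Continuous κ) {x : L} {t τ : ℝ}
    (ht : t ∈ flowInterval ξ x) (hτ : t + τ ∈ flowInterval ξ x) :
    affineParameter ξ κ x (t + τ) = affineParameter ξ κ x t
      + Real.exp (flowIntegral ξ κ x t) * affineParameter ξ κ (flow ξ x t) τ := by
  rw [affineParameter, primitive_add (continuousOn_exp_flowIntegral hξ hκ x)
    (ordConnected_flowInterval hξ x) (zero_mem_flowInterval hξ x) ht hτ]
  congr 1
  rw [affineParameter, ← intervalIntegral.integral_const_mul]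
  refine intervalIntegral.integral_congr fun r hr ↦ ?_
  have h1 : τ ∈ flowInterval ξ (flow ξ x t) := (mem_flowInterval_flow_iff hξ ht τ).2 hτ
  have h2 := (ordConnected_flowInterval hξ _).uIcc_subset (zero_mem_flowInterval hξ _) h1 hr
  simp only [flowIntegral_add hξ hκ ht ((mem_flowInterval_flow_iff hξ ht r).1 h2), Real.exp_add]

/-- The flow of `ξ` and the functions obtained from it by integration are defined and smooth near
`(x, t)`, as functions of `x`. -/
structure FlowSmoothAt (ξ : ∀ x : L, TangentSpace 𝓘(ℝ, F) x) (κ : L → ℝ) (x : L) (t : ℝ) :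
    Prop where
  mem : t ∈ flowInterval ξ x
  flow : ContMDiffAt 𝓘(ℝ, F) 𝓘(ℝ, F) ∞ (fun y ↦ flow ξ y t) x
  integral : ContMDiffAt 𝓘(ℝ, F) 𝓘(ℝ, ℝ) ∞ (fun y ↦ flowIntegral ξ κ y t) x
  parameter : ContMDiffAt 𝓘(ℝ, F) 𝓘(ℝ, ℝ) ∞ (fun y ↦ affineParameter ξ κ y t) x

/-- The triple `(Φ, K, S)` solves the single smooth autonomous system `(z, k, s)' = (ξ(z), κ(z), exp
k)` with initial value `(x, 0, 0)`. One application of the local flow theorem covers all three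
components. -/
theorem exists_flowSmoothAt (hξ : SmoothField ξ) (hκ : ContMDiff 𝓘(ℝ, F) 𝓘(ℝ, ℝ) ∞ κ) (x₀ : L) :
    ∃ ε > 0, ∀ᶠ x in 𝓝 x₀, ∀ t ∈ Ioo (-ε) ε, FlowSmoothAt ξ κ x t := by
  set e := extChartAt 𝓘(ℝ, F) x₀ with he
  let v : F × ℝ × ℝ → F × ℝ × ℝ := fun q ↦
    (coordField ξ x₀ q.1, (κ ∘ e.symm) q.1, Real.exp q.2.1)
  have hκe : ContDiffOn ℝ ∞ (κ ∘ e.symm) e.target := by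
    rw [← contMDiffOn_iff_contDiffOn]
    exact hκ.comp_contMDiffOn (contMDiffOn_extChartAt_symm x₀)
  have hv : ContDiffOn ℝ ∞ v (e.target ×ˢ univ) := by
    refine ContDiffOn.prodMk ?_ (ContDiffOn.prodMk ?_ ?_)
    · exact (contDiffOn_coordField hξ x₀).comp contDiffOn_fst fun q hq ↦ hq.1
    · exact hκe.comp contDiffOn_fst fun q hq ↦ hq.1
    · exact (Real.contDiff_exp.comp (contDiff_snd.fst)).contDiffOn
  have hΩ : e.target ×ˢ univ ∈ 𝓝 ((e x₀, 0, 0) : F × ℝ × ℝ) :=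
    prod_mem_nhds (extChartAt_target_mem_nhds x₀) Filter.univ_mem
  obtain ⟨ε, hε, α, hα⟩ := exists_smooth_localFlow v hv hΩ
  refine ⟨ε, hε, ?_⟩
  have hι : ContMDiffAt 𝓘(ℝ, F) 𝓘(ℝ, F × ℝ × ℝ) ∞ (fun x ↦ ((e x, 0, 0) : F × ℝ × ℝ)) x₀ :=
    ContMDiffAt.comp (I' := 𝓘(ℝ, F)) x₀
      (g := fun z : F ↦ ((z, 0, 0) : F × ℝ × ℝ)) (contDiff_prodMk_left _).contMDiff.contMDiffAt
      contMDiffAt_extChartAt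
  have hα' := hι.continuousAt.eventually hα
  have hsrc : ∀ᶠ x in 𝓝 x₀, x ∈ e.source := extChartAt_source_mem_nhds x₀
  have hchar : ∀ᶠ x in 𝓝 x₀, ∀ t ∈ Ioo (-ε) ε, t ∈ flowInterval ξ x ∧
      flow ξ x t = e.symm (α (e x, 0, 0) t).1 ∧ flowIntegral ξ κ x t = (α (e x, 0, 0) t).2.1 ∧
      affineParameter ξ κ x t = (α (e x, 0, 0) t).2.2 := by
    filter_upwards [hα', hsrc] with x ⟨hx0, hx⟩ hxs
    set a := α (e x, 0, 0) with ha
    have h0 : (0 : ℝ) ∈ Ioo (-ε) ε := by simpa using hε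
    have h1 : ∀ t ∈ Ioo (-ε) ε, HasDerivAt (fun t ↦ (a t).1) (coordField ξ x₀ (a t).1) t :=
      fun t ht ↦ (hasFDerivAt_fst (p := a t)).comp_hasDerivAt t (hx t ht).1
    have h2 : ∀ t ∈ Ioo (-ε) ε, HasDerivAt (fun t ↦ (a t).2.1) (κ (e.symm (a t).1)) t :=
      fun t ht ↦ ((ContinuousLinearMap.fst ℝ ℝ ℝ).comp
      (ContinuousLinearMap.snd ℝ F (ℝ × ℝ))).hasFDerivAt.comp_hasDerivAt t (hx t ht).1
    have h3 : ∀ t ∈ Ioo (-ε) ε, HasDerivAt (fun t ↦ (a t).2.2) (Real.exp (a t).2.1) t :=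
      fun t ht ↦ ((ContinuousLinearMap.snd ℝ ℝ ℝ).comp
      (ContinuousLinearMap.snd ℝ F (ℝ × ℝ))).hasFDerivAt.comp_hasDerivAt t (hx t ht).1
    have h4 : IsMIntegralCurveOn (e.symm ∘ fun t ↦ (a t).1) ξ (Ioo (-ε) ε) :=
      (isMIntegralCurveOn_iff_of_isOpen isOpen_Ioo).2 fun t ht ↦
        hasMFDerivAt_extChartAt_symm_comp (hx t ht).2.1.1 (h1 t ht)
    have h5 : (e.symm ∘ fun t ↦ (a t).1) 0 = x := by
      simp [hx0, e.left_inv hxs]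
    have h6 : ∀ t ∈ Ioo (-ε) ε, t ∈ flowInterval ξ x ∧ flow ξ x t = e.symm (a t).1 := by
      intro t ht
      have := mem_flowInterval_of_isMIntegralCurveOn hξ isOpen_Ioo ordConnected_Ioo h0 h4 ht
      rwa [h5] at this
    have h7 : ∀ t ∈ Ioo (-ε) ε, flowIntegral ξ κ x t = (a t).2.1 := fun t ht ↦
      primitive_eq (k := fun t ↦ (a t).2.1) ((continuousOn_comp_flow hξ hκ.continuous x).mono fun r hr ↦ (h6 r hr).1)
        ordConnected_Ioo h0 (fun r hr ↦ (h6 r hr).2 ▸ h2 r hr) (by simp [hx0]) ht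
    have h8 : ∀ t ∈ Ioo (-ε) ε, affineParameter ξ κ x t = (a t).2.2 := fun t ht ↦
      primitive_eq (k := fun t ↦ (a t).2.2) ((continuousOn_exp_flowIntegral hξ hκ.continuous x).mono
        fun r hr ↦ (h6 r hr).1)
        ordConnected_Ioo h0 (fun r hr ↦ (h7 r hr) ▸ h3 r hr) (by simp [hx0]) ht
    exact fun t ht ↦ ⟨(h6 t ht).1, (h6 t ht).2, h7 t ht, h8 t ht⟩
  have hι' : ∀ᶠ x in 𝓝 x₀, ContMDiffAt 𝓘(ℝ, F) 𝓘(ℝ, F × ℝ × ℝ) ∞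
      (fun x ↦ ((e x, 0, 0) : F × ℝ × ℝ)) x := by
    filter_upwards [hsrc] with x hx
    rw [he, extChartAt_source] at hx
    exact ContMDiffAt.comp (I' := 𝓘(ℝ, F)) x
      (g := fun z : F ↦ ((z, 0, 0) : F × ℝ × ℝ)) (contDiff_prodMk_left _).contMDiff.contMDiffAt
      (contMDiffAt_extChartAt' hx)
  filter_upwards [hchar.eventually_nhds, hα', hι'] with x hx hx' hιx t ht
  have hαx : ContMDiffAt 𝓘(ℝ, F) 𝓘(ℝ, F × ℝ × ℝ) ∞ (fun y ↦ α (e y, 0, 0) t) x :=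
    ContMDiffAt.comp (I' := 𝓘(ℝ, F × ℝ × ℝ)) x (g := fun q ↦ α q t)
      (hx'.2 t ht).2.2.contMDiffAt hιx
  refine ⟨(hx.self_of_nhds t ht).1, ?_, ?_, ?_⟩
  · have h1 : ContMDiffAt 𝓘(ℝ, F) 𝓘(ℝ, F) ∞ (fun y ↦ (α (e y, 0, 0) t).1) x :=
      ContMDiffAt.comp (I' := 𝓘(ℝ, F × ℝ × ℝ)) x contDiff_fst.contMDiff.contMDiffAt hαx
    have ht' := (hx'.2 t ht).2.1.1
    have h2 : ContMDiffAt 𝓘(ℝ, F) 𝓘(ℝ, F) ∞ e.symm (α (e x, 0, 0) t).1 :=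
      (contMDiffOn_extChartAt_symm (n := ∞) x₀ _ ht').contMDiffAt
        ((isOpen_extChartAt_target x₀).mem_nhds ht')
    exact (h2.comp x h1).congr_of_eventuallyEq (hx.mono fun y hy ↦ (hy t ht).2.1)
  · have h1 : ContMDiffAt 𝓘(ℝ, F) 𝓘(ℝ, ℝ) ∞ (fun y ↦ (α (e y, 0, 0) t).2.1) x :=
      ContMDiffAt.comp (I' := 𝓘(ℝ, F × ℝ × ℝ)) x
        (g := fun q : F × ℝ × ℝ ↦ q.2.1) contDiff_snd.fst.contMDiff.contMDiffAt hαx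
    exact h1.congr_of_eventuallyEq (hx.mono fun y hy ↦ (hy t ht).2.2.1)
  · have h1 : ContMDiffAt 𝓘(ℝ, F) 𝓘(ℝ, ℝ) ∞ (fun y ↦ (α (e y, 0, 0) t).2.2) x :=
      ContMDiffAt.comp (I' := 𝓘(ℝ, F × ℝ × ℝ)) x
        (g := fun q : F × ℝ × ℝ ↦ q.2.2) contDiff_snd.snd.contMDiff.contMDiffAt hαx
    exact h1.congr_of_eventuallyEq (hx.mono fun y hy ↦ (hy t ht).2.2.2)

theorem ContMDiffAt.rexp {f : L → ℝ} {x : L} (hf : ContMDiffAt 𝓘(ℝ, F) 𝓘(ℝ, ℝ) ∞ f x) :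
    ContMDiffAt 𝓘(ℝ, F) 𝓘(ℝ, ℝ) ∞ (fun y ↦ Real.exp (f y)) x :=
  ContMDiffAt.comp (I' := 𝓘(ℝ, ℝ)) x (g := Real.exp) Real.contDiff_exp.contMDiff.contMDiffAt hf

theorem eventually_flowSmoothAt_add (hξ : SmoothField ξ) (hκ : ContMDiff 𝓘(ℝ, F) 𝓘(ℝ, ℝ) ∞ κ)
    {x : L} {t τ : ℝ} (h : ∀ᶠ y in 𝓝 x, FlowSmoothAt ξ κ y t)
    (h' : ∀ᶠ y in 𝓝 (flow ξ x t), FlowSmoothAt ξ κ y τ) :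
    ∀ᶠ y in 𝓝 x, FlowSmoothAt ξ κ y (t + τ) := by
  have h1 : ∀ᶠ y in 𝓝 x, FlowSmoothAt ξ κ y t ∧ FlowSmoothAt ξ κ (flow ξ y t) τ :=
    h.and (h.self_of_nhds.flow.continuousAt.eventually h')
  filter_upwards [h1.eventually_nhds] with y hy
  have hmem : ∀ᶠ z in 𝓝 y, t ∈ flowInterval ξ z ∧ t + τ ∈ flowInterval ξ z :=
    hy.mono fun z hz ↦ ⟨hz.1.mem, (mem_flowInterval_flow_iff hξ hz.1.mem τ).1 hz.2.mem⟩
  obtain ⟨hyt, hyτ⟩ := hy.self_of_nhds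
  refine ⟨hmem.self_of_nhds.2, ?_, ?_, ?_⟩
  · exact (ContMDiffAt.comp (g := fun z ↦ _root_.flow ξ z τ) y hyτ.flow hyt.flow).congr_of_eventuallyEq
      (hmem.mono fun z hz ↦ (flow_add hξ hz.1 hz.2).symm)
  · exact (hyt.integral.add (ContMDiffAt.comp (g := fun z ↦ flowIntegral ξ κ z τ) y hyτ.integral
      hyt.flow)).congr_of_eventuallyEq
      (hmem.mono fun z hz ↦ flowIntegral_add hξ hκ.continuous hz.1 hz.2)
  · exact (hyt.parameter.add (hyt.integral.rexp.mul (ContMDiffAt.comp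
      (g := fun z ↦ affineParameter ξ κ z τ) y hyτ.parameter hyt.flow))).congr_of_eventuallyEq
      (hmem.mono fun z hz ↦ affineParameter_add hξ hκ.continuous hz.1 hz.2)

/-- Smoothness propagates along the connected interval of existence: for close times `t`, `t'`,
smoothness at one implies it at the other by composition with a short-time flow. -/
theorem eventually_flowSmoothAt (hξ : SmoothField ξ) (hκ : ContMDiff 𝓘(ℝ, F) 𝓘(ℝ, ℝ) ∞ κ)
    {x : L} {t : ℝ} (ht : t ∈ flowInterval ξ x) : ∀ᶠ y in 𝓝 x, FlowSmoothAt ξ κ y t := by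
  have h0 : ∀ᶠ y in 𝓝 x, FlowSmoothAt ξ κ y 0 := by
    obtain ⟨ε, hε, h⟩ := exists_flowSmoothAt hξ hκ x
    exact h.mono fun y hy ↦ hy 0 (by simpa using hε)
  have key := (ordConnected_flowInterval hξ x).isPreconnected.induction₂
    (fun t t' ↦ (∀ᶠ y in 𝓝 x, FlowSmoothAt ξ κ y t) ↔ ∀ᶠ y in 𝓝 x, FlowSmoothAt ξ κ y t')
    (fun t ht ↦ ?_) (fun _ _ _ _ _ _ ↦ Iff.trans) (fun _ _ _ _ ↦ Iff.symm)
    (zero_mem_flowInterval hξ x) ht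
  · exact key.1 h0
  · obtain ⟨ε, hε, h⟩ := exists_flowSmoothAt hξ hκ (flow ξ x t)
    refine Filter.Eventually.filter_mono nhdsWithin_le_nhds ?_
    have hcont : ContinuousAt (flow ξ x) t := (hasMFDerivAt_flow hξ ht).continuousAt
    -- The short time `ε` has to be valid near `flow ξ x t'` too, for the return from `t'` to `t`.
    filter_upwards [hcont.eventually h.eventually_nhds, Ioo_mem_nhds (show t - ε < t by linarith)
      (show t < t + ε by linarith)] with t' ht' htε
    constructor
    · intro h1
      have := eventually_flowSmoothAt_add hξ hκ h1 (τ := t' - t)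
        (h.mono fun y hy ↦ hy _ ⟨by linarith [htε.1], by linarith [htε.2]⟩)
      rwa [add_sub_cancel] at this
    · intro h1
      have := eventually_flowSmoothAt_add hξ hκ h1 (τ := t - t')
        (ht'.mono fun y hy ↦ hy _ ⟨by linarith [htε.2], by linarith [htε.1]⟩)
      rwa [add_sub_cancel] at this

end AugmentedFlow

/-! ### The interval of affine parameters and its inverse function. -/

section AffineInterval

variable {F : Type*} [NormedAddCommGroup F] [NormedSpace ℝ F]
  {L : Type*} [TopologicalSpace L] [ChartedSpace F L]

/-- The set of values of the affine parameter on the integral curve of `ξ` through `x`. -/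
def affineInterval (ξ : ∀ x : L, TangentSpace 𝓘(ℝ, F) x) (κ : L → ℝ) (x : L) : Set ℝ :=
  affineParameter ξ κ x '' flowInterval ξ x

/-- The inverse of the affine parameter. -/
noncomputable def affineInverse (ξ : ∀ x : L, TangentSpace 𝓘(ℝ, F) x) (κ : L → ℝ) (x : L) :
    ℝ → ℝ :=
  Function.invFunOn (affineParameter ξ κ x) (flowInterval ξ x)

variable [IsManifold 𝓘(ℝ, F) ∞ L] [T2Space L] [FiniteDimensional ℝ F]
  {ξ : ∀ x : L, TangentSpace 𝓘(ℝ, F) x} {κ : L → ℝ}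

theorem affineInverse_mem {x : L} {s : ℝ} (hs : s ∈ affineInterval ξ κ x) :
    affineInverse ξ κ x s ∈ flowInterval ξ x :=
  Function.invFunOn_mem hs

theorem affineParameter_affineInverse {x : L} {s : ℝ} (hs : s ∈ affineInterval ξ κ x) :
    affineParameter ξ κ x (affineInverse ξ κ x s) = s :=
  Function.invFunOn_eq hs

theorem continuousOn_affineParameter (hξ : SmoothField ξ) (hκ : Continuous κ) (x : L) :
    ContinuousOn (affineParameter ξ κ x) (flowInterval ξ x) := fun _ ht ↦
  (hasDerivAt_affineParameter hξ hκ ht).continuousAt.continuousWithinAt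

theorem strictMonoOn_affineParameter (hξ : SmoothField ξ) (hκ : Continuous κ) (x : L) :
    StrictMonoOn (affineParameter ξ κ x) (flowInterval ξ x) := by
  refine strictMonoOn_of_deriv_pos (ordConnected_flowInterval hξ x).convex
    (continuousOn_affineParameter hξ hκ x) fun t ht ↦ ?_
  rw [(hasDerivAt_affineParameter hξ hκ (interior_subset ht)).deriv]
  positivity

theorem affineInverse_affineParameter (hξ : SmoothField ξ) (hκ : Continuous κ) {x : L} {t : ℝ}
    (ht : t ∈ flowInterval ξ x) : affineInverse ξ κ x (affineParameter ξ κ x t) = t :=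
  (strictMonoOn_affineParameter hξ hκ x).injOn (affineInverse_mem ⟨t, ht, rfl⟩) ht
    (affineParameter_affineInverse ⟨t, ht, rfl⟩)

theorem zero_mem_affineInterval (hξ : SmoothField ξ) (x : L) : 0 ∈ affineInterval ξ κ x :=
  ⟨0, zero_mem_flowInterval hξ x, affineParameter_zero x⟩

theorem affineInverse_zero (hξ : SmoothField ξ) (hκ : Continuous κ) (x : L) :
    affineInverse ξ κ x 0 = 0 := by
  have h := affineInverse_affineParameter hξ hκ (zero_mem_flowInterval hξ x)
  rwa [affineParameter_zero] at h

theorem ordConnected_affineInterval (hξ : SmoothField ξ) (hκ : Continuous κ) (x : L) :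
    (affineInterval ξ κ x).OrdConnected :=
  ((ordConnected_flowInterval hξ x).isPreconnected.image _
    (continuousOn_affineParameter hξ hκ x)).ordConnected

theorem isOpen_affineInterval (hξ : SmoothField ξ) (hκ : Continuous κ) (x : L) :
    IsOpen (affineInterval ξ κ x) := by
  refine isOpen_iff_mem_nhds.2 ?_
  rintro _ ⟨t, ht, rfl⟩
  obtain ⟨ε, hε, h⟩ := Metric.nhds_basis_closedBall.mem_iff.1
    ((isOpen_flowInterval hξ x).mem_nhds ht)
  rw [Real.closedBall_eq_Icc] at h
  have h1 : t - ε ∈ flowInterval ξ x := h ⟨le_rfl, by linarith⟩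
  have h2 : t + ε ∈ flowInterval ξ x := h ⟨by linarith, le_rfl⟩
  have hm := strictMonoOn_affineParameter hξ hκ x
  refine Filter.mem_of_superset (Icc_mem_nhds (hm h1 ht (by linarith)) (hm ht h2 (by linarith))) ?_
  exact (intermediate_value_Icc (by linarith)
    ((continuousOn_affineParameter hξ hκ x).mono h)).trans (image_mono h)

theorem continuousAt_affineInverse (hξ : SmoothField ξ) (hκ : Continuous κ) {x : L} {s : ℝ}
    (hs : s ∈ affineInterval ξ κ x) : ContinuousAt (affineInverse ξ κ x) s := by
  have hm : StrictMonoOn (affineInverse ξ κ x) (affineInterval ξ κ x) := by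
    rintro _ ⟨a, ha, rfl⟩ _ ⟨b, hb, rfl⟩ hab
    rw [affineInverse_affineParameter hξ hκ ha, affineInverse_affineParameter hξ hκ hb]
    exact ((strictMonoOn_affineParameter hξ hκ x).lt_iff_lt ha hb).1 hab
  refine hm.continuousAt_of_image_mem_nhds ((isOpen_affineInterval hξ hκ x).mem_nhds hs) ?_
  refine Filter.mem_of_superset ((isOpen_flowInterval hξ x).mem_nhds (affineInverse_mem hs))
    fun t ht ↦ ⟨_, ⟨t, ht, rfl⟩, affineInverse_affineParameter hξ hκ ht⟩

theorem hasDerivAt_affineInverse (hξ : SmoothField ξ) (hκ : Continuous κ) {x : L} {s : ℝ}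
    (hs : s ∈ affineInterval ξ κ x) : HasDerivAt (affineInverse ξ κ x)
      (Real.exp (-flowIntegral ξ κ x (affineInverse ξ κ x s))) s := by
  rw [Real.exp_neg]
  refine HasDerivAt.of_local_left_inverse (continuousAt_affineInverse hξ hκ hs)
    (hasDerivAt_affineParameter hξ hκ (affineInverse_mem hs)) (Real.exp_pos _).ne' ?_
  filter_upwards [(isOpen_affineInterval hξ hκ x).mem_nhds hs] with r hr
    using affineParameter_affineInverse hr

theorem contDiffOn_of_hasDerivAt {f f' : ℝ → ℝ} {s : Set ℝ} (hs : IsOpen s)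
    (hf : ∀ t ∈ s, HasDerivAt f (f' t) t) (hf' : ContDiffOn ℝ ∞ f' s) : ContDiffOn ℝ ∞ f s := by
  rw [contDiffOn_infty_iff_deriv_of_isOpen hs]
  exact ⟨fun t ht ↦ (hf t ht).differentiableAt.differentiableWithinAt,
    hf'.congr fun t ht ↦ (hf t ht).deriv⟩

theorem contMDiffOn_flow (hξ : SmoothField ξ) (x : L) :
    ContMDiffOn 𝓘(ℝ, ℝ) 𝓘(ℝ, F) ∞ (flow ξ x) (flowInterval ξ x) :=
  contMDiffOn_integralCurve hξ (isOpen_flowInterval hξ x) fun _ ht ↦ hasMFDerivAt_flow hξ ht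

theorem contDiffOn_flowIntegral (hξ : SmoothField ξ) (hκ : ContMDiff 𝓘(ℝ, F) 𝓘(ℝ, ℝ) ∞ κ) (x : L) :
    ContDiffOn ℝ ∞ (flowIntegral ξ κ x) (flowInterval ξ x) :=
  contDiffOn_of_hasDerivAt (isOpen_flowInterval hξ x)
    (fun _ ht ↦ hasDerivAt_flowIntegral hξ hκ.continuous ht)
    (hκ.comp_contMDiffOn (contMDiffOn_flow hξ x)).contDiffOn

/-- The inverse `T` solves the autonomous equation `T' = exp(-K(x, T))`. -/
theorem contDiffOn_affineInverse (hξ : SmoothField ξ) (hκ : ContMDiff 𝓘(ℝ, F) 𝓘(ℝ, ℝ) ∞ κ)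
    (x : L) : ContDiffOn ℝ ∞ (affineInverse ξ κ x) (affineInterval ξ κ x) :=
  contDiffOn_of_hasDerivAt_comp (v := fun t ↦ Real.exp (-flowIntegral ξ κ x t))
    (contDiffOn_flowIntegral hξ hκ x).neg.exp (isOpen_affineInterval hξ hκ.continuous x)
    (fun _ hs ↦ hasDerivAt_affineInverse hξ hκ.continuous hs) fun _ hs ↦ affineInverse_mem hs

/-- Moving the base point along the generator changes the affine parameter by a translation and a
positive factor, as expressed by `affineParameter_add`. -/
theorem image_affineInterval_flow (hξ : SmoothField ξ) (hκ : Continuous κ) {x : L} {t : ℝ}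
    (ht : t ∈ flowInterval ξ x) :
    (fun a ↦ affineParameter ξ κ x t + Real.exp (flowIntegral ξ κ x t) * a) ''
      affineInterval ξ κ (flow ξ x t) = affineInterval ξ κ x := by
  ext s
  constructor
  · rintro ⟨_, ⟨τ, hτ, rfl⟩, rfl⟩
    have h := (mem_flowInterval_flow_iff hξ ht τ).1 hτ
    exact ⟨t + τ, h, affineParameter_add hξ hκ ht h⟩
  · rintro ⟨r, hr, rfl⟩
    have h : t + (r - t) ∈ flowInterval ξ x := by rwa [add_sub_cancel]
    refine ⟨_, ⟨r - t, (mem_flowInterval_flow_iff hξ ht _).2 h, rfl⟩, ?_⟩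
    have h2 := affineParameter_add hξ hκ ht h
    rw [add_sub_cancel] at h2
    exact h2.symm

end AffineInterval

/-! ### Generators as geodesics, and geodesics that stay in the hypersurface. -/

section AffineGeodesics

variable {E : Type*} [NormedAddCommGroup E] [NormedSpace ℝ E] [FiniteDimensional ℝ E]
  {M : Type*} [TopologicalSpace M] [ChartedSpace E M] [IsManifold 𝓘(ℝ, E) ∞ M]
  {F : Type*} [NormedAddCommGroup F] [NormedSpace ℝ F] [FiniteDimensional ℝ F]
  {L : Type*} [TopologicalSpace L] [ChartedSpace F L] [IsManifold 𝓘(ℝ, F) ∞ L] [T2Space L]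

theorem velocity_congr {β₁ β₂ : ℝ → M} {t : ℝ} (h : β₁ =ᶠ[𝓝 t] β₂) :
    velocity (E := E) β₁ t = velocity β₂ t :=
  DFunLike.congr_fun (h.mfderiv_eq (I := 𝓘(ℝ, ℝ)) (I' := 𝓘(ℝ, E))) (1 : ℝ)

/-- The affinely parametrized null generator through `x`, with initial velocity `ξ x`. -/
noncomputable def affineGenerator (g : LorentzianMetric E M) (i : L → M)
    (ξ : ∀ x : L, TangentSpace 𝓘(ℝ, F) x) (x : L) : ℝ → M :=
  (i ∘ flow ξ x) ∘ affineInverse ξ (g.surfaceGravity i ξ) x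

variable {g : LorentzianMetric E M} {i : L → M} {ξ : ∀ x : L, TangentSpace 𝓘(ℝ, F) x}

namespace IsNullSection

theorem smoothField (h : IsNullSection g i ξ) : SmoothField ξ := h.smooth

theorem continuous_surfaceGravity (h : IsNullSection g i ξ) :
    Continuous (g.surfaceGravity i ξ) := h.contMDiff_surfaceGravity.continuous

theorem injective (h : IsNullSection g i ξ) : Function.Injective i :=
  h.hypersurface.isSmoothEmbedding.isEmbedding.injective

theorem contMDiffAt_flow (h : IsNullSection g i ξ) {x : L} {t : ℝ} (ht : t ∈ flowInterval ξ x) :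
    ContMDiffAt 𝓘(ℝ, ℝ) 𝓘(ℝ, F) ∞ (flow ξ x) t :=
  (contMDiffOn_flow h.smoothField x).contMDiffAt ((isOpen_flowInterval h.smoothField x).mem_nhds ht)

theorem velocity_affineGenerator (h : IsNullSection g i ξ) {x : L} {s : ℝ}
    (hs : s ∈ affineInterval ξ (g.surfaceGravity i ξ) x) :
    velocity (E := E) (affineGenerator g i ξ x) s
      = Real.exp (-flowIntegral ξ (g.surfaceGravity i ξ) x
          (affineInverse ξ (g.surfaceGravity i ξ) x s)) •
        push E i ξ (flow ξ x (affineInverse ξ (g.surfaceGravity i ξ) x s)) := by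
  have ht := affineInverse_mem hs
  rw [affineGenerator, velocity_comp
    ((h.hypersurface.contMDiff.contMDiffAt.comp _ (h.contMDiffAt_flow ht)).mdifferentiableAt
      (by simp)) (hasDerivAt_affineInverse h.smoothField h.continuous_surfaceGravity hs),
    velocity_comp_integralCurve h.hypersurface.contMDiff (hasMFDerivAt_flow h.smoothField ht)]

theorem affineGenerator_zero (h : IsNullSection g i ξ) (x : L) :
    affineGenerator g i ξ x 0 = i x := by
  simp only [affineGenerator, Function.comp_apply,
    affineInverse_zero h.smoothField h.continuous_surfaceGravity, flow_zero h.smoothField]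

theorem velocity_affineGenerator_zero (h : IsNullSection g i ξ) (x : L) :
    velocity (E := E) (affineGenerator g i ξ x) 0 = push E i ξ x := by
  rw [h.velocity_affineGenerator (zero_mem_affineInterval h.smoothField x),
    affineInverse_zero h.smoothField h.continuous_surfaceGravity, flow_zero h.smoothField,
    flowIntegral_zero, neg_zero, Real.exp_zero, one_smul]

/-- The inverse parameter satisfies `T' = exp(-K)` and `T'' = -κ T'²`, so the second order term of
the reparametrization cancels the acceleration `κ T'²` of the integral curve. -/
theorem isGeodesicOn_affineGenerator (h : IsNullSection g i ξ) (x : L) :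
    g.IsGeodesicOn (affineGenerator g i ξ x) (affineInterval ξ (g.surfaceGravity i ξ) x) := by
  set κ := g.surfaceGravity i ξ with hκ
  set T := affineInverse ξ κ x with hT
  have hJ := isOpen_affineInterval h.smoothField h.continuous_surfaceGravity x
  have hsT := contDiffOn_affineInverse h.smoothField h.contMDiff_surfaceGravity x
  refine ⟨((h.hypersurface.contMDiff.comp_contMDiffOn (contMDiffOn_flow h.smoothField x))).comp
    hsT.contMDiffOn fun s hs ↦ affineInverse_mem hs, fun s hs ↦ ?_⟩
  have ht : T s ∈ flowInterval ξ x := affineInverse_mem hs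
  have h1 : g.acceleration (i ∘ flow ξ x) (T s) = κ (flow ξ x (T s)) • push E i ξ (flow ξ x (T s)) :=
    (g.acceleration_comp_integralCurve h.hypersurface.contMDiff h.smooth
      ((isMIntegralCurveOn_flow h.smoothField x).isMIntegralCurveAt
        ((isOpen_flowInterval h.smoothField x).mem_nhds ht)) (h.contMDiffAt_flow ht)).trans
      (h.pushAccel_eq _)
  have h2 := g.acceleration_comp (β := i ∘ flow ξ x) (T := T) (t := s)
    (h.hypersurface.contMDiff.contMDiffAt.comp _ (h.contMDiffAt_flow ht))
    (hsT.contDiffAt (hJ.mem_nhds hs))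
  have hd : ∀ r ∈ affineInterval ξ κ x, HasDerivAt T (Real.exp (-flowIntegral ξ κ x (T r))) r :=
    fun r hr ↦ hasDerivAt_affineInverse h.smoothField h.continuous_surfaceGravity hr
  have hd1 : deriv T =ᶠ[𝓝 s] fun r ↦ Real.exp (-flowIntegral ξ κ x (T r)) := by
    filter_upwards [hJ.mem_nhds hs] with r hr using (hd r hr).deriv
  have hd2 : HasDerivAt (fun r ↦ Real.exp (-flowIntegral ξ κ x (T r)))
      (Real.exp (-flowIntegral ξ κ x (T s)) *
        -(κ (flow ξ x (T s)) * Real.exp (-flowIntegral ξ κ x (T s)))) s :=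
    (((hasDerivAt_flowIntegral h.smoothField h.continuous_surfaceGravity ht).comp s
      (hd s hs)).neg).exp
  rw [h1, hd1.deriv_eq, hd2.deriv, (hd s hs).deriv,
    velocity_comp_integralCurve h.hypersurface.contMDiff (hasMFDerivAt_flow h.smoothField ht),
    smul_smul, ← add_smul] at h2
  refine Eq.trans h2 ?_
  rw [show (Real.exp (-flowIntegral ξ κ x (T s)) ^ 2 * κ (flow ξ x (T s)) +
    Real.exp (-flowIntegral ξ κ x (T s)) *
        -(κ (flow ξ x (T s)) * Real.exp (-flowIntegral ξ κ x (T s)))) = 0 by ring, zero_smul]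
  rfl

variable [T2Space M]

theorem exp_scaledVector (h : IsNullSection g i ξ) {x : L} {s : ℝ}
    (hs : s ∈ affineInterval ξ (g.surfaceGravity i ξ) x) :
    scaledVector E i ξ x s ∈ g.expDomain ∧
      g.exp (scaledVector E i ξ x s)
        = i (flow ξ x (affineInverse ξ (g.surfaceGravity i ξ) x s)) :=
  (h.isGeodesicOn_affineGenerator x).exp_smul
    (isOpen_affineInterval h.smoothField h.continuous_surfaceGravity x)
    (ordConnected_affineInterval h.smoothField h.continuous_surfaceGravity x)
    (zero_mem_affineInterval h.smoothField x) hs (h.affineGenerator_zero x)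
    (h.velocity_affineGenerator_zero x)

theorem mem_affineDomain (h : IsNullSection g i ξ) {x : L} {s : ℝ}
    (hs : s ∈ affineInterval ξ (g.surfaceGravity i ξ) x) : (x, s) ∈ g.affineDomain i ξ :=
  ⟨(h.exp_scaledVector hs).1, _, (h.exp_scaledVector hs).2.symm⟩

theorem affineFlow_eq (h : IsNullSection g i ξ) {x : L} {s : ℝ}
    (hs : s ∈ affineInterval ξ (g.surfaceGravity i ξ) x) :
    g.affineFlow i ξ x s = flow ξ x (affineInverse ξ (g.surfaceGravity i ξ) x s) := by
  have h1 : ∃ y : L, i y = g.exp (scaledVector E i ξ x s) := ⟨_, (h.exp_scaledVector hs).2.symm⟩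
  rw [LorentzianMetric.affineFlow, dif_pos h1]
  exact h.injective (h1.choose_spec.trans (h.exp_scaledVector hs).2)

/-- A geodesic that starts out along a generator and stays in the hypersurface up to an endpoint of
the affine parameter interval of the generator can only do so if the endpoint is attained. -/
theorem mem_affineInterval_of_mem_closure (h : IsNullSection g i ξ) {x : L} {β : ℝ → M}
    {J' : Set ℝ} (hβ : g.IsGeodesicOn β J') (hJ' : IsOpen J') (hJc' : J'.OrdConnected)
    (h0 : 0 ∈ J') (hβ0 : β 0 = i x) (hβv : velocity (E := E) β 0 = push E i ξ x) {u₀ : ℝ}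
    (hu₀ : u₀ ∈ closure (affineInterval ξ (g.surfaceGravity i ξ) x)) (hu₀' : u₀ ∈ J') {y : L}
    (hy : i y = β u₀) : u₀ ∈ affineInterval ξ (g.surfaceGravity i ξ) x := by
  set κ := g.surfaceGravity i ξ with hκ
  set J := affineInterval ξ κ x with hJdef
  set T := affineInverse ξ κ x with hT
  have hi := h.hypersurface.contMDiff
  have hξ := h.smoothField
  have hκc : Continuous κ := h.continuous_surfaceGravity
  have hJ : IsOpen J := isOpen_affineInterval hξ hκc x
  have hJc : J.OrdConnected := ordConnected_affineInterval hξ hκc x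
  have hgen := h.isGeodesicOn_affineGenerator x
  have heq : EqOn β (affineGenerator g i ξ x) (J' ∩ J) :=
    (hβ.mono inter_subset_left).eqOn (hgen.mono inter_subset_right) (hJ'.inter hJ)
      (hJc'.inter hJc).isPreconnected ⟨h0, zero_mem_affineInterval hξ x⟩
      (hβ0.trans (h.affineGenerator_zero x).symm)
      (hβv.trans (h.velocity_affineGenerator_zero x).symm)
  set l := 𝓝[J] u₀ with hl
  have : l.NeBot := mem_closure_iff_nhdsWithin_neBot.1 hu₀
  have hlJ : ∀ᶠ u in l, u ∈ J' ∩ J := by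
    filter_upwards [self_mem_nhdsWithin, nhdsWithin_le_nhds (hJ'.mem_nhds hu₀')] with u hu hu'
      using ⟨hu', hu⟩
  let z : ℝ → L := fun u ↦ flow ξ x (T u)
  have hβz : ∀ u ∈ J' ∩ J, β u = i (z u) := fun u hu ↦ heq hu
  have hβc : Filter.Tendsto β l (𝓝 (i y)) := by
    rw [hy]
    exact (hβ.contMDiffAt hJ' hu₀').continuousAt.mono_left nhdsWithin_le_nhds
  -- This is where the embedding is used: convergence in spacetime to a point of `L` gives
  -- convergence in the topology of `L`.
  have hz : Filter.Tendsto z l (𝓝 y) := by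
    rw [h.hypersurface.isSmoothEmbedding.isEmbedding.isInducing.tendsto_nhds_iff]
    exact hβc.congr' (hlJ.mono fun u hu ↦ hβz u hu)
  set lam : ℝ → ℝ := fun u ↦ Real.exp (-flowIntegral ξ κ x (T u)) with hlam
  have hvel : ∀ u ∈ J' ∩ J, velocity (E := E) β u = lam u • push E i ξ (z u) := fun u hu ↦
    (velocity_congr (heq.eventuallyEq_of_mem ((hJ'.inter hJ).mem_nhds hu))).trans
      (h.velocity_affineGenerator hu.2)
  set V : L → E := fun q ↦ coordPush i ξ y (i y) (extChartAt 𝓘(ℝ, F) y q) with hV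
  set c : ℝ → E := extChartAt 𝓘(ℝ, E) (i y) ∘ β with hc
  have hVy : V y = push E i ξ y := coordPush_self hi y
  have hVc : ContinuousAt V y :=
    ContinuousAt.comp (g := coordPush i ξ y (i y)) (contDiffAt_coordPush hi h.smooth
      (mem_chart_source F y) (mem_chart_source E (i y))).continuousAt (continuousAt_extChartAt y)
  have hcs : ContDiffAt ℝ ∞ c u₀ :=
    contDiffAt_extChartAt_comp (hβ.contMDiffAt hJ' hu₀') (hy ▸ mem_chart_source E (i y))
  have hc' : ∀ᶠ u in l, deriv c u = lam u • V (z u) := by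
    filter_upwards [hlJ, hβc.eventually_mem ((chartAt E (i y)).open_source.mem_nhds
      (mem_chart_source E (i y))), hz.eventually_mem ((chartAt F y).open_source.mem_nhds
      (mem_chart_source F y))] with u hu hu1 hu2
    have h1 : deriv c u = tangentCoordChange 𝓘(ℝ, E) (β u) (i y) (β u) (velocity (E := E) β u) :=
      deriv_extChartAt_comp ((hβ.contMDiffAt hJ' hu.1).mdifferentiableAt (by simp)) hu1
    rw [hβz u hu] at hu1
    rw [h1, hvel u hu, hβz u hu, map_smul]
    exact congrArg (fun w : E ↦ lam u • w) (tangentCoordChange_pushSection hi hu2 hu1)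
  have hdc : Filter.Tendsto (deriv c) l (𝓝 (deriv c u₀)) :=
    hcs.deriv_infty.continuousAt.mono_left nhdsWithin_le_nhds
  have hVz : Filter.Tendsto (fun u ↦ V (z u)) l (𝓝 (V y)) := hVc.tendsto.comp hz
  -- A functional that equals `1` on `ξ_y` reads off the factors `lam u`, which thus converge; the
  -- limiting velocity is the limiting factor times `ξ_y`.
  obtain ⟨f, hf⟩ := SeparatingDual.exists_eq_one (R := ℝ) (hVy.symm ▸ h.push_ne_zero y : V y ≠ 0)
  have hfV : Filter.Tendsto (fun u ↦ f (V (z u))) l (𝓝 1) := by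
    rw [← hf]
    exact (f.continuous.tendsto _).comp hVz
  set lam₀ : ℝ := f (deriv c u₀) with hlam₀
  have hlamt : Filter.Tendsto lam l (𝓝 lam₀) := by
    have h1 : Filter.Tendsto (fun u ↦ f (deriv c u) / f (V (z u))) l (𝓝 (lam₀ / 1)) :=
      ((f.continuous.tendsto _).comp hdc).div hfV one_ne_zero
    rw [div_one] at h1
    refine h1.congr' ?_
    filter_upwards [hc', hfV.eventually_ne one_ne_zero] with u hu hu'
    rw [hu, map_smul, smul_eq_mul, mul_div_cancel_right₀ _ hu']
  have hcu₀ : deriv c u₀ = lam₀ • push E i ξ y := by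
    rw [← hVy]
    exact tendsto_nhds_unique (hdc.congr' hc') (hlamt.smul hVz)
  have hvelu₀ : velocity (E := E) β u₀ = lam₀ • push E i ξ y := by
    rw [velocity_eq_deriv ((hβ.contMDiffAt hJ' hu₀').mdifferentiableAt (by simp)), ← hy]
    exact hcu₀
  have hJy : IsOpen (affineInterval ξ κ y) := isOpen_affineInterval hξ hκc y
  have hgeny := h.isGeodesicOn_affineGenerator y
  -- The generator of `y` is reparametrized so as to pass through `y` at `u₀` with velocity `lam₀
  -- ξ_y`. The construction makes sense without knowing that `lam₀ ≠ 0`.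
  set δ : ℝ → M := affineGenerator g i ξ y ∘ fun u ↦ lam₀ * u + -(lam₀ * u₀) with hδ
  have hδgeo := hgeny.comp_mul_add hJy lam₀ (-(lam₀ * u₀))
  have hJδ : IsOpen ((fun u ↦ lam₀ * u + -(lam₀ * u₀)) ⁻¹' affineInterval ξ κ y) :=
    hJy.preimage (by fun_prop)
  have hu₀δ : u₀ ∈ (fun u ↦ lam₀ * u + -(lam₀ * u₀)) ⁻¹' affineInterval ξ κ y := by
    rw [mem_preimage, add_neg_cancel]
    exact zero_mem_affineInterval hξ y
  have hδv : ∀ u ∈ (fun u ↦ lam₀ * u + -(lam₀ * u₀)) ⁻¹' affineInterval ξ κ y,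
      velocity (E := E) δ u
        = lam₀ • velocity (E := E) (affineGenerator g i ξ y) (lam₀ * u + -(lam₀ * u₀)) :=
    fun u hu ↦ hgeny.velocity_comp_mul_add hJy _ _ hu
  have hβδ : β =ᶠ[𝓝 u₀] δ := by
    refine hβ.eventuallyEq_of_velocity_eq hδgeo hJ' hJδ hu₀' hu₀δ ?_ ?_
    · change β u₀ = affineGenerator g i ξ y (lam₀ * u₀ + -(lam₀ * u₀))
      rw [add_neg_cancel, h.affineGenerator_zero, hy]
    · rw [hvelu₀]
      refine Eq.trans ?_ (hδv u₀ hu₀δ).symm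
      rw [add_neg_cancel, h.velocity_affineGenerator_zero]
  -- At a parameter `u` in the interval, close to `u₀`, the generators of `x` and of `y` meet at `z
  -- u = flow ξ y τ`. So `y` lies on the integral curve of `x`, at time `T u - τ`; it remains to see
  -- that its affine parameter is `u₀`.
  obtain ⟨u, huJ, huδ, hu⟩ := (hlJ.and (nhdsWithin_le_nhds
    ((hJδ.mem_nhds hu₀δ |> fun h' ↦ Filter.Eventually.and h' hβδ.eventuallyEq_nhds)))).exists
  set σ := lam₀ * u + -(lam₀ * u₀) with hσ
  set τ := affineInverse ξ κ y σ with hτ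
  have hσJ : σ ∈ affineInterval ξ κ y := huδ
  have hτI : τ ∈ flowInterval ξ y := affineInverse_mem hσJ
  have hSτ : affineParameter ξ κ y τ = σ := affineParameter_affineInverse hσJ
  have hzu : z u = flow ξ y τ := h.injective ((hβz u huJ).symm.trans hu.self_of_nhds)
  have hlamu : lam u = lam₀ * Real.exp (-flowIntegral ξ κ y τ) := by
    have h1 := (hvel u huJ).symm.trans ((velocity_congr hu).trans (hδv u huδ))
    rw [h.velocity_affineGenerator hσJ, smul_smul, hzu] at h1
    exact smul_left_injective ℝ (h.push_ne_zero _) h1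
  have hTu : T u ∈ flowInterval ξ x := affineInverse_mem huJ.2
  have hneg : -τ ∈ flowInterval ξ (flow ξ x (T u)) := by
    have := neg_mem_flowInterval_flow hξ hτI
    rwa [← hzu] at this
  have hmem := (mem_flowInterval_flow_iff hξ hTu (-τ)).1 hneg
  refine ⟨T u + -τ, hmem, ?_⟩
  rw [affineParameter_add hξ hκc hTu hmem, affineParameter_affineInverse huJ.2]
  have h2 := affineParameter_add hξ hκc hτI (τ := -τ)
    (by rw [add_neg_cancel]; exact zero_mem_flowInterval hξ y)
  rw [add_neg_cancel, affineParameter_zero, hSτ, ← hzu] at h2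
  have h3 : affineParameter ξ κ (flow ξ x (T u)) (-τ)
      = -(Real.exp (-flowIntegral ξ κ y τ) * σ) := by
    have h4 : Real.exp (-flowIntegral ξ κ y τ) * Real.exp (flowIntegral ξ κ y τ) = 1 := by
      rw [← Real.exp_add, neg_add_cancel, Real.exp_zero]
    have h5 : Real.exp (flowIntegral ξ κ y τ) * affineParameter ξ κ (z u) (-τ) = -σ := by linarith
    calc affineParameter ξ κ (z u) (-τ)
        = (Real.exp (-flowIntegral ξ κ y τ) * Real.exp (flowIntegral ξ κ y τ))
          * affineParameter ξ κ (z u) (-τ) := by rw [h4, one_mul]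
      _ = -(Real.exp (-flowIntegral ξ κ y τ) * σ) := by rw [mul_assoc, h5]; ring
  have h6 : Real.exp (flowIntegral ξ κ x (T u)) * lam u = 1 := by
    rw [hlam, ← Real.exp_add, add_neg_cancel, Real.exp_zero]
  rw [h3]
  have h7 : Real.exp (-flowIntegral ξ κ y τ) * σ = lam u * (u - u₀) := by
    rw [hlamu, hσ]
    ring
  rw [h7]
  linear_combination (-(u - u₀)) * h6

/-- Within the segment from `0` to `s` the affine interval is open, nonempty and, by
`mem_affineInterval_of_mem_closure`, closed, so it contains the whole segment. -/
theorem mem_affineInterval_of_uIcc_subset (h : IsNullSection g i ξ) {x : L} {s : ℝ}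
    (hs : ∀ u ∈ uIcc 0 s, (x, u) ∈ g.affineDomain i ξ) :
    s ∈ affineInterval ξ (g.surfaceGravity i ξ) x := by
  rcases eq_or_ne s 0 with rfl | hs0
  · exact zero_mem_affineInterval h.smoothField x
  obtain ⟨β, J', hβ, hJ', hJc', h0, hs', hβ0, hβv⟩ :=
    LorentzianMetric.exists_isGeodesicOn_of_mem_expDomain hs0 (hs s right_mem_uIcc).1
  have hsub : uIcc 0 s ⊆ J' := hJc'.uIcc_subset h0 hs'
  have key : uIcc 0 s ⊆ affineInterval ξ (g.surfaceGravity i ξ) x := by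
    refine isPreconnected_uIcc.subset_of_closure_inter_subset
      (isOpen_affineInterval h.smoothField h.continuous_surfaceGravity x)
      ⟨0, left_mem_uIcc, zero_mem_affineInterval h.smoothField x⟩ ?_
    rintro u ⟨hu, hu'⟩
    obtain ⟨y, hy⟩ := (hs u hu').2
    refine h.mem_affineInterval_of_mem_closure hβ hJ' hJc' h0 hβ0 hβv hu (hsub hu') (y := y) ?_
    rw [hy]
    exact (hβ.exp_smul hJ' hJc' h0 (hsub hu') hβ0 hβv).2
  exact key right_mem_uIcc

end IsNullSection

end AffineGeodesics

/-! ### Suprema and infima in the extended reals. -/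

section ExtendedReals

theorem isLUB_coe_image_iff {S : Set ℝ} (hS : S.Nonempty) {r : ℝ} :
    IsLUB ((fun s : ℝ ↦ (s : EReal)) '' S) (r : EReal) ↔ IsLUB S r := by
  constructor
  · refine fun h ↦ ⟨fun s hs ↦ EReal.coe_le_coe_iff.1 (h.1 ⟨s, hs, rfl⟩), fun b hb ↦ ?_⟩
    refine EReal.coe_le_coe_iff.1 (h.2 ?_)
    rintro _ ⟨s, hs, rfl⟩
    exact EReal.coe_le_coe_iff.2 (hb hs)
  · refine fun h ↦ ⟨?_, fun b hb ↦ ?_⟩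
    · rintro _ ⟨s, hs, rfl⟩
      exact EReal.coe_le_coe_iff.2 (h.1 hs)
    · obtain ⟨s, hs⟩ := hS
      induction b with
      | bot => exact absurd (hb ⟨s, hs, rfl⟩) (by simp)
      | top => exact le_top
      | coe b =>
        exact EReal.coe_le_coe_iff.2 (h.2 fun u hu ↦ EReal.coe_le_coe_iff.1 (hb ⟨u, hu, rfl⟩))

theorem isGLB_coe_image_iff {S : Set ℝ} (hS : S.Nonempty) {r : ℝ} :
    IsGLB ((fun s : ℝ ↦ (s : EReal)) '' S) (r : EReal) ↔ IsGLB S r := by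
  constructor
  · refine fun h ↦ ⟨fun s hs ↦ EReal.coe_le_coe_iff.1 (h.1 ⟨s, hs, rfl⟩), fun b hb ↦ ?_⟩
    refine EReal.coe_le_coe_iff.1 (h.2 ?_)
    rintro _ ⟨s, hs, rfl⟩
    exact EReal.coe_le_coe_iff.2 (hb hs)
  · refine fun h ↦ ⟨?_, fun b hb ↦ ?_⟩
    · rintro _ ⟨s, hs, rfl⟩
      exact EReal.coe_le_coe_iff.2 (h.1 hs)
    · obtain ⟨s, hs⟩ := hS
      induction b with
      | bot => exact bot_le
      | top => exact absurd (hb ⟨s, hs, rfl⟩) (by simp)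
      | coe b =>
        exact EReal.coe_le_coe_iff.2 (h.2 fun u hu ↦ EReal.coe_le_coe_iff.1 (hb ⟨u, hu, rfl⟩))

/-- The property `P` may recur beyond `J`, as when a geodesic leaves the hypersurface and returns.
Hence `J` is compared only with segments `[0, s]` on which `P` holds throughout. -/
theorem isLUB_sSup_of_isOpen {J : Set ℝ} (hJ : IsOpen J) (hc : J.OrdConnected) (h0 : 0 ∈ J)
    {P : ℝ → Prop} (h1 : ∀ s ∈ J, P s) (h2 : ∀ s, 0 ≤ s → (∀ u ∈ Icc 0 s, P u) → s ∈ J) :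
    IsLUB ((fun s : ℝ ↦ (s : EReal)) '' J)
      (sSup {r : EReal | ∃ s : ℝ, r = s ∧ 0 < s ∧ ∀ u ∈ Ico 0 s, P u}) := by
  constructor
  · rintro _ ⟨s, hs, rfl⟩
    obtain ⟨a, b, ha, hb, hab⟩ := exists_Ioo_subset hJ hc h0 h0
    -- The supremum admits only positive bounds, so `s` is enlarged to a positive element of `J`.
    have hb2 : b / 2 ∈ J := hab ⟨by linarith, by linarith⟩
    have hm : max s (b / 2) ∈ J := by
      rcases max_choice s (b / 2) with h | h <;> rw [h] <;> assumption
    refine le_trans (EReal.coe_le_coe_iff.2 (le_max_left s (b / 2))) (le_sSup ?_)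
    exact ⟨_, rfl, lt_max_of_lt_right (by linarith),
      fun u hu ↦ h1 u (hc.out h0 hm ⟨hu.1, hu.2.le⟩)⟩
  · intro b hb
    refine sSup_le ?_
    rintro _ ⟨s, rfl, hs0, hs⟩
    refine le_of_forall_lt fun c hcs ↦ ?_
    obtain ⟨u, hcu, hus⟩ := EReal.lt_iff_exists_real_btwn.1 hcs
    -- Since `P` is known only on `[0, s)`, the approximating number is replaced by a nonnegative
    -- one.
    have hus' : max u 0 < s := max_lt (EReal.coe_lt_coe_iff.1 hus) hs0
    have hmem : max u 0 ∈ J := h2 _ (le_max_right _ _) fun r hr ↦ hs r ⟨hr.1, hr.2.trans_lt hus'⟩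
    exact hcu.trans_le ((EReal.coe_le_coe_iff.2 (le_max_left u 0)).trans (hb ⟨_, hmem, rfl⟩))

theorem isGLB_sInf_of_isOpen {J : Set ℝ} (hJ : IsOpen J) (hc : J.OrdConnected) (h0 : 0 ∈ J)
    {P : ℝ → Prop} (h1 : ∀ s ∈ J, P s) (h2 : ∀ s, s ≤ 0 → (∀ u ∈ Icc s 0, P u) → s ∈ J) :
    IsGLB ((fun s : ℝ ↦ (s : EReal)) '' J)
      (sInf {r : EReal | ∃ s : ℝ, r = s ∧ s < 0 ∧ ∀ u ∈ Ioc s 0, P u}) := by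
  constructor
  · rintro _ ⟨s, hs, rfl⟩
    obtain ⟨a, b, ha, hb, hab⟩ := exists_Ioo_subset hJ hc h0 h0
    have ha2 : a / 2 ∈ J := hab ⟨by linarith, by linarith⟩
    have hm : min s (a / 2) ∈ J := by
      rcases min_choice s (a / 2) with h | h <;> rw [h] <;> assumption
    refine le_trans (sInf_le ?_) (EReal.coe_le_coe_iff.2 (min_le_left s (a / 2)))
    exact ⟨_, rfl, min_lt_of_right_lt (by linarith),
      fun u hu ↦ h1 u (hc.out hm h0 ⟨hu.1.le, hu.2⟩)⟩
  · intro b hb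
    refine le_sInf ?_
    rintro _ ⟨s, rfl, hs0, hs⟩
    refine le_of_forall_gt fun c hcs ↦ ?_
    obtain ⟨u, hcu, hus⟩ := EReal.lt_iff_exists_real_btwn.1 hcs
    have hus' : s < min u 0 := lt_min (EReal.coe_lt_coe_iff.1 hcu) hs0
    have hmem : min u 0 ∈ J := h2 _ (min_le_right _ _) fun r hr ↦ hs r ⟨hus'.trans_le hr.1, hr.2⟩
    exact ((hb ⟨_, hmem, rfl⟩).trans (EReal.coe_le_coe_iff.2 (min_le_left u 0))).trans_lt hus

theorem IsLUB.add_mul_image {S : Set ℝ} {r a b : ℝ} (hr : IsLUB S r) (hb : 0 < b) :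
    IsLUB ((fun s ↦ a + b * s) '' S) (a + b * r) := by
  constructor
  · rintro _ ⟨s, hs, rfl⟩
    have := mul_le_mul_of_nonneg_left (hr.1 hs) hb.le
    simpa using this
  · intro c hc
    have h1 : r ≤ (c - a) / b := hr.2 fun s hs ↦ by
      rw [le_div_iff₀ hb]
      have h2 : a + b * s ≤ c := hc ⟨s, hs, rfl⟩
      linarith
    rw [le_div_iff₀ hb] at h1
    linarith

theorem IsGLB.add_mul_image {S : Set ℝ} {r a b : ℝ} (hr : IsGLB S r) (hb : 0 < b) :
    IsGLB ((fun s ↦ a + b * s) '' S) (a + b * r) := by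
  constructor
  · rintro _ ⟨s, hs, rfl⟩
    have := mul_le_mul_of_nonneg_left (hr.1 hs) hb.le
    simpa using this
  · intro c hc
    have h1 : (c - a) / b ≤ r := hr.2 fun s hs ↦ by
      rw [div_le_iff₀ hb]
      have h2 : c ≤ a + b * s := hc ⟨s, hs, rfl⟩
      linarith
    rw [div_le_iff₀ hb] at h1
    linarith

end ExtendedReals

/-! ### Affine lengths as endpoints of the affine interval, and their transport. -/

section AffineLength

variable {E : Type*} [NormedAddCommGroup E] [NormedSpace ℝ E] [FiniteDimensional ℝ E]
  {M : Type*} [TopologicalSpace M] [ChartedSpace E M] [IsManifold 𝓘(ℝ, E) ∞ M] [T2Space M]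
  {F : Type*} [NormedAddCommGroup F] [NormedSpace ℝ F] [FiniteDimensional ℝ F]
  {L : Type*} [TopologicalSpace L] [ChartedSpace F L] [IsManifold 𝓘(ℝ, F) ∞ L] [T2Space L]
  {g : LorentzianMetric E M} {i : L → M} {ξ : ∀ x : L, TangentSpace 𝓘(ℝ, F) x}

theorem isLUB_finalParameter (hξ : SmoothField ξ) (x : L) :
    IsLUB ((fun s : ℝ ↦ (s : EReal)) '' flowInterval ξ x) (finalParameter ξ univ x) :=
  isLUB_sSup_of_isOpen (isOpen_flowInterval hξ x) (ordConnected_flowInterval hξ x)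
    (zero_mem_flowInterval hξ x) (fun _ hs ↦ hs) fun s hs h ↦ h s ⟨hs, le_rfl⟩

namespace IsNullSection

theorem isLUB_futureAffineLength (h : IsNullSection g i ξ) (x : L) :
    IsLUB ((fun s : ℝ ↦ (s : EReal)) '' affineInterval ξ (g.surfaceGravity i ξ) x)
      (g.futureAffineLength i ξ x) :=
  isLUB_sSup_of_isOpen (isOpen_affineInterval h.smoothField h.continuous_surfaceGravity x)
    (ordConnected_affineInterval h.smoothField h.continuous_surfaceGravity x)
    (zero_mem_affineInterval h.smoothField x) (fun _ hs ↦ h.mem_affineDomain hs)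
    fun s hs hP ↦ h.mem_affineInterval_of_uIcc_subset (by rwa [uIcc_of_le hs])

theorem isGLB_pastAffineLength (h : IsNullSection g i ξ) (x : L) :
    IsGLB ((fun s : ℝ ↦ (s : EReal)) '' affineInterval ξ (g.surfaceGravity i ξ) x)
      (g.pastAffineLength i ξ x) :=
  isGLB_sInf_of_isOpen (isOpen_affineInterval h.smoothField h.continuous_surfaceGravity x)
    (ordConnected_affineInterval h.smoothField h.continuous_surfaceGravity x)
    (zero_mem_affineInterval h.smoothField x) (fun _ hs ↦ h.mem_affineDomain hs)
    fun s hs hP ↦ h.mem_affineInterval_of_uIcc_subset (by rwa [uIcc_of_ge hs])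

theorem nonempty_affineInterval (h : IsNullSection g i ξ) (x : L) :
    (affineInterval ξ (g.surfaceGravity i ξ) x).Nonempty :=
  ⟨0, zero_mem_affineInterval h.smoothField x⟩

theorem futureAffineLength_eq_coe_iff (h : IsNullSection g i ξ) {x : L} {r : ℝ} :
    g.futureAffineLength i ξ x = (r : EReal)
      ↔ IsLUB (affineInterval ξ (g.surfaceGravity i ξ) x) r := by
  rw [← isLUB_coe_image_iff (h.nonempty_affineInterval x)]
  exact ⟨fun h1 ↦ h1 ▸ h.isLUB_futureAffineLength x,
    fun h1 ↦ (h.isLUB_futureAffineLength x).unique h1⟩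

theorem pastAffineLength_eq_coe_iff (h : IsNullSection g i ξ) {x : L} {r : ℝ} :
    g.pastAffineLength i ξ x = (r : EReal)
      ↔ IsGLB (affineInterval ξ (g.surfaceGravity i ξ) x) r := by
  rw [← isGLB_coe_image_iff (h.nonempty_affineInterval x)]
  exact ⟨fun h1 ↦ h1 ▸ h.isGLB_pastAffineLength x,
    fun h1 ↦ (h.isGLB_pastAffineLength x).unique h1⟩

/-- The transport formula: the increasing affine map between the affine intervals at the two base
points carries one supremum to the other. In particular finiteness at `flow ξ x t` implies
finiteness at `x`. -/
theorem futureAffineLength_eq_of_flow (h : IsNullSection g i ξ) {x : L} {t r : ℝ}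
    (ht : t ∈ flowInterval ξ x) (hr : g.futureAffineLength i ξ (flow ξ x t) = (r : EReal)) :
    g.futureAffineLength i ξ x = ((affineParameter ξ (g.surfaceGravity i ξ) x t
      + Real.exp (flowIntegral ξ (g.surfaceGravity i ξ) x t) * r : ℝ) : EReal) := by
  rw [h.futureAffineLength_eq_coe_iff] at hr ⊢
  rw [← image_affineInterval_flow h.smoothField h.continuous_surfaceGravity ht]
  exact hr.add_mul_image (Real.exp_pos _)

theorem pastAffineLength_eq_of_flow (h : IsNullSection g i ξ) {x : L} {t r : ℝ}
    (ht : t ∈ flowInterval ξ x) (hr : g.pastAffineLength i ξ (flow ξ x t) = (r : EReal)) :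
    g.pastAffineLength i ξ x = ((affineParameter ξ (g.surfaceGravity i ξ) x t
      + Real.exp (flowIntegral ξ (g.surfaceGravity i ξ) x t) * r : ℝ) : EReal) := by
  rw [h.pastAffineLength_eq_coe_iff] at hr ⊢
  rw [← image_affineInterval_flow h.smoothField h.continuous_surfaceGravity ht]
  exact hr.add_mul_image (Real.exp_pos _)

theorem lt_of_isLUB (h : IsNullSection g i ξ) {x : L} {r s : ℝ}
    (hr : IsLUB (affineInterval ξ (g.surfaceGravity i ξ) x) r)
    (hs : s ∈ affineInterval ξ (g.surfaceGravity i ξ) x) : s < r := by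
  obtain ⟨a, b, ha, hb, hab⟩ := exists_Ioo_subset
    (isOpen_affineInterval h.smoothField h.continuous_surfaceGravity x)
    (ordConnected_affineInterval h.smoothField h.continuous_surfaceGravity x) hs hs
  have hm : (s + b) / 2 ∈ affineInterval ξ (g.surfaceGravity i ξ) x :=
    hab ⟨by linarith, by linarith⟩
  have := hr.1 hm
  linarith

theorem toReal_futureAffineLength_pos (h : IsNullSection g i ξ) {x : L}
    (hx : g.futureAffineLength i ξ x ≠ ⊤ ∧ g.futureAffineLength i ξ x ≠ ⊥) :
    0 < (g.futureAffineLength i ξ x).toReal :=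
  h.lt_of_isLUB (h.futureAffineLength_eq_coe_iff.1 (EReal.coe_toReal hx.1 hx.2).symm)
    (zero_mem_affineInterval h.smoothField x)

theorem toReal_pastAffineLength_nonpos (h : IsNullSection g i ξ) {x : L}
    (hx : g.pastAffineLength i ξ x ≠ ⊤ ∧ g.pastAffineLength i ξ x ≠ ⊥) :
    (g.pastAffineLength i ξ x).toReal ≤ 0 :=
  (h.pastAffineLength_eq_coe_iff.1 (EReal.coe_toReal hx.1 hx.2).symm).1
    (zero_mem_affineInterval h.smoothField x)

/-- With `t` fixed, the transport formula writes the length near `x` through functions that are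
smooth in the starting point. The sign of `t` is arbitrary, so regularity travels both ways along
generators. -/
theorem exists_finiteSmoothOn (h : IsNullSection g i ξ) {x : L} {t : ℝ}
    (ht : t ∈ flowInterval ξ x) {V : Set L} (hV : IsOpen V) (hxV : flow ξ x t ∈ V)
    (hfin : FiniteSmoothOn F (g.futureAffineLength i ξ) V) :
    ∃ U : Set L, IsOpen U ∧ x ∈ U ∧ FiniteSmoothOn F (g.futureAffineLength i ξ) U := by
  have h1 := eventually_flowSmoothAt h.smoothField h.contMDiff_surfaceGravity ht
  have h2 : ∀ᶠ y in 𝓝 x, flow ξ y t ∈ V :=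
    h1.self_of_nhds.flow.continuousAt.eventually_mem (hV.mem_nhds hxV)
  obtain ⟨U, hU, hUo, hxU⟩ := eventually_nhds_iff.1 (h1.and h2)
  have heq : ∀ y ∈ U, g.futureAffineLength i ξ y
      = ((affineParameter ξ (g.surfaceGravity i ξ) y t
        + Real.exp (flowIntegral ξ (g.surfaceGravity i ξ) y t)
          * (g.futureAffineLength i ξ (flow ξ y t)).toReal : ℝ) : EReal) := fun y hy ↦
    h.futureAffineLength_eq_of_flow (hU y hy).1.mem
      (EReal.coe_toReal (hfin.1 _ (hU y hy).2).1 (hfin.1 _ (hU y hy).2).2).symm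
  refine ⟨U, hUo, hxU, fun y hy ↦ ?_, ?_⟩
  · rw [heq y hy]
    exact ⟨EReal.coe_ne_top _, EReal.coe_ne_bot _⟩
  · have h3 : ContMDiffOn 𝓘(ℝ, F) 𝓘(ℝ, ℝ) ∞ (fun y ↦ affineParameter ξ (g.surfaceGravity i ξ) y t
        + Real.exp (flowIntegral ξ (g.surfaceGravity i ξ) y t)
          * (g.futureAffineLength i ξ (flow ξ y t)).toReal) U := by
      intro y hy
      obtain ⟨hys, hyV⟩ := hU y hy
      refine (hys.parameter.add (hys.integral.rexp.mul ?_)).contMDiffWithinAt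
      exact ContMDiffAt.comp (g := fun z ↦ (g.futureAffineLength i ξ z).toReal) y
        ((hfin.2 _ hyV).contMDiffAt (hV.mem_nhds hyV)) hys.flow
    refine h3.congr fun y hy ↦ ?_
    rw [heq y hy, EReal.toReal_coe]

/-- The left side of the transport formula does not depend on `t`. The derivative of the right side
at `t = 0` is `1 + κ f + ξ(f)`. A general `f` allows the use for both affine lengths. -/
theorem directionalDeriv_add_eq_zero (h : IsNullSection g i ξ) {f : L → ℝ} {x : L}
    (hf : MDifferentiableAt 𝓘(ℝ, F) 𝓘(ℝ, ℝ) f x)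
    (heq : ∀ᶠ t in 𝓝 (0 : ℝ), f x = affineParameter ξ (g.surfaceGravity i ξ) x t
      + Real.exp (flowIntegral ξ (g.surfaceGravity i ξ) x t) * f (flow ξ x t)) :
    directionalDeriv f x (ξ x) + g.surfaceGravity i ξ x * f x + 1 = 0 := by
  have h0 := zero_mem_flowInterval h.smoothField x
  have hx0 := flow_zero h.smoothField x
  have h1 := hasDerivAt_comp_integralCurve_real (h := f) (γ := flow ξ x) (t := 0)
    (hx0.symm ▸ hf) (hasMFDerivAt_flow h.smoothField h0)
  rw [hx0] at h1
  have h2 := hasDerivAt_affineParameter h.smoothField h.continuous_surfaceGravity h0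
  have h3 := hasDerivAt_flowIntegral h.smoothField h.continuous_surfaceGravity h0
  have h4 := h2.add (h3.exp.mul h1)
  have h5 := h4.unique ((hasDerivAt_const (0 : ℝ) (f x)).congr_of_eventuallyEq
    (heq.mono fun t ht ↦ ht.symm))
  simp only [flowIntegral_zero, Real.exp_zero, hx0, one_mul, Function.comp_apply] at h5
  linarith

end IsNullSection

end AffineLength

/-! ### Constant surface gravity: explicit affine parameters. -/

section ConstantSurfaceGravity

variable {F : Type*} [NormedAddCommGroup F] [NormedSpace ℝ F] [FiniteDimensional ℝ F]
  {L : Type*} [TopologicalSpace L] [ChartedSpace F L] [IsManifold 𝓘(ℝ, F) ∞ L] [T2Space L]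
  {ξ : ∀ x : L, TangentSpace 𝓘(ℝ, F) x} {κ : L → ℝ} {x : L} {c t : ℝ}

theorem flowIntegral_eq_mul (hξ : SmoothField ξ) (hκ : Continuous κ)
    (hc : ∀ u ∈ flowInterval ξ x, κ (flow ξ x u) = c) (ht : t ∈ flowInterval ξ x) :
    flowIntegral ξ κ x t = c * t :=
  primitive_eq (k := fun u ↦ c * u) (continuousOn_comp_flow hξ hκ x)
    (ordConnected_flowInterval hξ x) (zero_mem_flowInterval hξ x)
    (fun u hu ↦ by simpa [hc u hu] using (hasDerivAt_id u).const_mul c) (mul_zero c) ht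

theorem affineParameter_eq_self (hξ : SmoothField ξ) (hκ : Continuous κ)
    (hc : ∀ u ∈ flowInterval ξ x, κ (flow ξ x u) = 0) (ht : t ∈ flowInterval ξ x) :
    affineParameter ξ κ x t = t :=
  primitive_eq (k := fun u ↦ u) (continuousOn_exp_flowIntegral hξ hκ x)
    (ordConnected_flowInterval hξ x) (zero_mem_flowInterval hξ x)
    (fun u hu ↦ by
      rw [flowIntegral_eq_mul hξ hκ hc hu, zero_mul, Real.exp_zero]
      exact hasDerivAt_id u) rfl ht

theorem affineParameter_eq_exp (hξ : SmoothField ξ) (hκ : Continuous κ) (hc0 : c ≠ 0)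
    (hc : ∀ u ∈ flowInterval ξ x, κ (flow ξ x u) = c) (ht : t ∈ flowInterval ξ x) :
    affineParameter ξ κ x t = (Real.exp (t * c) - 1) / c := by
  refine primitive_eq (k := fun u ↦ (Real.exp (u * c) - 1) / c)
    (continuousOn_exp_flowIntegral hξ hκ x) (ordConnected_flowInterval hξ x)
    (zero_mem_flowInterval hξ x) (fun u hu ↦ ?_) (by simp) ht
  have h := ((((hasDerivAt_id u).mul_const c).exp).sub_const 1).div_const c
  refine h.congr_deriv ?_
  rw [flowIntegral_eq_mul hξ hκ hc hu, one_mul, mul_div_cancel_right₀ _ hc0, id, mul_comm]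

theorem exists_isLUB_flowInterval (hξ : SmoothField ξ) (hx : finalParameter ξ univ x ≠ ⊤) :
    IsLUB (flowInterval ξ x) (finalParameter ξ univ x).toReal ∧
      finalParameter ξ univ x = ((finalParameter ξ univ x).toReal : EReal) := by
  have h0 := zero_mem_flowInterval hξ x
  have h := isLUB_finalParameter hξ x
  have hbot : finalParameter ξ univ x ≠ ⊥ := fun hb ↦ by
    have h1 := h.1 ⟨0, h0, rfl⟩
    rw [hb] at h1
    exact absurd (le_bot_iff.1 h1) (EReal.coe_ne_bot _)
  have heq := (EReal.coe_toReal hx hbot).symm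
  refine ⟨(isLUB_coe_image_iff ⟨0, h0⟩).1 ?_, heq⟩
  rw [← heq]
  exact h

theorem mem_flowInterval_of_finalParameter_eq_top (hξ : SmoothField ξ)
    (hx : finalParameter ξ univ x = ⊤) (ht : 0 ≤ t) : t ∈ flowInterval ξ x := by
  have h := isLUB_finalParameter hξ x
  rw [hx] at h
  obtain ⟨_, ⟨u, hu, rfl⟩, htu⟩ := (lt_isLUB_iff h).1 (EReal.coe_lt_top t)
  exact (ordConnected_flowInterval hξ x).out (zero_mem_flowInterval hξ x) hu
    ⟨ht, (EReal.coe_lt_coe_iff.1 htu).le⟩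

end ConstantSurfaceGravity

/-! ### Values of the length, forward saturation and completeness of the rescaled section. -/

section Conclusions

variable {E : Type*} [NormedAddCommGroup E] [NormedSpace ℝ E] [FiniteDimensional ℝ E]
  {M : Type*} [TopologicalSpace M] [ChartedSpace E M] [IsManifold 𝓘(ℝ, E) ∞ M] [T2Space M]
  {F : Type*} [NormedAddCommGroup F] [NormedSpace ℝ F] [FiniteDimensional ℝ F]
  {L : Type*} [TopologicalSpace L] [ChartedSpace F L] [IsManifold 𝓘(ℝ, F) ∞ L] [T2Space L]
  {g : LorentzianMetric E M} {i : L → M} {ξ : ∀ x : L, TangentSpace 𝓘(ℝ, F) x}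

namespace IsNullSection

theorem isLUB_affineInterval (h : IsNullSection g i ξ) {x : L}
    (hx : finalParameter ξ univ x ≠ ⊤) {k : ℝ → ℝ} (hk : Continuous k)
    (hS : ∀ t ∈ flowInterval ξ x, affineParameter ξ (g.surfaceGravity i ξ) x t = k t) :
    IsLUB (affineInterval ξ (g.surfaceGravity i ξ) x) (k (finalParameter ξ univ x).toReal) := by
  have hmono : MonotoneOn k (flowInterval ξ x) := by
    refine (strictMonoOn_affineParameter h.smoothField h.continuous_surfaceGravity
      x).monotoneOn.congr fun t ht ↦ hS t ht
  rw [affineInterval, image_congr hS]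
  exact (exists_isLUB_flowInterval h.smoothField hx).1.isLUB_of_tendsto hmono
    ⟨0, zero_mem_flowInterval h.smoothField x⟩ hk.continuousAt.continuousWithinAt

theorem futureAffineLength_eq_exp (h : IsNullSection g i ξ) {x : L} {c : ℝ} (hc0 : c ≠ 0)
    (hc : ∀ u ∈ flowInterval ξ x, g.surfaceGravity i ξ (flow ξ x u) = c)
    (hx : finalParameter ξ univ x ≠ ⊤) :
    g.futureAffineLength i ξ x
      = (((Real.exp ((finalParameter ξ univ x).toReal * c) - 1) / c : ℝ) : EReal) :=
  h.futureAffineLength_eq_coe_iff.2 <|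
    h.isLUB_affineInterval hx (k := fun t ↦ (Real.exp (t * c) - 1) / c) (by fun_prop) fun _ ht ↦
      affineParameter_eq_exp h.smoothField h.continuous_surfaceGravity hc0 hc ht

theorem futureAffineLength_eq_finalParameter (h : IsNullSection g i ξ) {x : L}
    (hc : ∀ u ∈ flowInterval ξ x, g.surfaceGravity i ξ (flow ξ x u) = 0)
    (hx : finalParameter ξ univ x ≠ ⊤) :
    g.futureAffineLength i ξ x = finalParameter ξ univ x := by
  rw [(exists_isLUB_flowInterval h.smoothField hx).2]
  exact h.futureAffineLength_eq_coe_iff.2 <|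
    h.isLUB_affineInterval hx (k := fun t ↦ t) continuous_id fun _ ht ↦
      affineParameter_eq_self h.smoothField h.continuous_surfaceGravity hc ht

theorem futureAffineLength_eq_neg_one_div (h : IsNullSection g i ξ) {x : L} {c : ℝ} (hc0 : c < 0)
    (hc : ∀ u ∈ flowInterval ξ x, g.surfaceGravity i ξ (flow ξ x u) = c)
    (hx : finalParameter ξ univ x = ⊤) :
    g.futureAffineLength i ξ x = ((-1 / c : ℝ) : EReal) := by
  rw [h.futureAffineLength_eq_coe_iff]
  constructor
  · rintro _ ⟨t, ht, rfl⟩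
    rw [affineParameter_eq_exp h.smoothField h.continuous_surfaceGravity hc0.ne hc ht]
    exact (div_le_div_right_of_neg hc0).2 (by linarith [Real.exp_pos (t * c)])
  · intro b hb
    have h1 : Filter.Tendsto (fun t : ℝ ↦ (Real.exp (t * c) - 1) / c) Filter.atTop
        (𝓝 ((0 - 1) / c)) :=
      ((Real.tendsto_exp_atBot.comp
        (Filter.tendsto_id.atTop_mul_const_of_neg hc0)).sub_const 1).div_const c
    rw [zero_sub] at h1
    refine le_of_tendsto h1 ((Filter.eventually_ge_atTop 0).mono fun t ht ↦ ?_)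
    have ht' := mem_flowInterval_of_finalParameter_eq_top h.smoothField hx ht
    exact hb ⟨t, ht', affineParameter_eq_exp h.smoothField h.continuous_surfaceGravity hc0.ne hc ht'⟩

theorem futureAffineLength_eq_top (h : IsNullSection g i ξ) {x : L} {c : ℝ} (hc0 : 0 ≤ c)
    (hc : ∀ u ∈ flowInterval ξ x, g.surfaceGravity i ξ (flow ξ x u) = c)
    (hx : finalParameter ξ univ x = ⊤) : g.futureAffineLength i ξ x = ⊤ := by
  rw [EReal.eq_top_iff_forall_lt]
  intro r
  have ht0 : 0 ≤ max r 0 + 1 := by positivity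
  have ht := mem_flowInterval_of_finalParameter_eq_top h.smoothField hx ht0
  -- For nonnegative `κ` the affine parameter dominates `t`, by `1 + a ≤ exp a`.
  have h1 : max r 0 + 1 ≤ affineParameter ξ (g.surfaceGravity i ξ) x (max r 0 + 1) := by
    rcases hc0.eq_or_lt with rfl | hpos
    · rw [affineParameter_eq_self h.smoothField h.continuous_surfaceGravity hc ht]
    · rw [affineParameter_eq_exp h.smoothField h.continuous_surfaceGravity hpos.ne' hc ht,
        le_div_iff₀ hpos]
      linarith [Real.add_one_le_exp ((max r 0 + 1) * c)]
  refine lt_of_lt_of_le (EReal.coe_lt_coe_iff.2 ?_)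
    ((h.isLUB_futureAffineLength x).1 ⟨_, ⟨_, ht, rfl⟩, rfl⟩)
  linarith [le_max_left r 0]

theorem eventually_futureAffineLength (h : IsNullSection g i ξ) {U : Set L} (hU : IsOpen U)
    (hfin : FiniteSmoothOn F (g.futureAffineLength i ξ) U) {x : L} (hx : x ∈ U) :
    ∀ᶠ t in 𝓝 (0 : ℝ), (g.futureAffineLength i ξ x).toReal
      = affineParameter ξ (g.surfaceGravity i ξ) x t
        + Real.exp (flowIntegral ξ (g.surfaceGravity i ξ) x t)
          * (g.futureAffineLength i ξ (flow ξ x t)).toReal := by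
  have h0 := zero_mem_flowInterval h.smoothField x
  filter_upwards [(isOpen_flowInterval h.smoothField x).mem_nhds h0,
    (hasMFDerivAt_flow h.smoothField h0).continuousAt.eventually_mem
      (hU.mem_nhds ((flow_zero h.smoothField x).symm ▸ hx))] with t ht htU
  rw [h.futureAffineLength_eq_of_flow ht
    (EReal.coe_toReal (hfin.1 _ htU).1 (hfin.1 _ htU).2).symm, EReal.toReal_coe]

theorem eventually_pastAffineLength (h : IsNullSection g i ξ) {U : Set L} (hU : IsOpen U)
    (hfin : FiniteSmoothOn F (g.pastAffineLength i ξ) U) {x : L} (hx : x ∈ U) :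
    ∀ᶠ t in 𝓝 (0 : ℝ), (g.pastAffineLength i ξ x).toReal
      = affineParameter ξ (g.surfaceGravity i ξ) x t
        + Real.exp (flowIntegral ξ (g.surfaceGravity i ξ) x t)
          * (g.pastAffineLength i ξ (flow ξ x t)).toReal := by
  have h0 := zero_mem_flowInterval h.smoothField x
  filter_upwards [(isOpen_flowInterval h.smoothField x).mem_nhds h0,
    (hasMFDerivAt_flow h.smoothField h0).continuousAt.eventually_mem
      (hU.mem_nhds ((flow_zero h.smoothField x).symm ▸ hx))] with t ht htU
  rw [h.pastAffineLength_eq_of_flow ht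
    (EReal.coe_toReal (hfin.1 _ htU).1 (hfin.1 _ htU).2).symm, EReal.toReal_coe]

theorem mem_affineInterval_of_lt_of_lt (h : IsNullSection g i ξ) {x : L} {s : ℝ}
    (h1 : g.pastAffineLength i ξ x < s) (h2 : s < g.futureAffineLength i ξ x) :
    s ∈ affineInterval ξ (g.surfaceGravity i ξ) x := by
  obtain ⟨_, ⟨u, hu, rfl⟩, hus⟩ := (isGLB_lt_iff (h.isGLB_pastAffineLength x)).1 h1
  obtain ⟨_, ⟨v, hv, rfl⟩, hsv⟩ := (lt_isLUB_iff (h.isLUB_futureAffineLength x)).1 h2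
  exact (ordConnected_affineInterval h.smoothField h.continuous_surfaceGravity x).out hu hv
    ⟨(EReal.coe_lt_coe_iff.1 hus).le, (EReal.coe_lt_coe_iff.1 hsv).le⟩

theorem subset_futureSaturation (h : IsNullSection g i ξ) (U : Set L) :
    U ⊆ futureSaturation ξ U := fun x hx ↦
  ⟨x, hx, 0, le_rfl, zero_mem_flowInterval h.smoothField x, flow_zero h.smoothField x⟩

/-- Points close to `Φ(x, t)` flow back by the same time `t` into the open set `U`. -/
theorem isOpen_futureSaturation (h : IsNullSection g i ξ) {U : Set L} (hU : IsOpen U) :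
    IsOpen (futureSaturation ξ U) := by
  rw [isOpen_iff_mem_nhds]
  rintro _ ⟨x, hx, t, ht0, ht, rfl⟩
  have ht' : t ∈ flowInterval ξ x := ht
  have h1 := eventually_flowSmoothAt h.smoothField h.contMDiff_surfaceGravity
    (neg_mem_flowInterval_flow h.smoothField ht')
  have h2 : ∀ᶠ z in 𝓝 (flow ξ x t), flow ξ z (-t) ∈ U :=
    h1.self_of_nhds.flow.continuousAt.eventually_mem
      (hU.mem_nhds ((flow_flow_neg h.smoothField ht').symm ▸ hx))
  filter_upwards [h1, h2] with z hz hzU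
  have h3 := neg_mem_flowInterval_flow h.smoothField hz.mem
  have h4 := flow_flow_neg h.smoothField hz.mem
  rw [neg_neg] at h3 h4
  exact ⟨_, hzU, t, ht0, h3, h4⟩

/-- The transport step is applied with the negative time that leads back into `U`. -/
theorem finiteSmoothOn_futureSaturation (h : IsNullSection g i ξ) {U : Set L} (hU : IsOpen U)
    (hfin : FiniteSmoothOn F (g.futureAffineLength i ξ) U) :
    FiniteSmoothOn F (g.futureAffineLength i ξ) (futureSaturation ξ U) := by
  have key : ∀ y ∈ futureSaturation ξ U,
      ∃ W : Set L, IsOpen W ∧ y ∈ W ∧ FiniteSmoothOn F (g.futureAffineLength i ξ) W := by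
    rintro _ ⟨x, hx, t, -, ht, rfl⟩
    have ht' : t ∈ flowInterval ξ x := ht
    exact h.exists_finiteSmoothOn (neg_mem_flowInterval_flow h.smoothField ht') hU
      ((flow_flow_neg h.smoothField ht').symm ▸ hx) hfin
  refine ⟨fun y hy ↦ ?_, fun y hy ↦ ?_⟩
  · obtain ⟨W, -, hyW, hW⟩ := key y hy
    exact hW.1 y hyW
  · obtain ⟨W, hWo, hyW, hW⟩ := key y hy
    exact ((hW.2 y hyW).contMDiffAt (hWo.mem_nhds hyW)).contMDiffWithinAt

/-- The integral curve is written down explicitly. In the affine parameter the remaining length is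
`l - s`, so the rescaled flow obeys `s' = l - s` and approaches `l` without reaching it in finite
time. -/
theorem finalParameter_futureRescaledSection (h : IsNullSection g i ξ) {U : Set L} (hU : IsOpen U)
    (hfin : FiniteSmoothOn F (g.futureAffineLength i ξ) U) {x : L} (hx : x ∈ U) :
    finalParameter (g.futureRescaledSection i ξ) (futureSaturation ξ U) x = ⊤ := by
  set κ := g.surfaceGravity i ξ with hκdef
  have hξ := h.smoothField
  have hκ : Continuous κ := h.continuous_surfaceGravity
  set l := (g.futureAffineLength i ξ x).toReal with hl
  have hlx : g.futureAffineLength i ξ x = (l : EReal) :=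
    (EReal.coe_toReal (hfin.1 x hx).1 (hfin.1 x hx).2).symm
  have hl0 : 0 < l := h.toReal_futureAffineLength_pos (hfin.1 x hx)
  have hlub : IsLUB (affineInterval ξ κ x) l := h.futureAffineLength_eq_coe_iff.1 hlx
  have hJ := isOpen_affineInterval hξ hκ x
  have hJc := ordConnected_affineInterval hξ hκ x
  have h0J : (0 : ℝ) ∈ affineInterval ξ κ x := zero_mem_affineInterval hξ x
  have hfin' := h.finiteSmoothOn_futureSaturation hU hfin
  -- This is the solution of `θ' = l - θ` with `θ 0 = 0`.
  set θ : ℝ → ℝ := fun τ ↦ l * (1 - Real.exp (-τ)) with hθ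
  have hθd : ∀ τ, HasDerivAt θ (l * Real.exp (-τ)) τ := fun τ ↦ by
    refine ((((hasDerivAt_neg τ).exp).const_sub 1).const_mul l).congr_deriv ?_
    ring
  have hθc : Continuous θ := by fun_prop
  have hθ0 : θ 0 = 0 := by simp [hθ]
  have hθm : Monotone θ := fun a b hab ↦ by
    have : Real.exp (-b) ≤ Real.exp (-a) := Real.exp_le_exp.2 (neg_le_neg hab)
    simp only [hθ]
    gcongr
  set γ : ℝ → L := fun τ ↦ flow ξ x (affineInverse ξ κ x (θ τ)) with hγ
  have hγ0 : γ 0 = x := by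
    simp only [hγ, hθ0]
    rw [affineInverse_zero hξ hκ, flow_zero hξ]
  set D : Set ℝ := θ ⁻¹' affineInterval ξ κ x with hD
  have hDo : IsOpen D := hJ.preimage hθc
  have hDc : D.OrdConnected := hJc.preimage_mono hθm
  have h0D : (0 : ℝ) ∈ D := by simpa [hD, hθ0] using h0J
  have hγd : ∀ τ ∈ D, HasMFDerivAt 𝓘(ℝ, ℝ) 𝓘(ℝ, F) γ τ ((1 : ℝ →L[ℝ] ℝ).smulRight
      ((Real.exp (-flowIntegral ξ κ x (affineInverse ξ κ x (θ τ))) * (l * Real.exp (-τ))) •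
        ξ (γ τ))) := fun τ hτ ↦ by
    have h1 := (hasDerivAt_affineInverse hξ hκ hτ).comp τ (hθd τ)
    have h2 := (hasMFDerivAt_flow hξ (affineInverse_mem hτ)).comp τ h1.hasFDerivAt.hasMFDerivAt
    refine h2.congr_mfderiv ?_
    ext
    exact smul_assoc (1 : ℝ) (Real.exp (-flowIntegral ξ κ x (affineInverse ξ κ x (θ τ))) *
      (l * Real.exp (-τ))) (ξ (γ τ))
  have hpos : ∀ τ, 0 ≤ τ → τ ∈ D := fun τ hτ ↦ by
    have h1 : θ τ < l := by
      have := mul_pos hl0 (Real.exp_pos (-τ))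
      simp only [hθ]
      linarith
    obtain ⟨u, hu, hτu⟩ := (lt_isLUB_iff hlub).1 h1
    exact hJc.out h0J hu ⟨hθ0 ▸ hθm hτ, hτu.le⟩
  -- Integral curves are required on an open interval around `0`. For small negative times the curve
  -- is kept in the open set `U` itself, since the saturation extends only forward.
  obtain ⟨a, b, ⟨ha, hb⟩, hab⟩ := mem_nhds_iff_exists_Ioo_subset.1
    ((hγd 0 h0D).continuousAt.eventually_mem (hU.mem_nhds (hγ0.symm ▸ hx)))
  have hmaps : MapsTo γ (D ∩ Ioi a) (futureSaturation ξ U) := by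
    rintro τ ⟨hτ, hτa⟩
    rcases lt_or_ge τ 0 with hneg | hnn
    · exact h.subset_futureSaturation U (hab ⟨hτa, hneg.trans hb⟩)
    · refine ⟨x, hx, _, ?_, affineInverse_mem hτ, rfl⟩
      rw [← (strictMonoOn_affineParameter hξ hκ x).le_iff_le (zero_mem_flowInterval hξ x)
        (affineInverse_mem hτ), affineParameter_zero, affineParameter_affineInverse hτ, ← hθ0]
      exact hθm hnn
  have hint : IsMIntegralCurveOn γ (g.futureRescaledSection i ξ) (D ∩ Ioi a) := by
    refine (isMIntegralCurveOn_iff_of_isOpen (hDo.inter isOpen_Ioi)).2 fun τ hτ ↦ ?_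
    have hft := hfin'.1 _ (hmaps hτ)
    -- The transport formula reads `l = θ τ + exp K · Λ⁺(γ τ)`, and `l - θ τ = l exp(-τ)`, so the
    -- speed of `γ` is precisely `Λ⁺(γ τ)`.
    have h1 := h.futureAffineLength_eq_of_flow (affineInverse_mem hτ.1)
      (EReal.coe_toReal hft.1 hft.2).symm
    rw [hlx, EReal.coe_eq_coe_iff, affineParameter_affineInverse hτ.1] at h1
    have h2 : Real.exp (-flowIntegral ξ κ x (affineInverse ξ κ x (θ τ))) * (l * Real.exp (-τ))
        = (g.futureAffineLength i ξ (γ τ)).toReal := by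
      rw [Real.exp_neg, inv_mul_eq_iff_eq_mul₀ (Real.exp_ne_zero _)]
      simp only [hθ] at h1 ⊢
      linarith
    have h3 := hγd τ hτ.1
    rw [h2] at h3
    exact h3
  rw [EReal.eq_top_iff_forall_lt]
  intro r
  have hr : (0 : ℝ) < max r 0 + 1 := by positivity
  refine lt_of_lt_of_le (EReal.coe_lt_coe_iff.2 (show r < max r 0 + 1 by
    linarith [le_max_left r 0])) (le_sSup ⟨_, rfl, hr, fun u hu ↦ ⟨γ, ?_⟩⟩)
  have h4 := isIntegralCurveFrom_of_isOpen (hDo.inter isOpen_Ioi) (hDc.inter ordConnected_Ioi)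
    ⟨h0D, ha⟩ hint hmaps ⟨hpos u hu.1, ha.trans_le hu.1⟩
  rwa [hγ0] at h4

end IsNullSection

end Conclusions

/-! ### Positive multiples of null sections, and the theorem. -/

section FutureNullSections

variable {E : Type*} [NormedAddCommGroup E] [NormedSpace ℝ E]
  {M : Type*} [TopologicalSpace M] [ChartedSpace E M] [IsManifold 𝓘(ℝ, E) ∞ M]
  {F : Type*} [NormedAddCommGroup F] [NormedSpace ℝ F]
  {L : Type*} [TopologicalSpace L] [ChartedSpace F L] [IsManifold 𝓘(ℝ, F) ∞ L]
  {g : TimeOrientedLorentzianMetric E M} {i : L → M} {ξ : ∀ x : L, TangentSpace 𝓘(ℝ, F) x}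

theorem IsFutureNullSectionOn.smul {U : Set L} (h : IsFutureNullSectionOn g i ξ U) {f : L → ℝ}
    (hf : ContMDiffOn 𝓘(ℝ, F) 𝓘(ℝ, ℝ) ∞ f U) (hpos : ∀ x ∈ U, 0 < f x) :
    IsFutureNullSectionOn g i (fun x ↦ f x • ξ x) U := by
  have hp : ∀ x, pushSection E i (fun x ↦ f x • ξ x) x = f x • pushSection E i ξ x := fun x ↦
    (mfderiv 𝓘(ℝ, F) 𝓘(ℝ, E) i x).map_smul (f x) (ξ x)
  refine ⟨hf.smul_section h.smooth, fun x hx ↦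
    ⟨smul_ne_zero (hpos x hx).ne' (h.null x hx).1, ?_⟩, fun x hx ↦ ?_⟩
  · rw [hp, map_smul, map_smul, smul_apply, (h.null x hx).2, smul_zero,
      smul_zero]
  · rw [hp, map_smul, smul_apply, smul_eq_mul]
    exact mul_neg_of_pos_of_neg (hpos x hx) (h.future x hx)

theorem IsFutureNullSectionOn.mono {U V : Set L} (h : IsFutureNullSectionOn g i ξ V)
    (hUV : U ⊆ V) : IsFutureNullSectionOn g i ξ U :=
  ⟨h.smooth.mono hUV, fun x hx ↦ h.null x (hUV hx), fun x hx ↦ h.future x (hUV hx)⟩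

theorem IsFutureNullSectionOn.isNullSection [FiniteDimensional ℝ E] [FiniteDimensional ℝ F]
    (h : IsFutureNullSectionOn g i ξ univ) (hi : IsNullHypersurface F g.toLorentzianMetric i) :
    IsNullSection g.toLorentzianMetric i ξ :=
  ⟨hi, contMDiffOn_univ.1 h.smooth, fun x ↦ (h.null x (mem_univ x)).1,
    fun x ↦ (h.null x (mem_univ x)).2⟩

end FutureNullSections
theorem mainTheorem4
    {E : Type*} [NormedAddCommGroup E] [NormedSpace ℝ E] [FiniteDimensional ℝ E]
    {M : Type*} [TopologicalSpace M] [ChartedSpace E M] [IsManifold 𝓘(ℝ, E) ∞ M]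
    [T2Space M] [SecondCountableTopology M] [ConnectedSpace M]
    (hdim : 3 ≤ Module.finrank ℝ E)
    (g : TimeOrientedLorentzianMetric E M)
    {F : Type*} [NormedAddCommGroup F] [NormedSpace ℝ F] [FiniteDimensional ℝ F]
    {L : Type*} [TopologicalSpace L] [ChartedSpace F L] [IsManifold 𝓘(ℝ, F) ∞ L]
    (i : L → M) (hi : IsNullHypersurface F g.toLorentzianMetric i)
    (ξ : ∀ x : L, TangentSpace 𝓘(ℝ, F) x) (hξ : IsFutureNullSectionOn g i ξ univ) :
    -- (1)
    (∀ (x : L) (s : ℝ), g.pastAffineLength i ξ x < s → s < g.futureAffineLength i ξ x →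
      ∀ V : Set L, IsOpen V → g.affineFlow i ξ x s ∈ V →
        FiniteSmoothOn F (g.futureAffineLength i ξ) V →
        ∃ U : Set L, IsOpen U ∧ x ∈ U ∧ FiniteSmoothOn F (g.futureAffineLength i ξ) U) ∧
    -- (2)
    (∀ U : Set L, IsOpen U → FiniteSmoothOn F (g.futureAffineLength i ξ) U →
      (∀ x ∈ U, directionalDeriv (fun y ↦ (g.futureAffineLength i ξ y).toReal) x (ξ x)
          + g.surfaceGravity i ξ x * (g.futureAffineLength i ξ x).toReal + 1 = 0) ∧
      IsFutureNullSectionOn g i (g.futureRescaledSection i ξ) U ∧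
      (∀ x ∈ U, g.surfaceGravity i (g.futureRescaledSection i ξ) x = -1) ∧
      IsOpen (futureSaturation ξ U) ∧
      FiniteSmoothOn F (g.futureAffineLength i ξ) (futureSaturation ξ U) ∧
      (∀ x ∈ U, finalParameter (g.futureRescaledSection i ξ) (futureSaturation ξ U) x = ⊤)) ∧
    -- (3)
    (∀ x : L, (∀ y ∈ generator ξ x, g.surfaceGravity i ξ y = g.surfaceGravity i ξ x) →
      (finalParameter ξ univ x ≠ ⊤ → g.surfaceGravity i ξ x ≠ 0 →
        g.futureAffineLength i ξ x =
          (((Real.exp ((finalParameter ξ univ x).toReal * g.surfaceGravity i ξ x) - 1)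
            / g.surfaceGravity i ξ x : ℝ) : EReal)) ∧
      (finalParameter ξ univ x ≠ ⊤ → g.surfaceGravity i ξ x = 0 →
        g.futureAffineLength i ξ x = finalParameter ξ univ x) ∧
      (finalParameter ξ univ x = ⊤ → g.surfaceGravity i ξ x < 0 →
        g.futureAffineLength i ξ x = ((-1 / g.surfaceGravity i ξ x : ℝ) : EReal)) ∧
      (finalParameter ξ univ x = ⊤ → 0 ≤ g.surfaceGravity i ξ x →
        g.futureAffineLength i ξ x = ⊤)) ∧
    ((∀ x : L, finalParameter ξ univ x = ⊤) →
      (∀ x : L, g.surfaceGravity i ξ x < 0 ∧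
        ∀ y ∈ generator ξ x, g.surfaceGravity i ξ y = g.surfaceGravity i ξ x) →
      FiniteSmoothOn F (g.futureAffineLength i ξ) univ) ∧
    -- (4)
    (FiniteSmoothOn F (g.pastAffineLength i ξ) univ →
      FiniteSmoothOn F (g.futureAffineLength i ξ) univ →
      IsFutureNullSectionOn g i (g.doublyRescaledSection i ξ) univ ∧
        ∀ x : L, g.sectionAccel i (g.doublyRescaledSection i ξ) x = 0) := by
  have : T2Space L := hi.isSmoothEmbedding.isEmbedding.t2Space
  have h : IsNullSection g.toLorentzianMetric i ξ := hξ.isNullSection hi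
  have hpde : ∀ U : Set L, IsOpen U → FiniteSmoothOn F (g.futureAffineLength i ξ) U →
      ∀ x ∈ U, directionalDeriv (fun y ↦ (g.futureAffineLength i ξ y).toReal) x (ξ x)
          + g.surfaceGravity i ξ x * (g.futureAffineLength i ξ x).toReal + 1 = 0 :=
    fun U hU hfin x hx ↦ h.directionalDeriv_add_eq_zero
      (((hfin.2 x hx).contMDiffAt (hU.mem_nhds hx)).mdifferentiableAt (by simp))
      (h.eventually_futureAffineLength hU hfin hx)
  refine ⟨fun x s h1 h2 V hV hsV hfin ↦ ?_, fun U hU hfin ↦ ⟨hpde U hU hfin, ?_, fun x hx ↦ ?_,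
    h.isOpen_futureSaturation hU, h.finiteSmoothOn_futureSaturation hU hfin,
    fun x hx ↦ h.finalParameter_futureRescaledSection hU hfin hx⟩, fun x hconst ↦ ?_,
    fun hb hκ ↦ ?_, fun hfin' hfin ↦ ?_⟩
  -- A parameter strictly between the two lengths lies in the affine interval, so `exp(s ξ_x)` is a
  -- flow point of `x` and regularity there is transported back.
  · have hs := h.mem_affineInterval_of_lt_of_lt h1 h2
    rw [h.affineFlow_eq hs] at hsV
    exact h.exists_finiteSmoothOn (affineInverse_mem hs) hV hsV hfin
  · exact (hξ.mono (subset_univ U)).smul hfin.2 fun x hx ↦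
      h.toReal_futureAffineLength_pos (hfin.1 x hx)
  · have hf := ((hfin.2 x hx).contMDiffAt (hU.mem_nhds hx)).mdifferentiableAt (by simp)
    refine (h.surfaceGravity_smul hf
      (h.toReal_futureAffineLength_pos (hfin.1 x hx)).ne').trans ?_
    linarith [hpde U hU hfin x hx]
  · have hc : ∀ u ∈ flowInterval ξ x, g.surfaceGravity i ξ (flow ξ x u) = g.surfaceGravity i ξ x :=
      fun u hu ↦ hconst _ ⟨u, hu, rfl⟩
    exact ⟨fun hx hκ ↦ h.futureAffineLength_eq_exp hκ hc hx,
      fun hx hκ ↦ h.futureAffineLength_eq_finalParameter (hκ ▸ hc) hx,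
      fun hx hκ ↦ h.futureAffineLength_eq_neg_one_div hκ hc hx,
      fun hx hκ ↦ h.futureAffineLength_eq_top hκ hc hx⟩
  · have heq : ∀ x, g.futureAffineLength i ξ x = ((-1 / g.surfaceGravity i ξ x : ℝ) : EReal) :=
      fun x ↦ h.futureAffineLength_eq_neg_one_div (hκ x).1
        (fun u hu ↦ (hκ x).2 _ ⟨u, hu, rfl⟩) (hb x)
    refine ⟨fun x _ ↦ by rw [heq]; exact ⟨EReal.coe_ne_top _, EReal.coe_ne_bot _⟩, ?_⟩
    simp only [heq, EReal.toReal_coe, contMDiffOn_univ]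
    exact contMDiff_const.div₀ h.contMDiff_surfaceGravity fun x ↦ (hκ x).1.ne
  · have hpos : ∀ x, 0 < (g.futureAffineLength i ξ x).toReal
        - (g.pastAffineLength i ξ x).toReal := fun x ↦ by
      linarith [h.toReal_futureAffineLength_pos (hfin.1 x (mem_univ x)),
        h.toReal_pastAffineLength_nonpos (hfin'.1 x (mem_univ x))]
    refine ⟨hξ.smul (hfin.2.sub hfin'.2) fun x _ ↦ hpos x, fun x ↦ ?_⟩
    have hf₁ := (contMDiffOn_univ.1 hfin.2 x).mdifferentiableAt (by simp)
    have hf₂ := (contMDiffOn_univ.1 hfin'.2 x).mdifferentiableAt (by simp)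
    have h1 := hpde univ isOpen_univ hfin x (mem_univ x)
    -- Both lengths solve the same inhomogeneous linear equation, so their difference `f` satisfies
    -- `ξ(f) + κ f = 0`, and this is the coefficient of `f ξ` in `∇_{fξ} (fξ)`.
    have h2 := h.directionalDeriv_add_eq_zero hf₂
      (h.eventually_pastAffineLength isOpen_univ hfin' (mem_univ x))
    have h3 : directionalDeriv (fun y ↦ (g.futureAffineLength i ξ y).toReal
        - (g.pastAffineLength i ξ y).toReal) x (ξ x)
        = directionalDeriv (fun y ↦ (g.futureAffineLength i ξ y).toReal) x (ξ x)
          - directionalDeriv (fun y ↦ (g.pastAffineLength i ξ y).toReal) x (ξ x) :=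
      DFunLike.congr_fun (hf₁.hasMFDerivAt.sub hf₂.hasMFDerivAt).mfderiv (ξ x)
    refine (h.pushAccel_smul (hf₁.sub hf₂)).trans ?_
    rw [show directionalDeriv ((fun y ↦ (g.futureAffineLength i ξ y).toReal)
      - fun y ↦ (g.pastAffineLength i ξ y).toReal) x (ξ x) = _ from h3]
    simp only [Pi.sub_apply]
    rw [show ∀ a b k p q : ℝ, a + k * p + 1 = 0 → b + k * q + 1 = 0 → a - b + k * (p - q) = 0 from
      fun a b k p q h1 h2 ↦ by linarith, zero_smul]
    · rfl
    · exact h1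
    · exact h2
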